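/- Let $F$ be an algebraically closed field with $\operatorname{char} F\neq 2$ and let $p,q\in F^\times$ be elements that are not roots of unity. For $n\ge 0$ let $\mathcal H_n$ be the affine Hecke algebra of type $B_n$: the unital associative $F$-algebra with generators $X_0^{\pm1},\dots,X_n^{\pm1}$ (which commute with one another, $X_j^{-1}$ being inverse to $X_j$) and $T_0,\dots,T_{n-1}$, and relations $(T_0-p)(T_0+p^{-1})=0$; $(T_i-q)(T_i+q^{-1})=0$ for $i\ge1$; $T_iT_{i+1}T_i=T_{i+1}T_iT_{i+1}$ for $i\ge 1$; $T_iT_j=T_jT_i$ for $|i-j|>1$; $T_1T_0T_1T_0=T_0T_1T_0T_1$; $T_0X_0T_0=X_0X_1$; $T_iX_j=X_jT_i$ for $j\ne i,i+1$; $T_iX_iT_i=X_{i+1}$ for $i\ge1$ (whenever the indices occur; so $\mathcal H_0=F[X_0^{\pm1}]$). All modules are finite-dimensional left modules. There is the map $\mathcal H_{n-1}\to\mathcal H_n$ sending $T_i\mapsto T_i$, $X_j\mapsto X_j$; together with $X_n$ it gives the parabolic subalgebra $\mathcal H_{n-1,1}\cong\mathcal H_{n-1}\otimes F[X_n^{\pm1}]$.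 Let $a\in F^\times$. For an $\mathcal H_n$-module $M$ and $0\le m\le n$ let $\Delta_{a^{(m)}}M$ be the simultaneous generalized $a$-eigenspace of $X_{n-m+1},\dots,X_n$ in $M$, and for $M\neq0$ put $\epsilon_a(M)=\max\{m\mid \Delta_{a^{(m)}}M\ne0\}$. For $n\ge1$ let $e_aM$ be the generalized $a$-eigenspace of $X_n$ in $M$, regarded as an $\mathcal H_{n-1}$-module, and for an $\mathcal H_{n-1}$-module $N$ let $f_aN=\operatorname{ind}_{\mathcal H_{n-1,1}}^{\mathcal H_n}(N\boxtimes(a))$, where $X_n$ acts on $N\boxtimes (a)$ by $a$. For irreducible $M$, $N$ put $\tilde e_aM=\operatorname{soc} e_aM$ (the largest semisimple submodule) and $\tilde f_aN=\operatorname{cosoc} f_aN$ (the largest semisimple quotient). Let $n\ge1$ and $a\in F^\times\setminus\{\pm1\}$. Then: (1) If $M$ is an irreducible $\mathcal H_n$-module with $\epsilon_a(M)>0$, then $\tilde e_aM=\operatorname{soc} e_aM$ is irreducible and $\epsilon_a(\operatorname{soc} e_aM)=\epsilon_a(M)-1$. If $\epsilon_a(M)=0$, then $\tilde e_aM=0$.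 (2) If $N$ is an irreducible $\mathcal H_{n-1}$-module, then $\tilde f_aN$ is irreducible (and finite-dimensional). (3) For irreducible modules $M$ over $\mathcal H_n$ and $N$ over $\mathcal H_{n-1}$: $\tilde e_aM\cong N$ if and only if $\tilde f_aN\cong M$. (4) Hence $\tilde e_a$ and $\tilde f_a$ induce mutually inverse partial bijections between the set of isomorphism classes of irreducible $\mathcal H_n$-modules and the set of isomorphism classes of irreducible $\mathcal H_{n-1}$-modules: $\tilde e_a$ is defined exactly on the classes with $\epsilon_a>0$, $\tilde f_a$ is defined on all classes of irreducible $\mathcal H_{n-1}$-modules. -/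

import Mathlib

open scoped TensorProduct

universe u v w

/-! ## Socle, cosocle, restriction and induction -/

section General

/-- The socle of a module: the sum of its simple submodules. -/
def socle (A : Type*) [Ring A] (M : Type*) [AddCommGroup M] [Module A M] : Submodule A M :=
  sSup {S : Submodule A M | IsSimpleModule A S}

/-- The cosocle of a module of finite length, i.e. its largest semisimple quotient: the quotient
by the intersection of all maximal submodules. That it is the largest semisimple
quotient is proved in `cosocle_isSemisimple` and `cosocle_largest`. -/
abbrev Cosocle (A : Type*) [Ring A] (M : Type*) [AddCommGroup M] [Module A M] :=
  M ⧸ Module.jacobson A M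

theorem cosocle_isSemisimple (A : Type*) [Ring A] (M : Type*) [AddCommGroup M] [Module A M]
    [IsArtinian A M] : IsSemisimpleModule A (Cosocle A M) :=
  (IsArtinian.isSemisimpleModule_iff_jacobson A (Cosocle A M)).2
    (Module.jacobson_quotient_jacobson A M)

theorem cosocle_largest (A : Type*) [Ring A] (M : Type*) [AddCommGroup M] [Module A M]
    (S : Submodule A M) [IsSemisimpleModule A (M ⧸ S)] : Module.jacobson A M ≤ S := by
  have h := Module.le_comap_jacobson S.mkQ
  rw [IsSemisimpleModule.jacobson_eq_bot A (M ⧸ S)] at h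
  intro x hx
  simpa using h hx

variable {F A B : Type*} [Field F] [Ring A] [Algebra F A] [Ring B] [Algebra F B]

/-- The restriction `res M` of an `A`-module `M` along an algebra map `φ : B → A`. -/
def Res (_φ : B →ₐ[F] A) (M : Type*) : Type _ := M

section Res
variable (φ : B →ₐ[F] A) (M : Type*) [AddCommGroup M] [Module F M] [Module A M]
  [IsScalarTower F A M]

instance : AddCommGroup (Res φ M) := inferInstanceAs (AddCommGroup M)
instance : Module F (Res φ M) := inferInstanceAs (Module F M)
instance : Module B (Res φ M) := Module.compHom M φ.toRingHom

instance : IsScalarTower F B (Res φ M) := ⟨fun r b m => by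
  change (φ (r • b) • (show M from m) : M) = (r • (φ b • (show M from m)) : M)
  rw [map_smul, smul_assoc]⟩

end Res

/-- The induced module `ind N = A ⊗_B N` along an algebra map `φ : B → A`, as the quotient of the
left `A`-module `A ⊗_F N` by the `A`-submodule generated by all `φ b ⊗ v - 1 ⊗ b v`. -/
abbrev Ind (φ : B →ₐ[F] A) (N : Type*) [AddCommGroup N] [Module F N] [Module B N] :=
  (A ⊗[F] N) ⧸ Submodule.span A
    {z : A ⊗[F] N | ∃ (b : B) (v : N), z = φ b ⊗ₜ[F] v - (1 : A) ⊗ₜ[F] (b • v)}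

/-- Evaluation `F[T, T⁻¹] → A` of Laurent polynomials at a unit `x` of `A`. -/
noncomputable def laurentEval (x : Aˣ) : LaurentPolynomial F →ₐ[F] A :=
  AddMonoidAlgebra.lift F A ℤ ((Units.coeHom A).comp (zpowersHom Aˣ x))

/-- The algebra map `B ⊗ F[T, T⁻¹] → B` which is the identity on `B` and sends `T` to `a`. -/
noncomputable def evalRight (B : Type*) [Ring B] [Algebra F B] (a : Fˣ) :
    B ⊗[F] LaurentPolynomial F →ₐ[F] B :=
  Algebra.TensorProduct.lift (AlgHom.id F B) ((Algebra.ofId F B).comp (laurentEval a))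
    (fun b t => (Algebra.commutes (laurentEval a t) b).symm)

/-- The outer tensor product `N ⊠ (a)` of a `B`-module `N` with the one-dimensional
`F[T, T⁻¹]`-module `(a)` on which `T` acts by `a`: its underlying space is `N = N ⊗ F`, on which
`B` acts as on `N` and `T` acts by `a`. -/
abbrev OuterChar (B : Type*) [Ring B] [Algebra F B] (a : Fˣ) (N : Type*) :=
  Res (evalRight B a) N

end General

/-! ## The affine Hecke algebra of type `B` -/

section Hecke

/-- The generators `T_0, …, T_{n-1}` and `X_0^{±1}, …, X_n^{±1}`. -/
inductive HeckeGen (n : ℕ) : Type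
  | T (i : Fin n) : HeckeGen n
  | X (j : Fin (n + 1)) : HeckeGen n
  | Xinv (j : Fin (n + 1)) : HeckeGen n

variable (F : Type u) [Field F] (p q : F)

open FreeAlgebra HeckeGen in
/-- The defining relations. For `i : Fin n`, the indices `i` and `i + 1` of the `X`s are
`i.castSucc` and `i.succ`. -/
inductive HeckeRel (n : ℕ) : FreeAlgebra F (HeckeGen n) → FreeAlgebra F (HeckeGen n) → Prop
  | X_comm (j k : Fin (n + 1)) : HeckeRel n (ι F (X j) * ι F (X k)) (ι F (X k) * ι F (X j))
  | X_Xinv (j : Fin (n + 1)) : HeckeRel n (ι F (X j) * ι F (Xinv j)) 1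
  | Xinv_X (j : Fin (n + 1)) : HeckeRel n (ι F (Xinv j) * ι F (X j)) 1
  | quad_zero (i : Fin n) (hi : (i : ℕ) = 0) :
      HeckeRel n ((ι F (T i) - algebraMap F _ p) * (ι F (T i) + algebraMap F _ p⁻¹)) 0
  | quad (i : Fin n) (hi : 1 ≤ (i : ℕ)) :
      HeckeRel n ((ι F (T i) - algebraMap F _ q) * (ι F (T i) + algebraMap F _ q⁻¹)) 0
  | braid (i j : Fin n) (hi : 1 ≤ (i : ℕ)) (hj : (j : ℕ) = i + 1) :
      HeckeRel n (ι F (T i) * ι F (T j) * ι F (T i)) (ι F (T j) * ι F (T i) * ι F (T j))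
  | T_comm (i j : Fin n) (h : (i : ℕ) + 1 < j) :
      HeckeRel n (ι F (T i) * ι F (T j)) (ι F (T j) * ι F (T i))
  | braid_zero (i j : Fin n) (hi : (i : ℕ) = 0) (hj : (j : ℕ) = 1) :
      HeckeRel n (ι F (T j) * ι F (T i) * ι F (T j) * ι F (T i))
        (ι F (T i) * ι F (T j) * ι F (T i) * ι F (T j))
  | mixed_zero (i : Fin n) (hi : (i : ℕ) = 0) :
      HeckeRel n (ι F (T i) * ι F (X i.castSucc) * ι F (T i))
        (ι F (X i.castSucc) * ι F (X i.succ))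
  | mixed_comm (i : Fin n) (j : Fin (n + 1)) (h1 : j ≠ i.castSucc) (h2 : j ≠ i.succ) :
      HeckeRel n (ι F (T i) * ι F (X j)) (ι F (X j) * ι F (T i))
  | mixed (i : Fin n) (hi : 1 ≤ (i : ℕ)) :
      HeckeRel n (ι F (T i) * ι F (X i.castSucc) * ι F (T i)) (ι F (X i.succ))

/-- The affine Hecke algebra `ℋ_n` of type `B_n` with parameters `p`, `q`;
`ℋ_0 = F[X_0, X_0⁻¹]`. -/
def Hecke (n : ℕ) : Type u := RingQuot (HeckeRel F p q n)

noncomputable instance (n : ℕ) : Ring (Hecke F p q n) :=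
  inferInstanceAs (Ring (RingQuot (HeckeRel F p q n)))

noncomputable instance (n : ℕ) : Algebra F (Hecke F p q n) :=
  inferInstanceAs (Algebra F (RingQuot (HeckeRel F p q n)))

namespace Hecke

noncomputable def mk (n : ℕ) : FreeAlgebra F (HeckeGen n) →ₐ[F] Hecke F p q n :=
  RingQuot.mkAlgHom F (HeckeRel F p q n)

theorem mk_rel {n : ℕ} {x y : FreeAlgebra F (HeckeGen n)} (h : HeckeRel F p q n x y) :
    mk F p q n x = mk F p q n y :=
  RingQuot.mkAlgHom_rel F h

theorem mk_surjective (n : ℕ) : Function.Surjective (mk F p q n) :=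
  RingQuot.mkAlgHom_surjective F _

variable {n : ℕ}

noncomputable def T (i : Fin n) : Hecke F p q n := mk F p q n (FreeAlgebra.ι F (.T i))

/-- The lattice operator `X_j`, as a unit. -/
noncomputable def X (j : Fin (n + 1)) : (Hecke F p q n)ˣ where
  val := mk F p q n (FreeAlgebra.ι F (.X j))
  inv := mk F p q n (FreeAlgebra.ι F (.Xinv j))
  val_inv := by rw [← map_mul, mk_rel F p q (.X_Xinv j), map_one]
  inv_val := by rw [← map_mul, mk_rel F p q (.Xinv_X j), map_one]

noncomputable def inclGen : HeckeGen n → Hecke F p q (n + 1)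
  | .T i => T F p q i.castSucc
  | .X j => X F p q j.castSucc
  | .Xinv j => ((X F p q j.castSucc)⁻¹ : (Hecke F p q (n + 1))ˣ)

theorem X_comm (j k : Fin (n + 1)) :
    (X F p q j : Hecke F p q n) * X F p q k = X F p q k * X F p q j := by
  simpa only [map_mul, X] using mk_rel F p q (.X_comm j k)

/-- The embedding `ℋ_n → ℋ_{n+1}` given by `T_i ↦ T_i`, `X_j ↦ X_j`. -/
noncomputable def incl (n : ℕ) : Hecke F p q n →ₐ[F] Hecke F p q (n + 1) :=
  RingQuot.liftAlgHom F ⟨FreeAlgebra.lift F (inclGen F p q), by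
    intro x y h
    induction h with
    | X_comm j k => simpa [inclGen] using X_comm F p q j.castSucc k.castSucc
    | X_Xinv j => simp [inclGen]
    | Xinv_X j => simp [inclGen]
    | quad_zero i hi =>
      simpa [inclGen, T] using mk_rel F p q (.quad_zero i.castSucc hi)
    | quad i hi => simpa [inclGen, T] using mk_rel F p q (.quad i.castSucc hi)
    | braid i j hi hj =>
      simpa [inclGen, T] using mk_rel F p q (.braid i.castSucc j.castSucc hi hj)
    | T_comm i j h => simpa [inclGen, T] using mk_rel F p q (.T_comm i.castSucc j.castSucc h)
    | braid_zero i j hi hj =>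
      simpa [inclGen, T] using mk_rel F p q (.braid_zero i.castSucc j.castSucc hi hj)
    | mixed_zero i hi =>
      simpa [inclGen, T, X] using mk_rel F p q (.mixed_zero i.castSucc hi)
    | mixed_comm i j h1 h2 =>
      have h1' : j.castSucc ≠ i.castSucc.castSucc := fun h => h1 (Fin.castSucc_injective _ h)
      have h2' : j.castSucc ≠ i.castSucc.succ := fun h => h2 (Fin.castSucc_injective _ h)
      simpa [inclGen, T, X] using mk_rel F p q (.mixed_comm i.castSucc j.castSucc h1' h2')
    | mixed i hi => simpa [inclGen, T, X] using mk_rel F p q (.mixed i.castSucc hi)⟩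

theorem incl_mk (x : FreeAlgebra F (HeckeGen n)) :
    incl F p q n (mk F p q n x) = FreeAlgebra.lift F (inclGen F p q) x :=
  RingQuot.liftAlgHom_mkAlgHom_apply F _ _ x

/-- `X_{n+1}` commutes with `ℋ_n` in `ℋ_{n+1}`. -/
theorem incl_commute (h : Hecke F p q n) :
    Commute (incl F p q n h) (X F p q (Fin.last (n + 1)) : Hecke F p q (n + 1)) := by
  obtain ⟨x, rfl⟩ := mk_surjective F p q n h
  rw [incl_mk]
  induction x using FreeAlgebra.induction with
  | grade0 r => rw [AlgHom.commutes]; exact Algebra.commutes r _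
  | add x y hx hy => rw [map_add]; exact hx.add_left hy
  | mul x y hx hy => rw [map_mul]; exact hx.mul_left hy
  | grade1 g =>
    rw [FreeAlgebra.lift_ι_apply]
    have hX (j : Fin (n + 1)) := X_comm F p q j.castSucc (Fin.last (n + 1))
    cases g with
    | X j => exact hX j
    | Xinv j => exact Commute.units_inv_left (hX j)
    | T i =>
      have h1 : Fin.last (n + 1) ≠ i.castSucc.castSucc := by
        intro h; have := congrArg Fin.val h; simp at this; omega
      have h2 : Fin.last (n + 1) ≠ i.castSucc.succ := by
        intro h; have := congrArg Fin.val h; simp at this; omega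
      have h := mk_rel F p q (.mixed_comm i.castSucc _ h1 h2)
      rw [map_mul, map_mul] at h
      exact h

theorem laurentEval_X_commute (h : Hecke F p q (n + 1))
    (hc : Commute h (X F p q (Fin.last (n + 1)) : Hecke F p q (n + 1)))
    (t : LaurentPolynomial F) :
    Commute h (laurentEval (F := F) (X F p q (Fin.last (n + 1))) t) := by
  induction t using AddMonoidAlgebra.induction_linear with
  | zero => simp
  | add f g hf hg => rw [map_add]; exact hf.add_right hg
  | single k r =>
    simp only [laurentEval, AddMonoidAlgebra.lift_single]
    refine Commute.smul_right ?_ r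
    simpa using hc.units_zpow_right k

variable (n) in
/-- The parabolic `ℋ_{n,1} ≅ ℋ_n ⊗ F[X_{n+1}, X_{n+1}⁻¹]` of `ℋ_{n+1}`. -/
abbrev Par := Hecke F p q n ⊗[F] LaurentPolynomial F

variable (n) in
/-- The embedding of the parabolic `ℋ_{n,1}` into `ℋ_{n+1}`: it is `incl` on `ℋ_n` and sends
the Laurent variable to `X_{n+1}`. -/
noncomputable def parIncl : Par F p q n →ₐ[F] Hecke F p q (n + 1) :=
  Algebra.TensorProduct.lift (incl F p q n) (laurentEval (X F p q (Fin.last (n + 1))))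
    (fun h t => laurentEval_X_commute F p q _ (incl_commute F p q h) t)

theorem parIncl_commute (b : Par F p q n) :
    Commute (parIncl F p q n b) (X F p q (Fin.last (n + 1)) : Hecke F p q (n + 1)) := by
  induction b using TensorProduct.induction_on with
  | zero => simp
  | add x y hx hy => rw [map_add]; exact hx.add_left hy
  | tmul x t =>
    rw [parIncl, Algebra.TensorProduct.lift_tmul]
    exact (incl_commute F p q x).mul_left
      (laurentEval_X_commute F p q _ (Commute.refl _) t).symm

end Hecke

end Hecke

/-! ## The functors `Δ_a`, `e_a`, `f_a`, the number `ε_a`, and the operators -/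

section Operators

open Hecke

variable {F : Type u} [Field F] (p q : F)

section Up

variable (n : ℕ) (a : Fˣ) (M : Type v) [AddCommGroup M] [Module F M] [Module (Hecke F p q n) M]
  [IsScalarTower F (Hecke F p q n) M]

/-- The space `Δ_{a^(m)} M` of an `ℋ_n`-module `M`: the simultaneous generalized `a`-eigenspace
of `X_{n-m+1}, …, X_n`. -/
noncomputable def deltaPow (m : ℕ) : Submodule F M :=
  ⨅ (i : Fin (n + 1)) (_ : n < (i : ℕ) + m),
    Module.End.maxGenEigenspace (Algebra.lsmul F F M (X F p q i : Hecke F p q n)) (a : F)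

/-- `ε_a(M) = max {m ≥ 0 | Δ_{a^(m)} M ≠ 0}`, where `m ≤ n` for an `ℋ_n`-module `M`. -/
noncomputable def epsilon : ℕ := sSup {m : ℕ | m ≤ n ∧ deltaPow p q n a M m ≠ ⊥}

end Up

variable (n : ℕ) (a : Fˣ)

section Down

variable (M : Type v) [AddCommGroup M] [Module F M] [Module (Hecke F p q (n + 1)) M]
  [IsScalarTower F (Hecke F p q (n + 1)) M]

/-- `Δ_a M` for an `ℋ_{n+1}`-module `M`: the generalized `a`-eigenspace of `X_{n+1}`, as a module
over the parabolic `ℋ_{n,1}`. -/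
noncomputable def delta : Submodule (Par F p q n) (Res (parIncl F p q n) M) where
  carrier := {m : M | m ∈ Module.End.maxGenEigenspace (Algebra.lsmul F F M
    (X F p q (Fin.last (n + 1)) : Hecke F p q (n + 1))) (a : F)}
  zero_mem' := (Module.End.maxGenEigenspace (Algebra.lsmul F F M
    (X F p q (Fin.last (n + 1)) : Hecke F p q (n + 1))) (a : F)).zero_mem
  add_mem' := (Module.End.maxGenEigenspace (Algebra.lsmul F F M
    (X F p q (Fin.last (n + 1)) : Hecke F p q (n + 1))) (a : F)).add_mem
  smul_mem' := fun b m hm => by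
    refine Module.End.mapsTo_maxGenEigenspace_of_comm
      (f := Algebra.lsmul F F M (X F p q (Fin.last (n + 1)) : Hecke F p q (n + 1)))
      (g := Algebra.lsmul F F M (parIncl F p q n b)) ?_ (a : F) hm
    exact ((parIncl_commute F p q b).map (Algebra.lsmul F F M)).symm

/-- `e_a M`: the restriction of `Δ_a M` to `ℋ_n`. -/
abbrev eFun := Res (Algebra.TensorProduct.includeLeft : Hecke F p q n →ₐ[F] Par F p q n)
  (delta p q n a M)

/-- `ẽ_a M = soc e_a M`. -/
noncomputable abbrev eTilde : Submodule (Hecke F p q n) (eFun p q n a M) :=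
  socle (Hecke F p q n) (eFun p q n a M)

end Down

variable (N : Type v) [AddCommGroup N] [Module F N] [Module (Hecke F p q n) N]
  [IsScalarTower F (Hecke F p q n) N]

/-- `f_a N = ind (N ⊠ (a))`, the induction being from `ℋ_{n,1}` to `ℋ_{n+1}`. -/
abbrev fFun := Ind (parIncl F p q n) (OuterChar (Hecke F p q n) a N)

/-- `f̃_a N = cosoc f_a N`. -/
abbrev fTilde := Cosocle (Hecke F p q (n + 1)) (fFun p q n a N)

end Operators

/-! ## Isomorphism classes of irreducible modules -/

section Classes

variable (F : Type u) [Field F] (p q : F)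

/-- An irreducible finite-dimensional `ℋ_n`-module. -/
structure IrrRep (n : ℕ) where
  carrier : Type u
  [addCommGroup : AddCommGroup carrier]
  [moduleField : Module F carrier]
  [module : Module (Hecke F p q n) carrier]
  [isScalarTower : IsScalarTower F (Hecke F p q n) carrier]
  [finiteDimensional : FiniteDimensional F carrier]
  [isSimple : IsSimpleModule (Hecke F p q n) carrier]

attribute [instance] IrrRep.addCommGroup IrrRep.moduleField IrrRep.module
  IrrRep.isScalarTower IrrRep.finiteDimensional IrrRep.isSimple

/-- Isomorphism of irreducible modules. -/
instance irrSetoid (n : ℕ) : Setoid (IrrRep F p q n) where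
  r M N := Nonempty (M.carrier ≃ₗ[Hecke F p q n] N.carrier)
  iseqv := ⟨fun _ => ⟨LinearEquiv.refl _ _⟩, fun ⟨e⟩ => ⟨e.symm⟩, fun ⟨e⟩ ⟨f⟩ => ⟨e.trans f⟩⟩

/-- The set of isomorphism classes of irreducible finite-dimensional `ℋ_n`-modules. -/
def IrrClass (n : ℕ) : Type (u + 1) := Quotient (irrSetoid F p q n)

/-- The isomorphism class of an irreducible module. -/
def IrrRep.cls {n : ℕ} (M : IrrRep F p q n) : IrrClass F p q n := Quotient.mk _ M

end Classes

/-! Everything is read off from joint eigenvectors of the last few lattice operators. Let `N` be an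
irreducible module over `ℋ_n`, put `r = n - ε_a(N)`, and let `S` be the joint `a`-eigenspace of
`X_{r+1}, …, X_n` in `N`; it is nonzero, and by maximality of `ε_a(N)` the operator `X_r` has no
eigenvalue `a` on it. Let `M` be a finite-dimensional `ℋ_{n+1}`-module generated by a copy of `N` on
which `X_{n+1}` acts by `a`. The key fact is the shuffle lemma (`mem_of_forall_X_smul_eq`, in module
form `IsEigenHom.exists_of_mem_tailEigenspace`): every joint `a`-eigenvector of `X_{r+1}, …,
X_{n+1}` in `M` already lies in `S`. In particular `ε_a(M) = ε_a(N) + 1`.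

The reason is a Mackey-type filtration. `M` is spanned by products of coset words applied to `S`,
and the lattice acts triangularly, a word permuting and inverting the `X_j` up to shorter words. If
a word carries one of the last positions through `T_0` and back into the tail, an eigenvalue `a⁻¹`
appears there, and `a⁻¹ ≠ a` because `a ≠ ±1`. If it brings position `r` into the tail, the
eigenvalues of `X_r` on `S` appear, and these differ from `a` (`heckeSpan_le_of_saturated`). What is
left is a module induced in type `A` from a character with all values equal to `a`. There Kato's
argument applies: since `q² ≠ 1`, the Bernstein relation makes the last lattice operator so far from
semisimple that its eigenvectors lie one step down, and iterating leads to `S`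
(`typeASpan_independent_and_eigenvectors`).

For the socle, let `K` be a simple submodule of `e_a M`, with `M` irreducible. The central elements
`∑ (X_j + X_j⁻¹)` of `ℋ_{n+1}` and `ℋ_n` act on `K` by scalars, hence so does their difference
`X_{n+1} + X_{n+1}⁻¹`, and `a ≠ a⁻¹` forces `X_{n+1}` itself to act by `a`. So the shuffle lemma
applies to `K ⊆ M`: every simple `K` contains the same nonzero eigenvectors for the longest tail,
and there is only one such `K`. For the cosocle, the same lemma in `M/(J ∩ J')` shows that `f_a N`
cannot have two different maximal submodules `J`, `J'` (`IsEigenHom.coatom_eq`). Frobenius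
reciprocity then links the two constructions.

It remains to see that `N` embeds in `f_a N`. This follows from freeness of `ℋ_{n+1}` over the
parabolic on the `2n + 2` coset words, which is proved with the faithful representation by
Demazure–Lusztig operators; `q` not being a root of unity separates the powers of each variable by
scaling. -/

/-! ## Families satisfying the defining relations, and coset words -/

/-- Elements `T 0, …, T (n-1)` and units `X 0, …, X n` of an algebra satisfying the defining
relations of the affine Hecke algebra of type `B_n`. -/
structure HeckeFamily {F A : Type*} [Field F] [Ring A] [Algebra F A] (p q : F) (n : ℕ)
    (T : ℕ → A) (X : ℕ → Aˣ) : Prop where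
  X_comm : ∀ j k, j ≤ n → k ≤ n → (X j : A) * X k = X k * X j
  quad_zero : 0 < n → (T 0 - algebraMap F A p) * (T 0 + algebraMap F A p⁻¹) = 0
  quad : ∀ i, 1 ≤ i → i < n → (T i - algebraMap F A q) * (T i + algebraMap F A q⁻¹) = 0
  braid : ∀ i, 1 ≤ i → i + 1 < n → T i * T (i + 1) * T i = T (i + 1) * T i * T (i + 1)
  T_comm : ∀ i j, i + 1 < j → j < n → T i * T j = T j * T i
  braid_zero : 1 < n → T 1 * T 0 * T 1 * T 0 = T 0 * T 1 * T 0 * T 1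
  mixed_zero : 0 < n → T 0 * X 0 * T 0 = X 0 * X 1
  mixed_comm : ∀ i j, i < n → j ≤ n → j ≠ i → j ≠ i + 1 → T i * X j = X j * T i
  mixed : ∀ i, 1 ≤ i → i < n → T i * X i * T i = X (i + 1)

/-- The letters `k, k-1, …, 1, 0, 1, …, k` of the longest coset representative. -/
def cosetLetter (k t : ℕ) : ℕ := (k - t) + (t - k)

/-- The product `T_{i_{s-1}} ⋯ T_{i_1} T_{i_0}` over the first `s` coset letters. -/
def cosetWord {A : Type*} [Monoid A] (T : ℕ → A) (k : ℕ) : ℕ → A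
  | 0 => 1
  | s + 1 => T (cosetLetter k s) * cosetWord T k s

/-- The parameter of `T_i`. -/
def heckeParam {F : Type*} (p q : F) (i : ℕ) : F := if i = 0 then p else q

/-- The coefficient `c_i` of the quadratic relation `T_i ^ 2 = c_i T_i + 1`. -/
def heckeCoeff {F : Type*} [Field F] (p q : F) (i : ℕ) : F :=
  heckeParam p q i - (heckeParam p q i)⁻¹

/-- The commutative subalgebra generated by the lattice operators and their inverses. -/
def latticeAlg (F : Type*) {A : Type*} [Field F] [Ring A] [Algebra F A] (n : ℕ) (X : ℕ → Aˣ) :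
    Subalgebra F A :=
  Algebra.adjoin F {x | ∃ j ≤ n, x = X j ∨ x = ((X j)⁻¹ : Aˣ)}

namespace HeckeFamily

variable {F A : Type*} [Field F] [Ring A] [Algebra F A] {p q : F} {n : ℕ} {T : ℕ → A}
  {X : ℕ → Aˣ} (H : HeckeFamily p q n T X)

include H

theorem T_commute {i j : ℕ} (hi : i < n) (hj : j < n) (h : i + 1 < j ∨ j + 1 < i) :
    T i * T j = T j * T i := by
  rcases h with h | h
  · exact H.T_comm i j h hj
  · exact (H.T_comm j i h hi).symm

theorem T_sq (hp : p ≠ 0) (hq : q ≠ 0) {i : ℕ} (hi : i < n) :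
    T i * T i = heckeCoeff p q i • T i + 1 := by
  have key : ∀ r : F, r ≠ 0 → (T i - algebraMap F A r) * (T i + algebraMap F A r⁻¹) = 0 →
      T i * T i = (r - r⁻¹) • T i + 1 := by
    intro r hr h
    have h1 : algebraMap F A r * algebraMap F A r⁻¹ = 1 := by
      rw [← map_mul, mul_inv_cancel₀ hr, map_one]
    have h2 : T i * algebraMap F A r⁻¹ = r⁻¹ • T i := by
      rw [Algebra.smul_def, Algebra.commutes]
    rw [mul_add, sub_mul, sub_mul, h1, h2, ← Algebra.smul_def] at h
    rw [sub_smul, ← sub_eq_zero, ← h]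
    abel
  rcases Nat.eq_zero_or_pos i with rfl | h0
  · simpa [heckeCoeff, heckeParam] using key p hp (H.quad_zero hi)
  · simpa [heckeCoeff, heckeParam, h0.ne'] using key q hq (H.quad i h0 hi)

/-- This is Deodhar's lemma for the minimal representatives of `W(B_{k+1})/W(B_k)`: a simple
reflection that neither lengthens nor shortens the representative within the list passes through it
and becomes a simple reflection of the subgroup. The clause on `lo` records that no index below
those involved is created, so that the same lemma serves the type `A` segments. -/
theorem T_mul_cosetWord {k : ℕ} (hk : k < n) (s : ℕ) : ∀ i, i ≤ k → s ≤ 2 * k + 1 →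
    i ≠ cosetLetter k s → (∀ t, s = t + 1 → i ≠ cosetLetter k t) →
    ∃ j < k, (∀ lo, lo ≤ i → (∀ t < s, lo ≤ cosetLetter k t) → lo ≤ j) ∧
      T i * cosetWord T k s = cosetWord T k s * T j := by
  induction s using Nat.strong_induction_on with
  | _ s ih =>
  intro i hi hs h1 h2
  rcases s with _ | s
  · refine ⟨i, ?_, fun lo h _ => h, by simp [cosetWord]⟩
    simp only [cosetLetter] at h1; omega
  have h3 := h2 s rfl
  have hlk : cosetLetter k s ≤ k := by simp only [cosetLetter]; omega
  by_cases hfar : i + 1 < cosetLetter k s ∨ cosetLetter k s + 1 < i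
  · obtain ⟨j, hj, hlo, e⟩ := ih s (Nat.lt_succ_self s) i hi (by omega) h3 (by
      rintro t rfl; simp only [cosetLetter] at hfar ⊢; omega)
    refine ⟨j, hj, fun lo h h' => hlo lo h fun t ht => h' t (by omega), ?_⟩
    rw [cosetWord, ← mul_assoc, H.T_commute (by omega) (by omega) hfar, mul_assoc, e, mul_assoc]
  rcases s with _ | s
  · simp only [cosetLetter] at *; omega
  -- The index is adjacent to the last letter and is not the next one, so it must be the letter
  -- before the last.
  have hil : i = cosetLetter k s := by simp only [cosetLetter] at *; omega
  by_cases hz : i = 0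
  · -- the turning point
    have hsk : s = k := by simp only [cosetLetter] at *; omega
    subst hsk
    rcases s with _ | s
    · simp only [cosetLetter] at *; omega
    obtain ⟨j, hj, hlo, e⟩ := ih s (by omega) 0 (by omega) (by omega)
      (by simp only [cosetLetter]; omega) (by intro t ht; simp only [cosetLetter]; omega)
    refine ⟨j, hj, fun lo h h' => by omega, ?_⟩
    have e0 : cosetLetter (s + 1) (s + 1) = 0 := by simp [cosetLetter]
    have e1 : cosetLetter (s + 1) s = 1 := by simp only [cosetLetter]; omega
    have e2 : cosetLetter (s + 1) (s + 1 + 1) = 1 := by simp only [cosetLetter]; omega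
    simp only [cosetWord, e0, e1, e2, hz]
    -- The word begins with `T_1 T_0 T_1`; the length-four braid relation moves the new `T_0` behind
    -- these letters, and the rest is the induction hypothesis for index `0`.
    have hb := H.braid_zero (by omega)
    calc T 0 * (T 1 * (T 0 * (T 1 * cosetWord T (s + 1) s)))
        = (T 0 * T 1 * T 0 * T 1) * cosetWord T (s + 1) s := by simp only [mul_assoc]
      _ = T 1 * T 0 * T 1 * (T 0 * cosetWord T (s + 1) s) := by
        rw [← hb]; simp only [mul_assoc]
      _ = _ := by rw [e]; simp only [mul_assoc]
  by_cases hz' : cosetLetter k (s + 1) = 0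
  · exfalso; simp only [cosetLetter] at *; omega
  -- an ordinary braid move
  obtain ⟨j, hj, hlo, e⟩ := ih s (by omega) (cosetLetter k (s + 1)) (by omega) (by omega)
    (by simp only [cosetLetter] at *; omega)
    (by rintro t rfl; simp only [cosetLetter] at *; omega)
  refine ⟨j, hj, fun lo h h' => hlo lo (h' _ (by omega)) fun t ht => h' t (by omega), ?_⟩
  have hb : T i * T (cosetLetter k (s + 1)) * T i =
      T (cosetLetter k (s + 1)) * T i * T (cosetLetter k (s + 1)) := by
    have : cosetLetter k (s + 1) = i + 1 ∨ i = cosetLetter k (s + 1) + 1 := by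
      simp only [cosetLetter] at *; omega
    rcases this with h | h
    · rw [h]; exact H.braid i (by omega) (by omega)
    · rw [h]; exact (H.braid _ (by omega) (by omega)).symm
  simp only [cosetWord, ← hil]
  calc T i * (T (cosetLetter k (s + 1)) * (T i * cosetWord T k s))
      = (T i * T (cosetLetter k (s + 1)) * T i) * cosetWord T k s := by simp only [mul_assoc]
    _ = T (cosetLetter k (s + 1)) * T i * (T (cosetLetter k (s + 1)) * cosetWord T k s) := by
      rw [hb]; simp only [mul_assoc]
    _ = _ := by rw [e]; simp only [mul_assoc]

end HeckeFamily

/-! ## Moving lattice operators past the `T_i` -/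

section Lattice

variable {F A : Type*} [Field F] [Ring A] [Algebra F A] {n : ℕ} {X : ℕ → Aˣ}

theorem X_mem_latticeAlg {j : ℕ} (hj : j ≤ n) : (X j : A) ∈ latticeAlg F n X :=
  Algebra.subset_adjoin ⟨j, hj, Or.inl rfl⟩

theorem X_inv_mem_latticeAlg {j : ℕ} (hj : j ≤ n) : ((X j)⁻¹ : Aˣ).val ∈ latticeAlg F n X :=
  Algebra.subset_adjoin ⟨j, hj, Or.inr rfl⟩

/-- If `f T = T f' + g` with units `f`, `f'`, then `f⁻¹ T = T f'⁻¹ - f⁻¹ g f'⁻¹`. -/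
theorem Units.inv_mul_of_mul_eq {t g : A} {f f' : Aˣ} (h : f * t = t * f' + g) :
    (f⁻¹ : Aˣ) * t = t * (f'⁻¹ : Aˣ) - (f⁻¹ : Aˣ) * g * (f'⁻¹ : Aˣ) := by
  have : t * f' = f * t - g := by rw [h]; abel
  have h2 : t = (f * t - g) * (f'⁻¹ : Aˣ) := by rw [← this, mul_assoc, Units.mul_inv, mul_one]
  have h3 : (f⁻¹ : Aˣ) * t = (f⁻¹ : Aˣ) * ((f * t - g) * (f'⁻¹ : Aˣ)) := by rw [← h2]
  rw [h3, sub_mul, mul_sub, ← mul_assoc, ← mul_assoc, ← mul_assoc, Units.inv_mul, one_mul]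

end Lattice

namespace HeckeFamily

variable {F A : Type*} [Field F] [Ring A] [Algebra F A] {p q : F} {n : ℕ} {T : ℕ → A}
  {X : ℕ → Aˣ} (H : HeckeFamily p q n T X) (hp : p ≠ 0) (hq : q ≠ 0)

include H

theorem X_mul_T_of_ne {i j : ℕ} (hi : i < n) (hj : j ≤ n) (h1 : j ≠ i) (h2 : j ≠ i + 1) :
    X j * T i = T i * X j := (H.mixed_comm i j hi hj h1 h2).symm

include hp hq

/-- The Bernstein relations: up to lower terms in the lattice, `T_i` acts on the lattice as the
simple reflection. They come from inserting `T_i² = c_i T_i + 1` into the mixed relation. -/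
theorem X_succ_mul_T {i : ℕ} (h0 : 1 ≤ i) (hi : i < n) :
    X (i + 1) * T i = T i * X i + heckeCoeff p q i • (X (i + 1) : A) := by
  rw [← H.mixed i h0 hi, mul_assoc (T i * _), H.T_sq hp hq hi, mul_add, mul_smul_comm, mul_one,
    add_comm]

theorem X_mul_T {i : ℕ} (h0 : 1 ≤ i) (hi : i < n) :
    X i * T i = T i * X (i + 1) - heckeCoeff p q i • (X (i + 1) : A) := by
  rw [← H.mixed i h0 hi, ← mul_assoc, ← mul_assoc, H.T_sq hp hq hi, add_mul, add_mul,
    smul_mul_assoc, smul_mul_assoc, one_mul]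
  abel

theorem X_zero_mul_T_zero (hn : 0 < n) :
    X 0 * T 0 = T 0 * (X 0 * X 1 : Aˣ) - heckeCoeff p q 0 • (X 0 * X 1 : A) := by
  rw [Units.val_mul, ← H.mixed_zero hn, ← mul_assoc, ← mul_assoc, H.T_sq hp hq hn, add_mul,
    add_mul, smul_mul_assoc, smul_mul_assoc, one_mul]
  abel

/-- The reflection belonging to `T_0` inverts `X_1`. Since `X_1 = X_0⁻¹ (X_0 X_1)`, the relation
results from moving the two factors past `T_0` in turn. -/
theorem X_one_mul_T_zero (hn : 0 < n) :
    X 1 * T 0 = T 0 * ((X 1)⁻¹ : Aˣ) + heckeCoeff p q 0 • (1 + X 1 : A) := by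
  have h1 : (X 0 * X 1 : A) * T 0 = T 0 * X 0 + heckeCoeff p q 0 • (X 0 * X 1 : A) := by
    rw [← H.mixed_zero hn, mul_assoc (T 0 * _), H.T_sq hp hq hn, mul_add, mul_smul_comm, mul_one,
      add_comm]
  have h2 := Units.inv_mul_of_mul_eq (f := X 0) (f' := X 0 * X 1) (t := T 0)
    (g := -(heckeCoeff p q 0 • (X 0 * X 1 : A)))
    (by rw [H.X_zero_mul_T_zero hp hq hn]; abel)
  have hc := H.X_comm 0 1 (by omega) (by omega)
  have hc' : (X 0 * X 1 : Aˣ)⁻¹ = (X 1)⁻¹ * (X 0)⁻¹ := mul_inv_rev _ _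
  have h3 : X 1 * T 0 = ((X 0)⁻¹ : Aˣ) * ((X 0 * X 1 : A) * T 0) := by
    rw [← mul_assoc, ← mul_assoc, Units.inv_mul, one_mul]
  have h4 : ((X 0)⁻¹ : Aˣ) * T 0 = T 0 * (((X 1)⁻¹ : Aˣ) * ((X 0)⁻¹ : Aˣ)) +
      heckeCoeff p q 0 • (((X 0)⁻¹ : Aˣ) : A) := by
    rw [h2, hc', Units.val_mul, mul_neg, neg_mul, sub_neg_eq_add, mul_smul_comm, smul_mul_assoc]
    congr 2
    rw [Units.inv_mul_cancel_left, Units.mul_inv_cancel_left]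
  rw [h3, h1, mul_add, ← mul_assoc, h4, add_mul, mul_smul_comm, ← mul_assoc (_ : A) (X 0 : A),
    Units.inv_mul, one_mul, smul_mul_assoc, Units.inv_mul, mul_assoc, mul_assoc, Units.inv_mul,
    mul_one, smul_add, add_assoc]

/-- Every element of the lattice algebra can be moved past `T_i`. -/
theorem exists_latticeAlg_mul_T {i : ℕ} (hi : i < n) {f : A} (hf : f ∈ latticeAlg F n X) :
    ∃ f' ∈ latticeAlg F n X, ∃ g ∈ latticeAlg F n X, f * T i = T i * f' + g := by
  -- The reflected element is kept as a unit with inverse in the lattice algebra, so that the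
  -- relation for `X_j⁻¹` can be derived from the one for `X_j`.
  have unit : ∀ j ≤ n, ∃ f' : Aˣ, (f' : A) ∈ latticeAlg F n X ∧ (f'⁻¹ : Aˣ).val ∈ latticeAlg F n X ∧
      ∃ g ∈ latticeAlg F n X, X j * T i = T i * f' + g := by
    intro j hj
    by_cases h1 : j = i
    · subst h1
      rcases Nat.eq_zero_or_pos j with rfl | h0
      · refine ⟨X 0 * X 1, ?_, ?_, -(heckeCoeff p q 0 • (X 0 * X 1 : A)), ?_, ?_⟩
        · exact mul_mem (X_mem_latticeAlg hj) (X_mem_latticeAlg (by omega))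
        · rw [mul_inv_rev]
          exact mul_mem (X_inv_mem_latticeAlg (by omega)) (X_inv_mem_latticeAlg hj)
        · exact neg_mem (Subalgebra.smul_mem _
            (mul_mem (X_mem_latticeAlg hj) (X_mem_latticeAlg (by omega))) _)
        · rw [H.X_zero_mul_T_zero hp hq hi, sub_eq_add_neg]
      · refine ⟨X (j + 1), X_mem_latticeAlg hi, X_inv_mem_latticeAlg hi,
          -(heckeCoeff p q j • (X (j + 1) : A)),
          neg_mem (Subalgebra.smul_mem _ (X_mem_latticeAlg hi) _), ?_⟩
        rw [H.X_mul_T hp hq h0 hi, sub_eq_add_neg]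
    by_cases h2 : j = i + 1
    · subst h2
      rcases Nat.eq_zero_or_pos i with rfl | h0
      · refine ⟨(X 1)⁻¹, X_inv_mem_latticeAlg hj, by simpa using X_mem_latticeAlg hj,
          heckeCoeff p q 0 • (1 + X 1 : A),
          Subalgebra.smul_mem _ (add_mem (one_mem _) (X_mem_latticeAlg hj)) _, ?_⟩
        exact H.X_one_mul_T_zero hp hq hi
      · exact ⟨X i, X_mem_latticeAlg hi.le, X_inv_mem_latticeAlg hi.le,
          heckeCoeff p q i • (X (i + 1) : A), Subalgebra.smul_mem _ (X_mem_latticeAlg hj) _,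
          H.X_succ_mul_T hp hq h0 hi⟩
    · exact ⟨X j, X_mem_latticeAlg hj, X_inv_mem_latticeAlg hj, 0, zero_mem _,
        by rw [H.X_mul_T_of_ne hi hj h1 h2, add_zero]⟩
  induction hf using Algebra.adjoin_induction with
  | mem x hx =>
    obtain ⟨j, hj, hx⟩ := hx
    obtain ⟨f', hf', hf'', g, hg, e⟩ := unit j hj
    rcases hx with rfl | rfl
    · exact ⟨f', hf', g, hg, e⟩
    · refine ⟨(f'⁻¹ : Aˣ), hf'', -(((X j)⁻¹ : Aˣ) * g * (f'⁻¹ : Aˣ)),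
        neg_mem (mul_mem (mul_mem (X_inv_mem_latticeAlg hj) hg) hf''), ?_⟩
      rw [Units.inv_mul_of_mul_eq e, sub_eq_add_neg]
  | algebraMap r =>
    exact ⟨algebraMap F A r, Subalgebra.algebraMap_mem _ r, 0, zero_mem _,
      by rw [add_zero, Algebra.commutes]⟩
  | add x y _ _ hx hy =>
    obtain ⟨f₁, h₁, g₁, k₁, e₁⟩ := hx
    obtain ⟨f₂, h₂, g₂, k₂, e₂⟩ := hy
    refine ⟨f₁ + f₂, add_mem h₁ h₂, g₁ + g₂, add_mem k₁ k₂, ?_⟩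
    rw [add_mul, e₁, e₂, mul_add]; abel
  | mul x y hx' hy' hx hy =>
    obtain ⟨f₁, h₁, g₁, k₁, e₁⟩ := hx
    obtain ⟨f₂, h₂, g₂, k₂, e₂⟩ := hy
    refine ⟨f₁ * f₂, mul_mem h₁ h₂, g₁ * f₂ + x * g₂,
      add_mem (mul_mem k₁ h₂) (mul_mem hx' k₂), ?_⟩
    rw [mul_assoc, e₂, mul_add, ← mul_assoc, e₁, add_mul, mul_assoc, add_assoc]

end HeckeFamily

/-! ## The span of an initial segment of coset words -/

section CosetSpan

variable {F A V : Type*} [Field F] [Ring A] [Algebra F A] [AddCommGroup V] [Module F V]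
  [Module A V] [IsScalarTower F A V]

/-- `Σ_{t < s} w_t U`, where `w_t` is the `t`-th coset word. -/
def cosetSpan (T : ℕ → A) (k s : ℕ) (U : Submodule F V) : Submodule F V :=
  ⨆ t : Fin s, U.map (Algebra.lsmul F F V (cosetWord T k t))

theorem cosetWord_smul_mem_cosetSpan {T : ℕ → A} {k s t : ℕ} (h : t < s) {U : Submodule F V}
    {u : V} (hu : u ∈ U) : cosetWord T k t • u ∈ cosetSpan T k s U :=
  Submodule.mem_iSup_of_mem (⟨t, h⟩ : Fin s) ⟨u, hu, rfl⟩

theorem cosetSpan_le {T : ℕ → A} {k s : ℕ} {U W : Submodule F V}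
    (h : ∀ t < s, ∀ u ∈ U, cosetWord T k t • u ∈ W) : cosetSpan T k s U ≤ W := by
  refine iSup_le fun t => ?_
  rintro _ ⟨u, hu, rfl⟩
  exact h t t.2 u hu

theorem smul_mem_of_mem_cosetSpan {T : ℕ → A} {k s : ℕ} {U W : Submodule F V} {x : A}
    (h : ∀ t < s, ∀ u ∈ U, x • cosetWord T k t • u ∈ W) {v : V} (hv : v ∈ cosetSpan T k s U) :
    x • v ∈ W :=
  cosetSpan_le (W := W.comap (Algebra.lsmul F F V x)) h hv

theorem cosetSpan_mono {T : ℕ → A} {k s s' : ℕ} (h : s ≤ s') {U : Submodule F V} :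
    cosetSpan T k s U ≤ cosetSpan T k s' U :=
  cosetSpan_le fun _ ht _ hu => cosetWord_smul_mem_cosetSpan (ht.trans_le h) hu

theorem le_cosetSpan {T : ℕ → A} {k s : ℕ} (h : 0 < s) {U : Submodule F V} :
    U ≤ cosetSpan T k s U := fun u hu => by
  simpa [cosetWord] using cosetWord_smul_mem_cosetSpan (T := T) (k := k) h hu

variable {p q : F} {n : ℕ} {T : ℕ → A} {X : ℕ → Aˣ} (H : HeckeFamily p q n T X)
  (hp : p ≠ 0) (hq : q ≠ 0) {k lo : ℕ} (hk : k < n) {U : Submodule F V}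
  (hT : ∀ i, lo ≤ i → i < k → ∀ u ∈ U, T i • u ∈ U)

include H hp hq hk hT

/-- On a word `w_t` the operator `T_i` either lengthens it to `w_{t+1}`, or shortens it by the
quadratic relation, or passes through to an operator preserving `U`. The hypothesis `hi'` only
forbids lengthening the last word of the segment, so a segment is stable as soon as its next letter
lies outside the range of `i`. -/
theorem T_smul_mem_cosetSpan {s : ℕ} (hs : s ≤ 2 * k + 2)
    (hlo : ∀ t, t + 1 < s → lo ≤ cosetLetter k t) {i : ℕ} (h0 : lo ≤ i) (hi : i ≤ k)
    (hi' : ∀ t, s = t + 1 → i ≠ cosetLetter k t) {v : V} (hv : v ∈ cosetSpan T k s U) :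
    T i • v ∈ cosetSpan T k s U := by
  refine smul_mem_of_mem_cosetSpan (fun t ht u hu => ?_) hv
  by_cases h1 : i = cosetLetter k t
  · have : t + 1 < s := by
      by_contra hlt
      exact hi' t (by omega) h1
    have e : T i • cosetWord T k t • u = cosetWord T k (t + 1) • u := by
      rw [cosetWord, mul_smul, h1]
    rw [e]
    exact cosetWord_smul_mem_cosetSpan this hu
  by_cases h2 : ∃ t', t = t' + 1 ∧ i = cosetLetter k t'
  · obtain ⟨t', rfl, h2⟩ := h2
    have e : T i • cosetWord T k (t' + 1) • u =
        heckeCoeff p q i • cosetWord T k (t' + 1) • u + cosetWord T k t' • u := by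
      rw [cosetWord, ← h2, ← mul_smul, ← mul_assoc, H.T_sq hp hq (by omega), add_mul, add_smul,
        smul_mul_assoc, one_mul, smul_assoc]
    rw [e]
    exact add_mem (Submodule.smul_mem _ _ (cosetWord_smul_mem_cosetSpan ht hu))
      (cosetWord_smul_mem_cosetSpan (by omega) hu)
  · push Not at h2
    obtain ⟨j, hj, hlo', e⟩ := H.T_mul_cosetWord hk t i hi (by omega) h1 h2
    rw [← mul_smul, e, mul_smul]
    exact cosetWord_smul_mem_cosetSpan ht
      (hT j (hlo' lo h0 fun t' ht' => hlo t' (by omega)) hj u hu)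

theorem T_smul_mem_cosetSpan_succ {s : ℕ} (hs : s ≤ 2 * k + 1)
    (hlo : ∀ t, t < s → lo ≤ cosetLetter k t) {i : ℕ} (h0 : lo ≤ i) (hi : i ≤ k)
    {v : V} (hv : v ∈ cosetSpan T k s U) : T i • v ∈ cosetSpan T k (s + 1) U := by
  by_cases h : i = cosetLetter k s
  · rcases s with _ | s
    · have : v = 0 := by
        have := cosetSpan_le (W := ⊥) (fun t ht => absurd ht (Nat.not_lt_zero t)) hv
        simpa using this
      rw [this, smul_zero]; exact zero_mem _
    · refine cosetSpan_mono (Nat.le_succ _) (T_smul_mem_cosetSpan H hp hq hk hT (by omega)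
        (fun t ht => hlo t (by omega)) h0 hi ?_ hv)
      rintro t ht rfl
      simp only [cosetLetter] at h; omega
  · exact T_smul_mem_cosetSpan H hp hq hk hT (by omega) (fun t ht => hlo t (by omega)) h0 hi
      (by intro t ht; obtain rfl : s = t := by omega
          exact h) (cosetSpan_mono (Nat.le_succ _) hv)

/-- The span of each initial segment is a lattice module: in `f T w_t = T f' w_t + g w_t` the
elements `f'` and `g` act on shorter words, where induction applies, and `T` raises the segment by
one. -/
theorem latticeAlg_smul_mem_cosetSpan (hX : ∀ f ∈ latticeAlg F n X, ∀ u ∈ U, f • u ∈ U) {s : ℕ}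
    (hs : s ≤ 2 * k + 2) (hlo : ∀ t, t + 1 < s → lo ≤ cosetLetter k t) {f : A}
    (hf : f ∈ latticeAlg F n X) {v : V} (hv : v ∈ cosetSpan T k s U) :
    f • v ∈ cosetSpan T k s U := by
  induction s generalizing f v with
  | zero =>
    have : v = 0 := by
      have := cosetSpan_le (W := ⊥) (fun t ht => absurd ht (Nat.not_lt_zero t)) hv
      simpa using this
    rw [this, smul_zero]; exact zero_mem _
  | succ s ih =>
    refine smul_mem_of_mem_cosetSpan (fun t ht u hu => ?_) hv
    rcases Nat.lt_succ_iff_lt_or_eq.1 ht with h | rfl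
    · exact cosetSpan_mono (Nat.le_succ _) (ih (by omega) (fun t ht => hlo t (by omega)) hf
        (cosetWord_smul_mem_cosetSpan h hu))
    rcases t with _ | t
    · simpa [cosetWord] using le_cosetSpan (T := T) (k := k) (Nat.succ_pos _) (hX f hf u hu)
    · have hlt : cosetLetter k t ≤ k := by simp only [cosetLetter]; omega
      obtain ⟨f', hf', g, hg, e⟩ := H.exists_latticeAlg_mul_T hp hq
        (i := cosetLetter k t) (by omega) hf
      rw [cosetWord, ← mul_smul, ← mul_assoc, e, add_mul, add_smul, mul_assoc, mul_smul,
        mul_smul, mul_smul]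
      have hm := cosetWord_smul_mem_cosetSpan (T := T) (k := k) (Nat.lt_succ_self t) hu
      have ih' := fun f hf => ih (by omega) (fun t ht => hlo t (by omega)) (f := f) hf hm
      exact add_mem (T_smul_mem_cosetSpan_succ H hp hq hk hT (by omega)
        (fun t ht => hlo t (by omega)) (hlo t (by omega)) hlt (ih' f' hf'))
        (cosetSpan_mono (Nat.le_succ _) (ih' g hg))

end CosetSpan

/-! ## Coset words and lattice operators -/

section CosetWord

variable {F A V : Type*} [Field F] [Ring A] [Algebra F A] [AddCommGroup V] [Module F V]
  [Module A V] [IsScalarTower F A V]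

theorem mul_cosetWord_of_commute {T : ℕ → A} {k s : ℕ} {x : A}
    (h : ∀ t < s, x * T (cosetLetter k t) = T (cosetLetter k t) * x) :
    x * cosetWord T k s = cosetWord T k s * x := by
  induction s with
  | zero => simp [cosetWord]
  | succ s ih =>
    rw [cosetWord, ← mul_assoc, h s (Nat.lt_succ_self s), mul_assoc,
      ih fun t ht => h t (Nat.lt_succ_of_lt ht), mul_assoc]

theorem cosetWord_succ_succ (T : ℕ → A) {k s : ℕ} (hs : s ≤ k + 1) :
    cosetWord T (k + 1) (s + 1) = cosetWord T k s * T (k + 1) := by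
  induction s with
  | zero => simp [cosetWord, cosetLetter]
  | succ s ih =>
    have e : cosetLetter (k + 1) (s + 1) = cosetLetter k s := by simp only [cosetLetter]; omega
    rw [cosetWord, ih (by omega), e, cosetWord, mul_assoc]

omit [Algebra F A] [IsScalarTower F A V] in
theorem cosetWord_smul_mem {T : ℕ → A} {k s : ℕ} {U : Submodule F V}
    (h : ∀ t < s, ∀ u ∈ U, T (cosetLetter k t) • u ∈ U) {u : V} (hu : u ∈ U) :
    cosetWord T k s • u ∈ U := by
  induction s with
  | zero => simpa [cosetWord] using hu
  | succ s ih =>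
    rw [cosetWord, mul_smul]
    exact h s (Nat.lt_succ_self s) _ (ih fun t ht => h t (Nat.lt_succ_of_lt ht))

theorem cosetSpan_one (T : ℕ → A) (k : ℕ) (U : Submodule F V) : cosetSpan T k 1 U = U := by
  refine le_antisymm (cosetSpan_le fun t ht u hu => ?_) (le_cosetSpan one_pos)
  obtain rfl : t = 0 := by omega
  simpa [cosetWord] using hu

theorem exists_sum_of_mem_cosetSpan {T : ℕ → A} {k s : ℕ} {U : Submodule F V} {v : V}
    (hv : v ∈ cosetSpan T k s U) :
    ∃ y : ℕ → V, (∀ t, y t ∈ U) ∧ v = ∑ t ∈ Finset.range s, cosetWord T k t • y t := by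
  rw [cosetSpan, Submodule.mem_iSup_iff_exists_finsupp] at hv
  obtain ⟨f, hf, rfl⟩ := hv
  choose g hg hg' using hf
  refine ⟨fun t => if h : t < s then g ⟨t, h⟩ else 0, fun t => ?_, ?_⟩
  · dsimp only
    split_ifs with h
    · exact hg _
    · exact zero_mem _
  · rw [Finset.sum_range, Finsupp.sum_fintype _ _ (fun _ => rfl)]
    refine Finset.sum_congr rfl fun t _ => ?_
    simp only [t.2, dite_true]
    exact (hg' t).symm

theorem latticeAlg_commute {n : ℕ} {X : ℕ → Aˣ}
    (hX : ∀ j k, j ≤ n → k ≤ n → (X j : A) * X k = X k * X j) {f g : A}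
    (hf : f ∈ latticeAlg F n X) (hg : g ∈ latticeAlg F n X) : Commute f g := by
  have hx : ∀ j ≤ n, ∀ k ≤ n, Commute (X j : A) (X k) := fun j hj k hk => hX j k hj hk
  refine Algebra.commute_of_mem_adjoin_of_forall_mem_commute hg ?_
  rintro y ⟨k, hk, rfl | rfl⟩
  · refine (Algebra.commute_of_mem_adjoin_of_forall_mem_commute hf ?_).symm
    rintro z ⟨j, hj, rfl | rfl⟩
    · exact hx k hk j hj
    · exact (hx k hk j hj).units_inv_right
  · refine (Algebra.commute_of_mem_adjoin_of_forall_mem_commute hf ?_).symm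
    rintro z ⟨j, hj, rfl | rfl⟩
    · exact (hx k hk j hj).units_inv_left
    · exact (hx k hk j hj).units_inv_left.units_inv_right

variable {p q : F} {n : ℕ} {T : ℕ → A} {X : ℕ → Aˣ} (H : HeckeFamily p q n T X)

include H in
theorem X_mul_cosetWord_of_ne {k s l : ℕ} (hk : k < n) (hs : s ≤ 2 * k + 1) (hl : l ≤ n)
    (h : ∀ t < s, l ≠ cosetLetter k t ∧ l ≠ cosetLetter k t + 1) :
    X l * cosetWord T k s = cosetWord T k s * X l :=
  mul_cosetWord_of_commute fun t ht => H.X_mul_T_of_ne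
    (by have : cosetLetter k t ≤ k := by simp only [cosetLetter]; omega
        omega) hl (h t ht).1 (h t ht).2

variable (hp : p ≠ 0) (hq : q ≠ 0) {k : ℕ} (hk : k < n) {U : Submodule F V}
  (hT : ∀ i, 0 ≤ i → i < k → ∀ u ∈ U, T i • u ∈ U)
  (hX : ∀ f ∈ latticeAlg F n X, ∀ u ∈ U, f • u ∈ U)

include H hp hq hk hT hX

/-- Moving a lattice element past one more coset letter, modulo shorter words. -/
theorem smul_cosetWord_succ_sub_mem {s : ℕ} (hs : s ≤ 2 * k) {f f' g : A}
    (hg : g ∈ latticeAlg F n X)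
    (e : f * T (cosetLetter k s) = T (cosetLetter k s) * f' + g) {y y' : V} (hy : y ∈ U)
    (h : f' • cosetWord T k s • y - cosetWord T k s • y' ∈ cosetSpan T k s U) :
    f • cosetWord T k (s + 1) • y - cosetWord T k (s + 1) • y' ∈ cosetSpan T k (s + 1) U := by
  have hlk : cosetLetter k s ≤ k := by simp only [cosetLetter]; omega
  have e' : f • cosetWord T k (s + 1) • y - cosetWord T k (s + 1) • y' =
      T (cosetLetter k s) • (f' • cosetWord T k s • y - cosetWord T k s • y') +
        g • cosetWord T k s • y := by
    rw [cosetWord, ← mul_smul, ← mul_assoc, e, add_mul, add_smul, smul_sub]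
    simp only [mul_smul]
    abel
  rw [e']
  exact add_mem (T_smul_mem_cosetSpan_succ H hp hq hk hT (by omega) (fun _ _ => Nat.zero_le _)
    (Nat.zero_le _) hlk h)
    (latticeAlg_smul_mem_cosetSpan H hp hq hk hT hX (by omega) (fun _ _ => Nat.zero_le _) hg
      (cosetWord_smul_mem_cosetSpan (Nat.lt_succ_self s) hy))

/-- The bounds on `s` say that the word contains the descending letter `l` but not yet the ascending
one. Exactly then the corresponding permutation sends position `l` to `l + 1`: the letter `l` makes
the shift, and the later letters, all smaller than `l`, leave `X_{l+1}` alone. -/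
theorem X_succ_smul_cosetWord_sub_mem {s l : ℕ} (hs : s ≤ 2 * k + 1) (h0 : 1 ≤ l) (hl : l ≤ k)
    (h1 : k + 1 ≤ l + s) (h2 : s ≤ l + k) {y : V} (hy : y ∈ U) :
    (X (l + 1) : A) • cosetWord T k s • y - cosetWord T k s • (X l : A) • y ∈
      cosetSpan T k s U := by
  induction s with
  | zero => omega
  | succ s ih =>
    by_cases h : k + 1 ≤ l + s
    · refine smul_cosetWord_succ_sub_mem H hp hq hk hT hX (by omega) (zero_mem _)
        (f' := X (l + 1)) ?_ hy (ih (by omega) h (by omega))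
      rw [add_zero]
      exact H.X_mul_T_of_ne (by simp only [cosetLetter]; omega) (by omega)
        (by simp only [cosetLetter]; omega) (by simp only [cosetLetter]; omega)
    · have hlet : cosetLetter k s = l := by simp only [cosetLetter]; omega
      refine smul_cosetWord_succ_sub_mem H hp hq hk hT hX (by omega)
        (Subalgebra.smul_mem _ (X_mem_latticeAlg (by omega : l + 1 ≤ n)) (heckeCoeff p q l))
        (f' := X l) ?_ hy ?_
      · rw [hlet]; exact H.X_succ_mul_T hp hq h0 (by omega)
      · rw [← mul_smul, X_mul_cosetWord_of_ne H hk (by omega) (by omega), mul_smul, sub_self]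
        · exact zero_mem _
        · intro t ht; simp only [cosetLetter]; omega

variable {a : F} (ha : ∀ u ∈ U, (X (k + 1) : A) • u = a • u)

include ha

/-- The descending letters carry the last position `k + 1`, where the eigenvalue is `a`, down to `k
+ 1 - s`. -/
theorem X_smul_cosetWord_sub_mem {s : ℕ} (hs : s ≤ k) {y : V} (hy : y ∈ U) :
    (X (k + 1 - s) : A) • cosetWord T k s • y - cosetWord T k s • a • y ∈ cosetSpan T k s U := by
  induction s with
  | zero => simp [cosetWord, ha y hy]
  | succ s ih =>
    have hlet : cosetLetter k s = k - s := by simp only [cosetLetter]; omega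
    have e1 : k + 1 - s = (k - s) + 1 := by omega
    have e2 : k + 1 - (s + 1) = k - s := by omega
    have e := H.X_mul_T hp hq (i := k - s) (by omega) (by omega)
    rw [sub_eq_add_neg] at e
    rw [e2]
    rw [e1] at ih
    refine smul_cosetWord_succ_sub_mem H hp hq hk hT hX (by omega)
      (neg_mem (Subalgebra.smul_mem _ (X_mem_latticeAlg (by omega : k - s + 1 ≤ n))
        (heckeCoeff p q (k - s))))
      (f' := X ((k - s) + 1)) ?_ hy (ih (by omega))
    rw [hlet]; exact e

/-- After the letter `0` the last position has been inverted, and the ascending letters carry it up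
again. Hence the eigenvalue `a⁻¹` at position `d + 1`. -/
theorem X_inv_smul_cosetWord_sub_mem (ha0 : a ≠ 0) {d : ℕ} (hd : d ≤ k) {y : V} (hy : y ∈ U) :
    (X (d + 1) : A) • cosetWord T k (k + 1 + d) • y - cosetWord T k (k + 1 + d) • a⁻¹ • y ∈
      cosetSpan T k (k + 1 + d) U := by
  induction d with
  | zero =>
    have h := X_smul_cosetWord_sub_mem H hp hq hk hT hX ha (le_refl k) hy
    have hlet : cosetLetter k k = 0 := by simp only [cosetLetter]; omega
    rw [Nat.add_sub_cancel_left] at h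
    refine smul_cosetWord_succ_sub_mem H hp hq hk hT hX (by omega)
      (Subalgebra.smul_mem _ (add_mem (one_mem _) (X_mem_latticeAlg (by omega : 1 ≤ n))) _)
      (f' := ((X 1)⁻¹ : Aˣ)) (by rw [hlet]; exact H.X_one_mul_T_zero hp hq (by omega)) hy ?_
    -- Applying `-a⁻¹ X_1⁻¹` to `X_1 w_k y ≡ a w_k y` turns it into `X_1⁻¹ w_k y ≡ a⁻¹ w_k y`, the
    -- form needed in front of `T_0`.
    have h' := latticeAlg_smul_mem_cosetSpan H hp hq hk hT hX (s := k) (by omega)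
      (fun _ _ => Nat.zero_le _) (X_inv_mem_latticeAlg (by omega : 1 ≤ n))
      (Submodule.smul_mem _ (-a⁻¹) h)
    have e1 (z : V) : (((X 1)⁻¹ : Aˣ) : A) • (X 1 : A) • z = z := by
      rw [← mul_smul, Units.inv_mul, one_smul]
    convert h' using 1
    rw [smul_comm (_ : A) (-a⁻¹), smul_sub, e1, smul_sub, smul_comm (cosetWord T k k) a,
      smul_comm (_ : A) a, smul_smul (-a⁻¹) a, neg_mul, inv_mul_cancel₀ ha0,
      smul_comm (cosetWord T k k) a⁻¹]
    simp only [neg_smul, one_smul]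
    abel
  | succ d ih =>
    have hlet : cosetLetter k (k + 1 + d) = d + 1 := by simp only [cosetLetter]; omega
    refine smul_cosetWord_succ_sub_mem H hp hq hk hT hX (s := k + 1 + d) (by omega)
      (Subalgebra.smul_mem _ (X_mem_latticeAlg (by omega : d + 1 + 1 ≤ n))
        (heckeCoeff p q (d + 1))) (f' := X (d + 1)) ?_ hy (ih (by omega))
    rw [hlet]; exact H.X_succ_mul_T hp hq (by omega) (by omega)

end CosetWord

/-! ## Iterated spans of coset words -/

section IterCosetSpan

variable {F A V : Type*} [Field F] [Ring A] [Algebra F A] [AddCommGroup V] [Module F V]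
  [Module A V] [IsScalarTower F A V]

/-- Iterating `cosetSpan` over `k = r, r + 1, …`, with `len j` coset words in step `j`. -/
def iterCosetSpan (T : ℕ → A) (r : ℕ) (len : ℕ → ℕ) (S : Submodule F V) : ℕ → Submodule F V
  | 0 => S
  | j + 1 => cosetSpan T (r + j) (len j) (iterCosetSpan T r len S j)

/-- The subspace generated by `S` under the affine Hecke algebra of type `B_{r+j}`. -/
abbrev heckeSpan (T : ℕ → A) (r : ℕ) (S : Submodule F V) (j : ℕ) : Submodule F V :=
  iterCosetSpan T r (fun j => 2 * (r + j) + 2) S j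

/-- The subspace generated by `S` under the affine Hecke algebra of type `A` on the positions
`r + 1, …, r + j`. -/
abbrev typeASpan (T : ℕ → A) (r : ℕ) (S : Submodule F V) (j : ℕ) : Submodule F V :=
  iterCosetSpan T r (fun j => j + 1) S j

variable {p q : F} {n : ℕ} {T : ℕ → A} {X : ℕ → Aˣ} (H : HeckeFamily p q n T X)
  (hp : p ≠ 0) (hq : q ≠ 0) {r : ℕ} {S : Submodule F V}

include H

/-- Step `j` uses only letters below `r + j`, and these commute with the later lattice operators. -/
theorem X_smul_iterCosetSpan {len : ℕ → ℕ} (hlen : ∀ j, len j ≤ 2 * (r + j) + 2) {a : F}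
    (ha : ∀ l, r < l → l ≤ n → ∀ u ∈ S, (X l : A) • u = a • u) {j l : ℕ} (hl : r + j < l)
    (hln : l ≤ n) {u : V} (hu : u ∈ iterCosetSpan T r len S j) : (X l : A) • u = a • u := by
  induction j generalizing u with
  | zero => exact ha l hl hln u hu
  | succ j ih =>
    have : (X l : A) • u - a • u ∈ (⊥ : Submodule F V) := by
      have hm := smul_mem_of_mem_cosetSpan (W := (⊥ : Submodule F V))
        (x := (X l : A) - algebraMap F A a) (fun t ht y hy => ?_) hu
      · rwa [sub_smul, algebraMap_smul] at hm
      · have := hlen j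
        rw [sub_smul, algebraMap_smul, ← mul_smul, X_mul_cosetWord_of_ne H (by omega) (by omega)
          hln, mul_smul, ih (by omega) hy, smul_comm, sub_self]
        · exact zero_mem _
        · intro t' ht'; simp only [cosetLetter]; omega
    exact sub_eq_zero.1 ((Submodule.mem_bot F).1 this)

include hp hq

/-- One proof for types `B` and `A`. By `hend` the letter that would lengthen the longest word of a
step is outside the range of admissible indices: in type `B` it is `r + j + 1`, in type `A` it is
`r`. -/
theorem iterCosetSpan_stable {len : ℕ → ℕ} {lo : ℕ} (hlen : ∀ j, len j ≤ 2 * (r + j) + 2)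
    (hlo : ∀ j t, t + 1 < len j → lo ≤ cosetLetter (r + j) t)
    (hend : ∀ j t, len j = t + 1 → cosetLetter (r + j) t < lo ∨ r + j < cosetLetter (r + j) t)
    (hST : ∀ i, lo ≤ i → i < r → ∀ u ∈ S, T i • u ∈ S)
    (hSX : ∀ f ∈ latticeAlg F n X, ∀ u ∈ S, f • u ∈ S) (j : ℕ) (hj : r + j ≤ n) :
    (∀ i, lo ≤ i → i < r + j → ∀ u ∈ iterCosetSpan T r len S j,
      T i • u ∈ iterCosetSpan T r len S j) ∧
    (∀ f ∈ latticeAlg F n X, ∀ u ∈ iterCosetSpan T r len S j,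
      f • u ∈ iterCosetSpan T r len S j) := by
  induction j with
  | zero => exact ⟨hST, hSX⟩
  | succ j ih =>
    obtain ⟨h1, h2⟩ := ih (by omega)
    refine ⟨fun i h0 hi u hu => ?_, fun f hf u hu => ?_⟩
    · refine T_smul_mem_cosetSpan H hp hq (by omega) h1 (hlen j) (hlo j) h0 (by omega) ?_ hu
      intro t ht
      have := hend j t ht
      omega
    · exact latticeAlg_smul_mem_cosetSpan H hp hq (by omega) h1 h2 (hlen j) (hlo j) hf hu

theorem heckeSpan_stable (hST : ∀ i < r, ∀ u ∈ S, T i • u ∈ S)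
    (hSX : ∀ f ∈ latticeAlg F n X, ∀ u ∈ S, f • u ∈ S) (j : ℕ) (hj : r + j ≤ n) :
    (∀ i, 0 ≤ i → i < r + j → ∀ u ∈ heckeSpan T r S j, T i • u ∈ heckeSpan T r S j) ∧
    (∀ f ∈ latticeAlg F n X, ∀ u ∈ heckeSpan T r S j, f • u ∈ heckeSpan T r S j) :=
  iterCosetSpan_stable H hp hq (fun _ => le_refl _)
    (fun _ _ _ => Nat.zero_le _) (fun j t ht => by simp only [cosetLetter]; omega)
    (fun i _ hi => hST i hi) hSX j hj

theorem typeASpan_stable (hSX : ∀ f ∈ latticeAlg F n X, ∀ u ∈ S, f • u ∈ S) (j : ℕ)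
    (hj : r + j ≤ n) :
    (∀ i, r + 1 ≤ i → i < r + j → ∀ u ∈ typeASpan T r S j, T i • u ∈ typeASpan T r S j) ∧
    (∀ f ∈ latticeAlg F n X, ∀ u ∈ typeASpan T r S j, f • u ∈ typeASpan T r S j) :=
  iterCosetSpan_stable H hp hq (fun _ => by omega)
    (fun _ _ _ => by simp only [cosetLetter]; omega)
    (fun j t ht => by simp only [cosetLetter]; omega)
    (fun i h0 hi => by omega) hSX j hj

end IterCosetSpan

/-! ## The shuffle lemma -/

section Shuffle

variable {F A V : Type*} [Field F] [Ring A] [Algebra F A] [AddCommGroup V] [Module F V]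
  [Module A V] [IsScalarTower F A V]

/-- A subspace `Q` containing every `y ∈ U` with `(x - b) y ∈ Q` for some `b ≠ a` contains the
finite-dimensional `x`-stable subspace `U` if `a` is not an eigenvalue of `x` on `U`. -/
theorem le_of_saturated [IsAlgClosed F] {U Q : Submodule F V} [FiniteDimensional F U] {x : A}
    {a : F} (hx : ∀ u ∈ U, x • u ∈ U) (ha : ∀ u ∈ U, x • u = a • u → u = 0)
    (hQ : ∀ y ∈ U, ∀ b ≠ a, x • y - b • y ∈ Q → y ∈ Q) : U ≤ Q := by
  let f : Module.End F U := (Algebra.lsmul F F V x).restrict hx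
  have hf (u : U) : (f u : V) = x • (u : V) := rfl
  have htop := Module.End.iSup_maxGenEigenspace_eq_top f
  have key : ∀ μ, f.maxGenEigenspace μ ≤ Q.comap U.subtype := by
    intro μ u hu
    obtain ⟨N, hN⟩ := (Module.End.mem_maxGenEigenspace f μ u).1 hu
    clear hu
    induction N generalizing u with
    | zero => rw [pow_zero, Module.End.one_apply] at hN; rw [hN]; exact zero_mem _
    | succ N ih =>
      by_cases hμ : μ = a
      -- For the excluded eigenvalue `a` the generalized eigenspace is zero, since `f - a` is
      -- injective; for all other eigenvalues one factor `f - μ` is removed at a time by saturation.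
      · have inj : ∀ w : U, (f - μ • 1) w = 0 → w = 0 := by
          intro w hw
          have hw' := congrArg Subtype.val hw
          simp only [LinearMap.sub_apply, LinearMap.smul_apply, Module.End.one_apply,
            Submodule.coe_sub, Submodule.coe_smul, hf, hμ, Submodule.coe_zero] at hw'
          exact Subtype.ext (ha w w.2 (sub_eq_zero.1 hw'))
        rw [pow_succ', Module.End.mul_apply] at hN
        exact ih (inj _ hN)
      · have h1 : ((f - μ • 1) ^ N) ((f - μ • 1) u) = 0 := by
          rw [← Module.End.mul_apply, ← pow_succ]; exact hN
        have h2 := ih h1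
        refine hQ u u.2 μ hμ ?_
        simpa [hf] using h2
  intro u hu
  have : (⟨u, hu⟩ : U) ∈ (⊤ : Submodule F U) := trivial
  rw [← htop] at this
  exact iSup_le key this

variable {p q : F} {n : ℕ} {T : ℕ → A} {X : ℕ → Aˣ} (H : HeckeFamily p q n T X)
  (hp : p ≠ 0) (hq : q ≠ 0) {r : ℕ} {S : Submodule F V}

-- The type `A` words have letters greater than `r` and so commute with `X_r`; the absence of the
-- eigenvalue `a` on `S` is inherited by each translate.
include H in
theorem typeASpan_le_of_saturated [IsAlgClosed F] [FiniteDimensional F V] {a : F}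
    (hrn : r ≤ n) (hS : ∀ u ∈ S, (X r : A) • u ∈ S)
    (ha : ∀ u ∈ S, (X r : A) • u = a • u → u = 0) (j : ℕ) (hj : r + j ≤ n) (Q : Submodule F V)
    (hQ : ∀ y ∈ typeASpan T r S j, ∀ b ≠ a, (X r : A) • y - b • y ∈ Q → y ∈ Q) :
    typeASpan T r S j ≤ Q := by
  induction j generalizing Q with
  | zero => exact le_of_saturated hS ha hQ
  | succ j ih =>
    refine cosetSpan_le fun s (hs : s < j + 1) u hu => ?_
    refine ih (by omega) (Q.comap (Algebra.lsmul F F V (cosetWord T (r + j) s)))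
      (fun y hy b hb h => ?_) hu
    refine hQ _ (cosetWord_smul_mem_cosetSpan hs hy) b hb ?_
    have e : (X r : A) • cosetWord T (r + j) s • y - b • cosetWord T (r + j) s • y =
        cosetWord T (r + j) s • ((X r : A) • y - b • y) := by
      rw [← mul_smul, X_mul_cosetWord_of_ne H (by omega) (by omega) hrn, mul_smul, smul_sub,
        smul_comm b]
      intro t ht; simp only [cosetLetter]; omega
    change (X r : A) • cosetWord T (r + j) s • y - b • cosetWord T (r + j) s • y ∈ Q
    rw [e]; exact h

theorem typeASpan_le_heckeSpan (j : ℕ) : typeASpan T r S j ≤ heckeSpan T r S j := by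
  induction j with
  | zero => exact le_refl _
  | succ j ih =>
    exact cosetSpan_le fun s (hs : s < j + 1) u hu =>
      cosetWord_smul_mem_cosetSpan (by dsimp only; omega) (ih hu)

include H hp hq

/-- This is the Mackey filtration argument: modulo the type `A` part, every layer of the span has,
at some position beyond `r`, only eigenvalues different from `a`. The subspace `Q` is kept arbitrary
because the induction passes to its preimage under a coset word. -/
theorem heckeSpan_le_of_saturated [IsAlgClosed F] [FiniteDimensional F V] {a : F} (ha0 : a ≠ 0)
    (ha : a⁻¹ ≠ a) (hr : r ≤ n) (hST : ∀ i < r, ∀ u ∈ S, T i • u ∈ S)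
    (hSX : ∀ f ∈ latticeAlg F n X, ∀ u ∈ S, f • u ∈ S)
    (hSa : ∀ l, r < l → l ≤ n → ∀ u ∈ S, (X l : A) • u = a • u)
    (hSr : 1 ≤ r → ∀ u ∈ S, (X r : A) • u = a • u → u = 0) (j : ℕ) (hj : r + j ≤ n)
    (Q : Submodule F V) (hDQ : typeASpan T r S j ≤ Q)
    (hQ : ∀ y ∈ heckeSpan T r S j, ∀ l, r < l → l ≤ r + j → ∀ b ≠ a,
      (X l : A) • y - b • y ∈ Q → y ∈ Q) :
    heckeSpan T r S j ≤ Q := by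
  induction j generalizing Q with
  | zero => exact hDQ
  | succ j ih =>
    have hk : r + j < n := by omega
    obtain ⟨hT, hX⟩ := heckeSpan_stable H hp hq hST hSX j (by omega)
    have hXa : ∀ u ∈ heckeSpan T r S j, (X (r + j + 1) : A) • u = a • u := fun u hu =>
      X_smul_iterCosetSpan H (fun _ => le_refl _) hSa (Nat.lt_succ_self _) (by omega) hu
    suffices hs : ∀ s, s ≤ 2 * (r + j) + 1 → ∀ y ∈ heckeSpan T r S j,
        cosetWord T (r + j) s • y ∈ Q from
      cosetSpan_le fun s (hs' : s < 2 * (r + j) + 2) y hy => hs s (by omega) y hy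
    intro s
    induction s using Nat.strong_induction_on with
    | _ s ihs =>
    intro hs
    have hG : cosetSpan T (r + j) s (heckeSpan T r S j) ≤ Q :=
      cosetSpan_le fun t ht u hu => ihs t ht (by omega) u hu
    have hmem : ∀ y ∈ heckeSpan T r S j, cosetWord T (r + j) s • y ∈ heckeSpan T r S (j + 1) :=
      fun y hy => cosetWord_smul_mem_cosetSpan (by dsimp only; omega) hy
    -- The word has turned at `T_0` and climbed back beyond position `r`, so `a⁻¹` occurs as an
    -- eigenvalue in the tail, modulo shorter words.
    by_cases hs1 : r + j + r < s
    · intro y hy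
      obtain ⟨d, rfl⟩ : ∃ d, s = r + j + 1 + d := ⟨s - (r + j + 1), by omega⟩
      have h := X_inv_smul_cosetWord_sub_mem H hp hq hk hT hX hXa ha0 (d := d) (by omega) hy
      rw [smul_comm _ a⁻¹ y] at h
      exact hQ _ (hmem y hy) (d + 1) (by omega) (by omega) a⁻¹ ha (hG h)
    have red : ∀ (l l' : ℕ) (u : V) (b : F), u ∈ heckeSpan T r S j → r < l' → l' ≤ r + (j + 1) →
        b ≠ a → (X l' : A) • cosetWord T (r + j) s • u - cosetWord T (r + j) s • (X l : A) • u ∈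
          cosetSpan T (r + j) s (heckeSpan T r S j) →
        cosetWord T (r + j) s • ((X l : A) • u - b • u) ∈ Q → cosetWord T (r + j) s • u ∈ Q := by
      intro l l' u b hu h1 h2 hb h3 h4
      refine hQ _ (hmem u hu) l' h1 h2 b hb ?_
      have := add_mem (hG h3) h4
      rwa [smul_sub, sub_add_sub_cancel, smul_comm _ b u] at this
    -- Saturation at position `l + 1` for `Q` becomes saturation at position `l` for the preimage of
    -- `Q` under the word.
    have shift : ∀ l, 1 ≤ l → r ≤ l → l ≤ r + j → r + j + 1 ≤ l + s → ∀ u ∈ heckeSpan T r S j,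
        ∀ b ≠ a, cosetWord T (r + j) s • ((X l : A) • u - b • u) ∈ Q →
        cosetWord T (r + j) s • u ∈ Q := fun l h0 h1 h2 h3 u hu b hb h4 =>
      red l (l + 1) u b hu (by omega) (by omega) hb
        (X_succ_smul_cosetWord_sub_mem H hp hq hk hT hX hs h0 h2 h3 (by omega) hu) h4
    let Q' : Submodule F V := Q.comap (Algebra.lsmul F F V (cosetWord T (r + j) s))
    -- Here all letters exceed `r`, so the word maps the type `A` span of step `j` into that of step
    -- `j + 1`. Positions `l` not reached by the word commute with it; the others are shifted by
    -- one.
    by_cases hs2 : s ≤ j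
    · refine ih (by omega) Q'
        (fun y hy => hDQ (cosetWord_smul_mem_cosetSpan (by dsimp only; omega) hy)) ?_
      intro y hy l hl hl' b hb h
      by_cases hls : r + j + 1 ≤ l + s
      · exact shift l (by omega) (by omega) (by omega) hls y hy b hb h
      · refine red l l y b hy hl (by omega) hb ?_ h
        rw [← mul_smul, X_mul_cosetWord_of_ne H (by omega) (by omega) (by omega), mul_smul,
          sub_self]
        · exact zero_mem _
        · intro t ht; simp only [cosetLetter]; omega
    -- Now `j < s ≤ 2r + j`, which forces `r ≥ 1`. The word moves position `r` to `r + 1`, into the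
    -- tail, and `X_r` does not have the eigenvalue `a` on `S`; so even the type `A` part lies in
    -- the preimage.
    · refine ih (by omega) Q' ?_ fun y hy l hl hl' b hb h =>
        shift l (by omega) (by omega) (by omega) (by omega) y hy b hb h
      exact typeASpan_le_of_saturated H hr (hSX _ (X_mem_latticeAlg hr)) (hSr (by omega)) j
        (by omega) Q' fun y hy b hb h => shift r (by omega) (by omega) (by omega) (by omega) y
          (typeASpan_le_heckeSpan j hy) b hb h

end Shuffle

/-! ### Kato's argument in type `A`, and the end of the shuffle lemma -/

section Kato

variable {F A V : Type*} [Field F] [Ring A] [Algebra F A] [AddCommGroup V] [Module F V]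
  [Module A V] [IsScalarTower F A V] {p q : F} {n : ℕ} {T : ℕ → A} {X : ℕ → Aˣ}
  (H : HeckeFamily p q n T X) (hp : p ≠ 0) (hq : q ≠ 0) {r : ℕ} {S : Submodule F V} {a : F}
  (hSX : ∀ f ∈ latticeAlg F n X, ∀ u ∈ S, f • u ∈ S)
  (hSa : ∀ l, r < l → l ≤ n → ∀ u ∈ S, (X l : A) • u = a • u)

include H hSa in
theorem X_smul_typeASpan {j l : ℕ} (hl : r + j < l) (hln : l ≤ n) {u : V}
    (hu : u ∈ typeASpan T r S j) : (X l : A) • u = a • u :=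
  X_smul_iterCosetSpan H (fun _ => by omega) hSa hl hln hu

include H hSX hp hq in
theorem cosetWord_smul_mem_typeASpan {j s : ℕ} (hj : r + j + 1 ≤ n) (hs : s ≤ j) {y : V}
    (hy : y ∈ typeASpan T r S (j + 1)) : cosetWord T (r + j) s • y ∈ typeASpan T r S (j + 1) :=
  cosetWord_smul_mem (fun t ht => (typeASpan_stable H hp hq hSX (j + 1) (by omega)).1 _
    (by simp only [cosetLetter]; omega) (by simp only [cosetLetter]; omega)) hy

include H hp hq hSa

/-- The action of `X_{k+1} - a` on a coset word applied to `y`, `k = r + j + 1`. -/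
theorem X_sub_smul_cosetWord {j s : ℕ} (hj : r + j + 1 < n) (hs : s ≤ j) {y : V}
    (hy : y ∈ typeASpan T r S (j + 1)) :
    ((X (r + j + 2) : A) - algebraMap F A a) • cosetWord T (r + j + 1) (s + 1) • y =
      cosetWord T (r + j + 1) (s + 1) • ((X (r + j + 1) : A) - algebraMap F A a) • y +
        (heckeCoeff p q (r + j + 1) * a) • cosetWord T (r + j) s • y := by
  have h1 : (X (r + j + 2) : A) • cosetWord T (r + j + 1) (s + 1) • y =
      cosetWord T (r + j + 1) (s + 1) • (X (r + j + 1) : A) • y +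
        (heckeCoeff p q (r + j + 1) * a) • cosetWord T (r + j) s • y := by
    rw [← mul_smul, cosetWord_succ_succ T (by omega), ← mul_assoc,
      X_mul_cosetWord_of_ne H (by omega) (by omega) (by omega), mul_assoc,
      H.X_succ_mul_T hp hq (by omega) hj, mul_add, add_smul, mul_smul_comm, smul_assoc,
      mul_smul _ (X (r + j + 1 + 1) : A), X_smul_typeASpan H hSa (by omega) (by omega) hy,
      smul_comm _ a y, ← mul_smul (heckeCoeff p q (r + j + 1)), ← mul_assoc, mul_smul _ (X _ : A)]
    intro t ht; simp only [cosetLetter]; omega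
  rw [sub_smul, h1, sub_smul, smul_sub, algebraMap_smul, algebraMap_smul,
    smul_comm _ a y]
  abel

include hSX

/-- Each step of the induction adds one to the nilpotency order: up to a term from the previous
span, powers of `X_{k+1} - a` pass through a coset word as powers of `X_k - a`. -/
theorem X_sub_pow_smul_typeASpan (j : ℕ) (hj : r + j + 1 ≤ n) {y : V}
    (hy : y ∈ typeASpan T r S (j + 1)) :
    ((X (r + j + 1) : A) - algebraMap F A a) ^ (j + 1) • y = 0 := by
  induction j generalizing y with
  | zero =>
    rw [typeASpan, iterCosetSpan, zero_add, cosetSpan_one] at hy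
    rw [zero_add, pow_one, sub_smul, algebraMap_smul, hSa _ (by omega) (by omega) y hy, sub_self]
  | succ j ih =>
    have kill : ∀ d ∈ typeASpan T r S (j + 1),
        ((X (r + j + 2) : A) - algebraMap F A a) • d = 0 := fun d hd => by
      rw [sub_smul, algebraMap_smul, X_smul_typeASpan H hSa (by omega) (by omega) hd, sub_self]
    suffices h : ∀ s < j + 2, ∀ u ∈ typeASpan T r S (j + 1),
        ((X (r + j + 2) : A) - algebraMap F A a) ^ (j + 2) • cosetWord T (r + j + 1) s • u ∈
          (⊥ : Submodule F V) from
      (Submodule.mem_bot F).1 (smul_mem_of_mem_cosetSpan (W := (⊥ : Submodule F V)) h hy)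
    intro s hs u hu
    rw [Submodule.mem_bot]
    rcases s with _ | s
    · rw [cosetWord, one_smul, pow_succ, mul_smul, kill u hu, smul_zero]
    have hN : ∀ i, ((X (r + j + 1) : A) - algebraMap F A a) ^ i • u ∈ typeASpan T r S (j + 1) :=
      fun i => (typeASpan_stable H hp hq hSX (j + 1) (by omega)).2 _ (pow_mem (sub_mem
        (X_mem_latticeAlg (by omega)) (Subalgebra.algebraMap_mem _ _)) _) u hu
    -- The correction terms do not accumulate, because `X_{k+1} - a` annihilates the previous span.
    have claim : ∀ i, ∃ d ∈ typeASpan T r S (j + 1),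
        ((X (r + j + 2) : A) - algebraMap F A a) ^ i • cosetWord T (r + j + 1) (s + 1) • u =
        cosetWord T (r + j + 1) (s + 1) •
          ((X (r + j + 1) : A) - algebraMap F A a) ^ i • u + d := by
      intro i
      induction i with
      | zero => exact ⟨0, zero_mem _, by simp⟩
      | succ i ihi =>
        obtain ⟨d, hd, e⟩ := ihi
        refine ⟨(heckeCoeff p q (r + j + 1) * a) • cosetWord T (r + j) s •
          ((X (r + j + 1) : A) - algebraMap F A a) ^ i • u, Submodule.smul_mem _ _
          (cosetWord_smul_mem_typeASpan H hp hq hSX (by omega) (by omega) (hN i)), ?_⟩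
        rw [pow_succ', mul_smul, e, smul_add, kill d hd, add_zero,
          X_sub_smul_cosetWord H hp hq hSa (by omega) (by omega) (hN i), pow_succ',
          mul_smul _ (_ ^ i)]
    obtain ⟨d, hd, e⟩ := claim (j + 1)
    rw [pow_succ', mul_smul, e, ih (by omega) hu, smul_zero, zero_add, kill d hd]

/-- The coset words are independent over the previous span, and the `a`-eigenvectors of the last
lattice operator lie in the previous span. -/
theorem typeASpan_independent_and_eigenvectors (ha0 : a ≠ 0) (hc : q - q⁻¹ ≠ 0) (j : ℕ)
    (hj : r + j + 1 ≤ n) :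
    (∀ y : ℕ → V, (∀ s ≤ j, y s ∈ typeASpan T r S j) →
      ∑ s ∈ Finset.range (j + 1), cosetWord T (r + j) s • y s = 0 → ∀ s ≤ j, y s = 0) ∧
    (∀ v ∈ typeASpan T r S (j + 1), (X (r + j + 1) : A) • v = a • v →
      v ∈ typeASpan T r S j) := by
  induction j with
  | zero =>
    refine ⟨fun y _ h s hs => ?_, fun v hv _ => ?_⟩
    · obtain rfl : s = 0 := by omega
      simpa [cosetWord] using h
    · rwa [typeASpan, iterCosetSpan, zero_add, cosetSpan_one] at hv
  | succ j ih =>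
    obtain ⟨ih1, ih2⟩ := ih (by omega)
    set N : A := (X (r + j + 1) : A) - algebraMap F A a with hN
    set N' : A := (X (r + j + 2) : A) - algebraMap F A a with hN'
    have hNmem : ∀ u ∈ typeASpan T r S (j + 1), N • u ∈ typeASpan T r S (j + 1) :=
      fun u hu => (typeASpan_stable H hp hq hSX (j + 1) (by omega)).2 _ (sub_mem
        (X_mem_latticeAlg (by omega)) (Subalgebra.algebraMap_mem _ _)) u hu
    have hca : heckeCoeff p q (r + j + 1) * a ≠ 0 :=
      mul_ne_zero (by simpa [heckeCoeff, heckeParam] using hc) ha0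
    -- `N'` acts on tuples
    let step : (ℕ → V) → ℕ → V := fun y s => match s with
      | 0 => (heckeCoeff p q (r + j + 1) * a) •
          ∑ s ∈ Finset.range (j + 1), cosetWord T (r + j) s • y (s + 1)
      | s + 1 => N • y (s + 1)
    have step_mem : ∀ y : ℕ → V, (∀ s ≤ j + 1, y s ∈ typeASpan T r S (j + 1)) →
        ∀ s ≤ j + 1, step y s ∈ typeASpan T r S (j + 1) := by
      intro y hy s hs
      rcases s with _ | s
      · refine Submodule.smul_mem _ _ (Submodule.sum_mem _ fun s hs => ?_)
        rw [Finset.mem_range] at hs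
        exact cosetWord_smul_mem_typeASpan H hp hq hSX (by omega) (by omega) (hy _ (by omega))
      · exact hNmem _ (hy _ hs)
    have step_sum : ∀ y : ℕ → V, (∀ s ≤ j + 1, y s ∈ typeASpan T r S (j + 1)) →
        N' • ∑ s ∈ Finset.range (j + 2), cosetWord T (r + j + 1) s • y s =
        ∑ s ∈ Finset.range (j + 2), cosetWord T (r + j + 1) s • step y s := by
      intro y hy
      rw [Finset.sum_range_succ' _ (j + 1), Finset.sum_range_succ' (fun s => _ • step y s) (j + 1),
        smul_add, Finset.smul_sum]
      have e0 : N' • cosetWord T (r + j + 1) 0 • y 0 = 0 := by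
        rw [cosetWord, one_smul, hN', sub_smul, algebraMap_smul,
          X_smul_typeASpan H hSa (by omega) (by omega) (hy 0 (by omega)), sub_self]
      rw [e0, add_zero]
      simp only [step]
      rw [cosetWord, one_smul, Finset.smul_sum, ← Finset.sum_add_distrib]
      refine Finset.sum_congr rfl fun s hs => ?_
      rw [Finset.mem_range] at hs
      exact X_sub_smul_cosetWord H hp hq hSa (by omega) (by omega) (hy _ (by omega))
    -- If the image tuple vanishes, its entries `N y_{s+1}` put each `y_{s+1}` into the smaller
    -- span, by the eigenvector half of the induction hypothesis. Its zeroth entry, after cancelling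
    -- `c a ≠ 0`, is a relation over that smaller span, and the independence half makes it trivial.
    have core : ∀ y : ℕ → V, (∀ s ≤ j + 1, y s ∈ typeASpan T r S (j + 1)) →
        (∀ s ≤ j + 1, step y s = 0) → ∀ s ≤ j, y (s + 1) = 0 := by
      intro y hy h
      refine ih1 (fun s => y (s + 1)) (fun s hs => ih2 _ (hy _ (by omega)) ?_) ?_
      · have := h (s + 1) (by omega)
        simp only [step, hN, sub_smul, algebraMap_smul] at this
        exact sub_eq_zero.1 this
      · exact (smul_eq_zero.1 (h 0 (by omega))).resolve_left hca
    -- The induction is on the nilpotency order of `N` on the entries after the first. Applying `N'`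
    -- to a relation gives another relation, on the image tuple, whose order is smaller by one.
    have indep : ∀ i (y : ℕ → V), (∀ s ≤ j + 1, y s ∈ typeASpan T r S (j + 1)) →
        (∀ s ≤ j, N ^ i • y (s + 1) = 0) →
        ∑ s ∈ Finset.range (j + 2), cosetWord T (r + j + 1) s • y s = 0 →
        ∀ s ≤ j + 1, y s = 0 := by
      intro i
      have last : ∀ y : ℕ → V, (∀ s ≤ j, y (s + 1) = 0) →
          ∑ s ∈ Finset.range (j + 2), cosetWord T (r + j + 1) s • y s = 0 →
          ∀ s ≤ j + 1, y s = 0 := by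
        intro y h hs s hsj
        rcases s with _ | s
        · rw [Finset.sum_range_succ', Finset.sum_eq_zero, zero_add, cosetWord, one_smul] at hs
          · exact hs
          · intro s hs
            rw [Finset.mem_range] at hs
            rw [h s (by omega), smul_zero]
        · exact h s (by omega)
      induction i with
      | zero => exact fun y _ h => last y fun s hs => by simpa using h s hs
      | succ i ihi =>
        intro y hy h hsum
        refine last y (core y hy (ihi (step y) (step_mem y hy) (fun s hs => ?_) ?_)) hsum
        · simp only [step]
          rw [← mul_smul, ← pow_succ]; exact h s hs
        · rw [← step_sum y hy, hsum, smul_zero]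
    have indep' : ∀ y : ℕ → V, (∀ s ≤ j + 1, y s ∈ typeASpan T r S (j + 1)) →
        ∑ s ∈ Finset.range (j + 2), cosetWord T (r + j + 1) s • y s = 0 →
        ∀ s ≤ j + 1, y s = 0 := fun y hy hs =>
      indep (j + 1) y hy (fun s hs => X_sub_pow_smul_typeASpan H hp hq hSX hSa j (by omega)
        (hy _ (by omega))) hs
    refine ⟨indep', fun v hv hv' => ?_⟩
    obtain ⟨y, hy, rfl⟩ := exists_sum_of_mem_cosetSpan hv
    have h0 := step_sum y fun s _ => hy s
    have hz : N' • ∑ s ∈ Finset.range (j + 2), cosetWord T (r + j + 1) s • y s = 0 := by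
      rw [hN', sub_smul, algebraMap_smul]; exact sub_eq_zero.2 hv'
    rw [hz] at h0
    have h1 := core y (fun s _ => hy s)
      (indep' (step y) (step_mem y fun s _ => hy s) h0.symm)
    rw [Finset.sum_range_succ', Finset.sum_eq_zero, zero_add, cosetWord, one_smul]
    · exact hy 0
    · intro s hs
      rw [Finset.mem_range] at hs
      rw [h1 s (by omega), smul_zero]

/-- **Shuffle lemma.** If `S` generates `V`, is stable under the Hecke algebra of type `B_r`, the
operators `X_{r+1}, …, X_n` act on `S` by `a`, and `a` is not an eigenvalue of `X_r` on `S`, then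
`S` is the simultaneous `a`-eigenspace of `X_{r+1}, …, X_n` on `V`. -/
theorem mem_of_forall_X_smul_eq [IsAlgClosed F] [FiniteDimensional F V] (ha0 : a ≠ 0)
    (ha : a⁻¹ ≠ a) (hc : q - q⁻¹ ≠ 0) (hr : r ≤ n) (hST : ∀ i < r, ∀ u ∈ S, T i • u ∈ S)
    (hSr : 1 ≤ r → ∀ u ∈ S, (X r : A) • u = a • u → u = 0)
    (hgen : ∀ W : Submodule F V, S ≤ W → (∀ i < n, ∀ u ∈ W, T i • u ∈ W) →
      (∀ f ∈ latticeAlg F n X, ∀ u ∈ W, f • u ∈ W) → W = ⊤)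
    {v : V} (hv : ∀ l, r < l → l ≤ n → (X l : A) • v = a • v) : v ∈ S := by
  obtain ⟨m, rfl⟩ : ∃ m, n = r + m := ⟨n - r, by omega⟩
  have hS_le : ∀ j, S ≤ heckeSpan T r S j := by
    intro j
    induction j with
    | zero => exact le_refl _
    | succ j ih => exact ih.trans (le_cosetSpan (Nat.succ_pos _))
  have htop : heckeSpan T r S m = ⊤ := by
    obtain ⟨h1, h2⟩ := heckeSpan_stable H hp hq hST hSX m (le_refl _)
    exact hgen _ (hS_le m) (fun i hi => h1 i (Nat.zero_le _) hi) h2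
  -- These products act invertibly on every joint `a`-eigenvector of the tail.
  let Mon : Submonoid A := Submonoid.closure {f | ∃ l b, r < l ∧ l ≤ r + m ∧ b ≠ a ∧
    f = (X l : A) - algebraMap F A b}
  have hMon : ∀ f ∈ Mon, f ∈ latticeAlg F (r + m) X := by
    refine (Submonoid.closure_le (S := (latticeAlg F (r + m) X).toSubmonoid)).2 ?_
    rintro _ ⟨l, b, hl, hl', hb, rfl⟩
    change _ ∈ latticeAlg F (r + m) X
    exact sub_mem (X_mem_latticeAlg hl') (Subalgebra.algebraMap_mem _ _)
  have hDX := (typeASpan_stable H hp hq hSX m (le_refl _)).2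
  -- The vectors that become elements of the type `A` span after inverting `Mon`. Commutativity of
  -- the lattice makes this a subspace, and it is saturated by construction.
  let Q : Submodule F V :=
    { carrier := {u | ∃ f ∈ Mon, f • u ∈ typeASpan T r S m}
      zero_mem' := ⟨1, one_mem _, by rw [smul_zero]; exact zero_mem _⟩
      add_mem' := by
        rintro u u' ⟨f, hf, hu⟩ ⟨f', hf', hu'⟩
        refine ⟨f * f', mul_mem hf hf', ?_⟩
        rw [smul_add, mul_smul f f' u', (latticeAlg_commute H.X_comm (hMon f hf) (hMon f' hf')).eq,
          mul_smul]
        exact add_mem (hDX _ (hMon f' hf') _ hu) (hDX _ (hMon f hf) _ hu')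
      smul_mem' := by
        rintro c u ⟨f, hf, hu⟩
        exact ⟨f, hf, by rw [smul_comm]; exact Submodule.smul_mem _ _ hu⟩ }
  have hQ : heckeSpan T r S m ≤ Q := by
    refine heckeSpan_le_of_saturated H hp hq ha0 ha (by omega) hST hSX hSa hSr m (le_refl _) Q
      (fun u hu => ⟨1, one_mem _, by rwa [one_smul]⟩) ?_
    rintro y - l hl hl' b hb ⟨f, hf, hy⟩
    refine ⟨f * ((X l : A) - algebraMap F A b),
      mul_mem hf (Submonoid.subset_closure ⟨l, b, hl, hl', hb, rfl⟩), ?_⟩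
    rwa [mul_smul, sub_smul, algebraMap_smul]
  have hvD : v ∈ typeASpan T r S m := by
    obtain ⟨f, hf, hfv⟩ := hQ (htop ▸ trivial : v ∈ heckeSpan T r S m)
    -- On the joint eigenvector each factor `X_l - b` is the nonzero scalar `a - b`, so membership
    -- in `Q` improves to membership in the type `A` span itself.
    have hχ : ∃ c : F, c ≠ 0 ∧ f • v = c • v := by
      clear hfv
      induction hf using Submonoid.closure_induction with
      | mem f hf =>
        obtain ⟨l, b, hl, hl', hb, rfl⟩ := hf
        refine ⟨a - b, sub_ne_zero.2 hb.symm, ?_⟩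
        rw [sub_smul, algebraMap_smul, hv l hl hl', sub_smul]
      | one => exact ⟨1, one_ne_zero, by simp⟩
      | mul f g _ _ hf hg =>
        obtain ⟨c, hc, e⟩ := hf
        obtain ⟨d, hd, e'⟩ := hg
        exact ⟨c * d, mul_ne_zero hc hd, by rw [mul_smul, e', smul_comm, e, smul_smul, mul_comm]⟩
    obtain ⟨c, hc, e⟩ := hχ
    rw [e] at hfv
    have := Submodule.smul_mem _ c⁻¹ hfv
    rwa [smul_smul, inv_mul_cancel₀ hc, one_smul] at this
  -- Being an eigenvector of the last lattice operator lowers the type `A` span by one step, and the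
  -- eigenvector condition is available at every position down to `r + 1`.
  have descend : ∀ i ≤ m, v ∈ typeASpan T r S (m - i) := by
    intro i
    induction i with
    | zero => exact fun _ => hvD
    | succ i ih =>
      intro hi
      have e : m - i = m - (i + 1) + 1 := by omega
      refine (typeASpan_independent_and_eigenvectors H hp hq hSX hSa ha0 hc (m - (i + 1))
        (by omega)).2 v ?_ (hv _ (by omega) (by omega))
      rw [← e]; exact ih (by omega)
  have := descend m (le_refl _)
  rwa [Nat.sub_self] at this

end Kato

/-! ## The polynomial representation -/

section RationalFunctions

variable (F : Type u) [Field F]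

/-- The group algebra of the lattice. -/
abbrev LatticeRing := AddMonoidAlgebra F (ℕ →₀ ℤ)

/-- The field of rational functions in `x_0, x_1, …`. -/
abbrev RatField := FractionRing (LatticeRing F)

/-- Laurent monomials. -/
noncomputable def ratMon (l : ℕ →₀ ℤ) : RatField F :=
  algebraMap (LatticeRing F) (RatField F) (AddMonoidAlgebra.single l 1)

/-- The variables. -/
noncomputable def ratVar (j : ℕ) : RatField F := ratMon F (Finsupp.single j 1)

variable {F}

theorem ratMon_zero : ratMon F 0 = 1 := by
  rw [ratMon, ← AddMonoidAlgebra.one_def, map_one]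

theorem ratMon_add (l m : ℕ →₀ ℤ) : ratMon F (l + m) = ratMon F l * ratMon F m := by
  rw [ratMon, ratMon, ratMon, ← map_mul, AddMonoidAlgebra.single_mul_single, one_mul]

theorem ratMon_injective : Function.Injective (ratMon F) := fun l m h => by
  have h1 := IsFractionRing.injective (LatticeRing F) (RatField F) h
  have h2 := congrArg AddMonoidAlgebra.coeff h1
  simpa using (Finsupp.single_left_inj (one_ne_zero (α := F))).1 h2

theorem ratMon_ne_zero (l : ℕ →₀ ℤ) : ratMon F l ≠ 0 := fun h => by
  have := ratMon_add (F := F) l (-l)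
  rw [h, zero_mul, add_neg_cancel, ratMon_zero] at this
  exact one_ne_zero this

theorem ratMon_neg (l : ℕ →₀ ℤ) : ratMon F (-l) = (ratMon F l)⁻¹ := by
  exact eq_inv_of_mul_eq_one_left (by rw [← ratMon_add, neg_add_cancel, ratMon_zero])

theorem ratVar_ne_zero (j : ℕ) : ratVar F j ≠ 0 := ratMon_ne_zero _

theorem ratVar_ne_one (j : ℕ) : ratVar F j ≠ 1 := fun h => by
  rw [ratVar, ← ratMon_zero] at h
  simpa using ratMon_injective h

theorem ratVar_ne_inv (j k : ℕ) : ratVar F j ≠ (ratVar F k)⁻¹ := fun h => by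
  rw [ratVar, ratVar, ← ratMon_neg] at h
  have h := DFunLike.congr_fun (ratMon_injective h) j
  by_cases e : k = j <;> simp [e] at h

theorem ratVar_injective : Function.Injective (ratVar F) := fun j k h => by
  simpa using Finsupp.single_left_injective (one_ne_zero (α := ℤ)) (ratMon_injective h)

theorem ratMon_single (j : ℕ) (k : ℤ) : ratMon F (Finsupp.single j k) = ratVar F j ^ k := by
  let f : Multiplicative ℤ →* RatField F :=
    { toFun := fun k => ratMon F (Finsupp.single j k.toAdd)
      map_one' := by simp [ratMon_zero]
      map_mul' := fun a b => by simp [Finsupp.single_add, ratMon_add] }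
  have hk : Multiplicative.ofAdd k = Multiplicative.ofAdd (1 : ℤ) ^ k := by
    rw [← ofAdd_zsmul, smul_eq_mul, mul_one]
  have h := map_zpow' f (fun x => by
    change ratMon F _ = (ratMon F _)⁻¹
    rw [← ratMon_neg, toAdd_inv, Finsupp.single_neg]) (Multiplicative.ofAdd (1 : ℤ)) k
  rw [← hk] at h
  exact h

theorem ratField_algHom_ext {f g : RatField F →ₐ[F] RatField F}
    (h : ∀ j, f (ratVar F j) = g (ratVar F j)) : f = g := by
  refine IsLocalization.algHom_ext (nonZeroDivisors (LatticeRing F)) ?_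
  have hl : ∀ l, f (ratMon F l) = g (ratMon F l) := by
    intro l
    induction l using Finsupp.induction_linear with
    | zero => simp [ratMon_zero]
    | add l m hl hm => rw [ratMon_add, map_mul, map_mul, hl, hm]
    | single j k => rw [ratMon_single, map_zpow₀, map_zpow₀, h]
  refine AddMonoidAlgebra.algHom_ext (fun m => hl m) ?_
  ext

/-- The simple reflections of the lattice. -/
noncomputable def latticeReflection (i : ℕ) : (ℕ →₀ ℤ) ≃+ (ℕ →₀ ℤ) :=
  let f : (ℕ →₀ ℤ) →+ (ℕ →₀ ℤ) :=
    { toFun := fun l => if i = 0 then l + Finsupp.single 1 (l 0 - 2 * l 1)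
        else l + Finsupp.single i (l (i + 1) - l i) + Finsupp.single (i + 1) (l i - l (i + 1))
      map_zero' := by simp
      map_add' := fun l m => by
        ext j
        by_cases h : i = 0
        · simp only [h, if_true, Finsupp.add_apply, Finsupp.single_apply]
          split_ifs <;> ring
        · simp only [h, if_false, Finsupp.add_apply, Finsupp.single_apply]
          split_ifs <;> ring }
  { f with
    invFun := f
    left_inv := fun l => by
      ext j
      by_cases h : i = 0
      · simp [f, h, Finsupp.single_apply]
        split_ifs with h1
        · subst h1; ring
        · ring
      · simp [f, h, Finsupp.single_apply]
        split_ifs with h1 h2 h2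
        · omega
        · subst h1; ring
        · subst h2; ring
        · ring
    right_inv := fun l => by
      ext j
      by_cases h : i = 0
      · simp [f, h, Finsupp.single_apply]
        split_ifs with h1
        · subst h1; ring
        · ring
      · simp [f, h, Finsupp.single_apply]
        split_ifs with h1 h2 h2
        · omega
        · subst h1; ring
        · subst h2; ring
        · ring }

theorem latticeReflection_apply (i : ℕ) (l : ℕ →₀ ℤ) : latticeReflection i l =
    if i = 0 then l + Finsupp.single 1 (l 0 - 2 * l 1)
    else l + Finsupp.single i (l (i + 1) - l i) + Finsupp.single (i + 1) (l i - l (i + 1)) := rfl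

variable (F) in
/-- The simple reflections of the field of rational functions. -/
noncomputable def ratReflection (i : ℕ) : RatField F ≃ₐ[F] RatField F :=
  IsFractionRing.algEquivOfAlgEquiv (AddMonoidAlgebra.domCongr F F (latticeReflection i))

theorem ratReflection_ratMon (i : ℕ) (l : ℕ →₀ ℤ) :
    ratReflection F i (ratMon F l) = ratMon F (latticeReflection i l) := by
  rw [ratReflection, ratMon, IsFractionRing.algEquivOfAlgEquiv_algebraMap, ratMon]
  simp

theorem ratReflection_zero_zero :
    ratReflection F 0 (ratVar F 0) = ratVar F 0 * ratVar F 1 := by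
  rw [ratVar, ratReflection_ratMon, ratVar, ← ratMon_add, latticeReflection_apply]
  simp

theorem ratReflection_zero_one : ratReflection F 0 (ratVar F 1) = (ratVar F 1)⁻¹ := by
  rw [ratVar, ratReflection_ratMon, ← ratMon_neg, latticeReflection_apply]
  congr 1
  ext j
  simp [Finsupp.single_apply]
  split_ifs <;> rfl

theorem ratReflection_of_ne {i j : ℕ} (h1 : j ≠ i) (h2 : j ≠ i + 1) :
    ratReflection F i (ratVar F j) = ratVar F j := by
  rw [ratVar, ratReflection_ratMon, latticeReflection_apply]
  congr 1
  split_ifs with h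
  · subst h
    simp [h1, h2]
  · simp [h1, h2]

theorem ratReflection_self {i : ℕ} (h : 1 ≤ i) :
    ratReflection F i (ratVar F i) = ratVar F (i + 1) := by
  rw [ratVar, ratReflection_ratMon, latticeReflection_apply, if_neg (by omega)]
  simp [ratVar]

theorem ratReflection_succ {i : ℕ} (h : 1 ≤ i) :
    ratReflection F i (ratVar F (i + 1)) = ratVar F i := by
  rw [ratVar, ratReflection_ratMon, latticeReflection_apply, if_neg (by omega)]
  congr 1
  ext j
  simp [Finsupp.single_apply]

variable (F) in
/-- The endomorphism of the group algebra scaling the `j`-th variable by `c`. -/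
noncomputable def latticeScale (c : Fˣ) (j : ℕ) : LatticeRing F →ₐ[F] LatticeRing F :=
  AddMonoidAlgebra.lift F (LatticeRing F) (ℕ →₀ ℤ)
    { toFun := fun l => ((c ^ (l.toAdd j) : Fˣ) : F) • AddMonoidAlgebra.single l.toAdd 1
      map_one' := by simp [AddMonoidAlgebra.one_def]
      map_mul' := fun l m => by
        rw [toAdd_mul, Finsupp.add_apply, zpow_add, smul_mul_smul_comm,
          AddMonoidAlgebra.single_mul_single, one_mul, Units.val_mul] }

theorem latticeScale_single (c : Fˣ) (j : ℕ) (l : ℕ →₀ ℤ) :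
    latticeScale F c j (AddMonoidAlgebra.single l 1) =
      ((c ^ (l j) : Fˣ) : F) • AddMonoidAlgebra.single l 1 := by
  rw [latticeScale, AddMonoidAlgebra.lift_single, one_smul]
  rfl

theorem latticeScale_comp (c d : Fˣ) (h : c * d = 1) (j : ℕ) :
    (latticeScale F c j).comp (latticeScale F d j) = AlgHom.id F _ := by
  refine AddMonoidAlgebra.algHom_ext (fun l => ?_) (by ext)
  rw [AlgHom.comp_apply, latticeScale_single, map_smul, latticeScale_single, smul_smul,
    ← Units.val_mul, ← mul_zpow, mul_comm d, h, one_zpow, Units.val_one, one_smul, AlgHom.id_apply]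

variable (F) in
/-- The automorphism of the field of rational functions scaling the `j`-th variable by `c`. -/
noncomputable def ratScale (c : Fˣ) (j : ℕ) : RatField F ≃ₐ[F] RatField F :=
  IsFractionRing.algEquivOfAlgEquiv (AlgEquiv.ofAlgHom (latticeScale F c j) (latticeScale F c⁻¹ j)
    (latticeScale_comp c c⁻¹ (mul_inv_cancel c) j) (latticeScale_comp c⁻¹ c (inv_mul_cancel c) j))

theorem ratScale_ratVar (c : Fˣ) (j k : ℕ) :
    ratScale F c j (ratVar F k) = (if k = j then (c : F) else 1) • ratVar F k := by
  rw [ratScale, ratVar, ratMon, IsFractionRing.algEquivOfAlgEquiv_algebraMap,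
    AlgEquiv.ofAlgHom_apply, latticeScale_single, Algebra.algebraMap_eq_smul_one,
    Algebra.algebraMap_eq_smul_one, smul_assoc]
  congr 1
  by_cases h : k = j <;> simp [h]

end RationalFunctions

/-! ## Fields with an action of the Weyl group -/

/-- Elements `x 0, x 1, …` of a field with automorphisms `s 0, s 1, …` acting on them as the simple
reflections act on the lattice. -/
structure ReflectionSystem {F K : Type*} [Field F] [Field K] [Algebra F K] (x : ℕ → K)
    (s : ℕ → K ≃ₐ[F] K) : Prop where
  ext : ∀ f g : K →ₐ[F] K, (∀ j, f (x j) = g (x j)) → f = g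
  ne_zero : ∀ j, x j ≠ 0
  ne_one : ∀ j, x j ≠ 1
  ne_inv : ∀ j k, x j ≠ (x k)⁻¹
  injective : Function.Injective x
  zero_zero : s 0 (x 0) = x 0 * x 1
  zero_one : s 0 (x 1) = (x 1)⁻¹
  of_ne : ∀ i j, j ≠ i → j ≠ i + 1 → s i (x j) = x j
  self : ∀ i, 1 ≤ i → s i (x i) = x (i + 1)
  succ : ∀ i, 1 ≤ i → s i (x (i + 1)) = x i
  exists_scale : ∀ (c : Fˣ) (j : ℕ), ∃ t : K ≃ₐ[F] K, t (x j) = (c : F) • x j ∧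
    ∀ k ≠ j, t (x k) = x k

theorem reflectionSystem_ratField (F : Type u) [Field F] :
    ReflectionSystem (ratVar F) (ratReflection F) where
  ext _ _ h := ratField_algHom_ext h
  ne_zero := ratVar_ne_zero
  ne_one := ratVar_ne_one
  ne_inv := ratVar_ne_inv
  injective := ratVar_injective
  zero_zero := ratReflection_zero_zero
  zero_one := ratReflection_zero_one
  of_ne _ _ := ratReflection_of_ne
  self _ := ratReflection_self
  succ _ := ratReflection_succ
  exists_scale c j := ⟨ratScale F c j, by rw [ratScale_ratVar, if_pos rfl],
    fun k hk => by rw [ratScale_ratVar, if_neg hk, one_smul]⟩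

namespace ReflectionSystem

variable {F K : Type*} [Field F] [Field K] [Algebra F K] {x : ℕ → K} {s : ℕ → K ≃ₐ[F] K}
  (R : ReflectionSystem x s)

include R

theorem algEquiv_ext {f g : K ≃ₐ[F] K} (h : ∀ j, f (x j) = g (x j)) (z : K) : f z = g z :=
  DFunLike.congr_fun (R.ext f.toAlgHom g.toAlgHom h) z

theorem s_involutive (i : ℕ) (z : K) :
    s i (s i z) = z := by
  refine R.algEquiv_ext (f := (s i).trans (s i))
    (g := AlgEquiv.refl) (fun j => ?_) z
  simp only [AlgEquiv.trans_apply, AlgEquiv.coe_refl, id]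
  rcases Nat.eq_zero_or_pos i with rfl | hi
  · by_cases h0 : j = 0
    · subst h0
      rw [R.zero_zero, map_mul, R.zero_zero, R.zero_one,
        mul_assoc, mul_inv_cancel₀ (R.ne_zero 1), mul_one]
    by_cases h1 : j = 1
    · subst h1
      rw [R.zero_one, map_inv₀, R.zero_one, inv_inv]
    · rw [R.of_ne _ _ h0 h1, R.of_ne _ _ h0 h1]
  · by_cases h0 : j = i
    · subst h0
      rw [R.self _ hi, R.succ _ hi]
    by_cases h1 : j = i + 1
    · subst h1
      rw [R.succ _ hi, R.self _ hi]
    · rw [R.of_ne _ _ h0 h1, R.of_ne _ _ h0 h1]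

theorem s_comm {i j : ℕ} (h : i + 1 < j) (z : K) :
    s i (s j z) = s j (s i z) := by
  refine R.algEquiv_ext (f := (s j).trans (s i))
    (g := (s i).trans (s j)) (fun k => ?_) z
  simp only [AlgEquiv.trans_apply]
  have hj : 1 ≤ j := by omega
  by_cases h1 : k = j
  · subst h1
    rw [R.self _ hj, R.of_ne i _ (by omega) (by omega),
      R.of_ne i _ (by omega) (by omega), R.self _ hj]
  by_cases h2 : k = j + 1
  · subst h2
    rw [R.succ _ hj, R.of_ne i _ (by omega) (by omega),
      R.of_ne i _ (by omega) (by omega), R.succ _ hj]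
  rw [R.of_ne _ _ h1 h2]
  rcases Nat.eq_zero_or_pos i with rfl | hi
  · by_cases h3 : k = 0
    · subst h3
      rw [R.zero_zero, map_mul, R.of_ne _ _ h1 h2,
        R.of_ne _ _ (by omega) (by omega)]
    by_cases h4 : k = 1
    · subst h4
      rw [R.zero_one, map_inv₀, R.of_ne _ _ (by omega) (by omega)]
    rw [R.of_ne _ _ h3 h4, R.of_ne _ _ h1 h2]
  · by_cases h3 : k = i
    · subst h3
      rw [R.self _ hi, R.of_ne _ _ (by omega) (by omega)]
    by_cases h4 : k = i + 1
    · subst h4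
      rw [R.succ _ hi, R.of_ne _ _ (by omega) (by omega)]
    rw [R.of_ne _ _ h3 h4, R.of_ne _ _ h1 h2]

set_option linter.unusedSimpArgs false in
theorem s_braid {i : ℕ} (hi : 1 ≤ i) (z : K) :
    s i (s (i + 1) (s i z)) =
      s (i + 1) (s i (s (i + 1) z)) := by
  refine R.algEquiv_ext
    (f := ((s i).trans (s (i + 1))).trans (s i))
    (g := ((s (i + 1)).trans (s i)).trans (s (i + 1)))
    (fun k => ?_) z
  simp only [AlgEquiv.trans_apply]
  have a1 := R.self i hi
  have a2 := R.succ i hi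
  have a3 := R.self (i + 1) (by omega)
  have a4 := R.succ (i + 1) (by omega)
  have a5 := R.of_ne (i + 1) i (by omega) (by omega)
  have a6 := R.of_ne i (i + 1 + 1) (by omega) (by omega)
  by_cases h1 : k = i
  · subst h1; simp only [a1, a2, a3, a4, a5, a6]
  by_cases h2 : k = i + 1
  · subst h2; simp only [a1, a2, a3, a4, a5, a6]
  by_cases h3 : k = i + 1 + 1
  · subst h3; simp only [a1, a2, a3, a4, a5, a6]
  have b1 := R.of_ne _ _ h1 h2
  have b2 := R.of_ne _ _ h2 h3
  simp only [b1, b2]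

set_option linter.unusedSimpArgs false in
theorem s_braid_zero (z : K) :
    s 1 (s 0 (s 1 (s 0 z))) =
      s 0 (s 1 (s 0 (s 1 z))) := by
  refine R.algEquiv_ext
    (f := (((s 0).trans (s 1)).trans (s 0)).trans
      (s 1))
    (g := (((s 1).trans (s 0)).trans (s 1)).trans
      (s 0))
    (fun k => ?_) z
  simp only [AlgEquiv.trans_apply]
  have a1 := R.self 1 (le_refl 1)
  have a2 := R.succ 1 (le_refl 1)
  have a3 := R.zero_zero
  have a4 := R.zero_one
  have a5 := R.of_ne 0 2 (by omega) (by omega)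
  have a6 := R.of_ne 1 0 (by omega) (by omega)
  norm_num at a2 a1
  by_cases h1 : k = 0
  · subst h1; simp only [a1, a2, a3, a4, a5, a6, map_mul, map_inv₀]; ring
  by_cases h2 : k = 1
  · subst h2; simp only [a1, a2, a3, a4, a5, a6, map_mul, map_inv₀]
  by_cases h3 : k = 2
  · subst h3; simp only [a1, a2, a3, a4, a5, a6, map_mul, map_inv₀]
  have b1 := R.of_ne 0 _ h1 h2
  have b2 := R.of_ne 1 _ h2 h3
  simp only [b1, b2]

end ReflectionSystem

/-! ### Demazure–Lusztig operators and their relations -/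

section Demazure

variable {F K : Type*} [Field F] [Field K] [Algebra F K]

/-- The coefficient of the identity in the Demazure–Lusztig operator. -/
noncomputable def demazureCoeff (p q : F) (x : ℕ → K) (i : ℕ) : K :=
  if i = 0 then (algebraMap F K p - (algebraMap F K p)⁻¹) * x 1 / (x 1 - 1)
  else (algebraMap F K q - (algebraMap F K q)⁻¹) * x (i + 1) / (x (i + 1) - x i)

/-- The Demazure–Lusztig operators. -/
noncomputable def demazure (p q : F) (x : ℕ → K) (s : ℕ → K ≃ₐ[F] K) (i : ℕ) : Module.End F K :=
  Algebra.lmul F K (demazureCoeff p q x i) +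
    Algebra.lmul F K (algebraMap F K (heckeParam p q i) - demazureCoeff p q x i) ∘ₗ
      (s i).toLinearMap

theorem demazure_apply (p q : F) (x : ℕ → K) (s : ℕ → K ≃ₐ[F] K) (i : ℕ) (z : K) :
    demazure p q x s i z = demazureCoeff p q x i * z +
      (algebraMap F K (heckeParam p q i) - demazureCoeff p q x i) * s i z := rfl

theorem algEquiv_demazureCoeff_succ (t : K ≃ₐ[F] K) (p q : F) (x : ℕ → K) {i : ℕ} (hi : 1 ≤ i) :
    t (demazureCoeff p q x i) = (algebraMap F K q - (algebraMap F K q)⁻¹) * t (x (i + 1)) /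
      (t (x (i + 1)) - t (x i)) := by
  rw [demazureCoeff, if_neg (by omega)]
  simp

theorem algEquiv_demazureCoeff_zero (t : K ≃ₐ[F] K) (p q : F) (x : ℕ → K) :
    t (demazureCoeff p q x 0) = (algebraMap F K p - (algebraMap F K p)⁻¹) * t (x 1) /
      (t (x 1) - 1) := by
  simp [demazureCoeff]

end Demazure

namespace ReflectionSystem

variable {F K : Type*} [Field F] [Field K] [Algebra F K] {x : ℕ → K} {s : ℕ → K ≃ₐ[F] K}
  (R : ReflectionSystem x s)

/-- Multiplication by the variables, as units. -/
noncomputable def mulX (j : ℕ) : (Module.End F K)ˣ :=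
  Units.map (Algebra.lmul F K : K →* Module.End F K) (Units.mk0 (x j) (R.ne_zero j))

theorem mulX_apply (j : ℕ) (z : K) : (R.mulX j : Module.End F K) z = x j * z := rfl

include R

theorem sub_ne_zero_of_ne {i j : ℕ} (h : i ≠ j) : x i - x j ≠ 0 :=
  sub_ne_zero.2 fun e => h (R.injective e)

/-- The coefficients at a root and at its negative add up to `P - P⁻¹`. This is all that the
quadratic relation needs to know about them. -/
theorem s_demazureCoeff (p q : F) (i : ℕ) : s i (demazureCoeff p q x i) =
    algebraMap F K (heckeParam p q i) - (algebraMap F K (heckeParam p q i))⁻¹ -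
      demazureCoeff p q x i := by
  rcases Nat.eq_zero_or_pos i with rfl | hi
  · rw [algEquiv_demazureCoeff_zero, R.zero_one, demazureCoeff, if_pos rfl, heckeParam, if_pos rfl]
    have h1 := R.ne_zero 1
    have h2 : x 1 - 1 ≠ 0 := sub_ne_zero.2 (R.ne_one 1)
    have h3 : 1 - x 1 ≠ 0 := sub_ne_zero.2 (R.ne_one 1).symm
    generalize algebraMap F K p - (algebraMap F K p)⁻¹ = c
    have h4 : (x 1)⁻¹ - 1 = (1 - x 1) / x 1 := by field_simp
    rw [h4]
    field_simp
    ring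
  · rw [algEquiv_demazureCoeff_succ _ _ _ _ hi, R.self i hi, R.succ i hi, demazureCoeff,
      if_neg (by omega), heckeParam, if_neg (by omega)]
    have h2 := R.sub_ne_zero_of_ne (show i ≠ i + 1 by omega)
    have h3 := R.sub_ne_zero_of_ne (show i + 1 ≠ i by omega)
    generalize algebraMap F K q - (algebraMap F K q)⁻¹ = c
    field_simp
    ring

theorem demazure_quad (p q : F) (hp : p ≠ 0) (hq : q ≠ 0) (i : ℕ) :
    (demazure p q x s i - algebraMap F _ (heckeParam p q i)) *
      (demazure p q x s i + algebraMap F _ (heckeParam p q i)⁻¹) = 0 := by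
  ext z
  have h0 : algebraMap F K (heckeParam p q i) ≠ 0 := by
    rw [Ne, map_eq_zero, heckeParam]; split_ifs <;> assumption
  simp only [Module.End.mul_apply, LinearMap.sub_apply, LinearMap.add_apply, demazure_apply,
    Module.algebraMap_end_apply, map_add, map_mul, map_sub, LinearMap.zero_apply,
    R.s_demazureCoeff, AlgEquiv.commutes, R.s_involutive, Algebra.smul_def, map_inv₀]
  generalize algebraMap F K (heckeParam p q i) = P at *
  field_simp
  ring

theorem demazure_comm (p q : F) {i j : ℕ} (h : i + 1 < j) :
    demazure p q x s i * demazure p q x s j = demazure p q x s j * demazure p q x s i := by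
  ext z
  have e1 : s i (demazureCoeff p q x j) = demazureCoeff p q x j := by
    rw [algEquiv_demazureCoeff_succ _ _ _ _ (by omega), R.of_ne _ _ (by omega) (by omega),
      R.of_ne _ _ (by omega) (by omega), demazureCoeff, if_neg (by omega)]
  have e2 : s j (demazureCoeff p q x i) = demazureCoeff p q x i := by
    rcases Nat.eq_zero_or_pos i with rfl | hi
    · rw [algEquiv_demazureCoeff_zero, R.of_ne _ _ (by omega) (by omega), demazureCoeff,
        if_pos rfl]
    · rw [algEquiv_demazureCoeff_succ _ _ _ _ hi, R.of_ne _ _ (by omega) (by omega),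
        R.of_ne _ _ (by omega) (by omega), demazureCoeff, if_neg (by omega)]
  simp only [Module.End.mul_apply, demazure_apply, map_add, map_mul, map_sub, e1, e2,
    AlgEquiv.commutes, R.s_comm h]
  ring

theorem demazure_mixed_comm (p q : F) {i j : ℕ} (h1 : j ≠ i) (h2 : j ≠ i + 1) :
    demazure p q x s i * R.mulX j = R.mulX j * demazure p q x s i := by
  ext z
  simp only [Module.End.mul_apply, demazure_apply, mulX_apply, map_mul, R.of_ne i j h1 h2]
  ring

theorem demazure_mixed (p q : F) (hq : q ≠ 0) {i : ℕ} (hi : 1 ≤ i) :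
    demazure p q x s i * R.mulX i * demazure p q x s i = R.mulX (i + 1) := by
  ext z
  have hs := R.s_demazureCoeff p q i
  have hP : heckeParam p q i = q := if_neg (by omega)
  simp only [Module.End.mul_apply, demazure_apply, mulX_apply, map_add, map_mul, map_sub,
    R.self i hi, hs, AlgEquiv.commutes, R.s_involutive, hP]
  rw [demazureCoeff, if_neg (by omega)]
  have h0 : algebraMap F K q ≠ 0 := (map_ne_zero _).2 hq
  have h3 := R.sub_ne_zero_of_ne (show i + 1 ≠ i by omega)
  generalize algebraMap F K q = Q at *
  generalize x (i + 1) = y at *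
  generalize x i = y' at *
  field_simp
  ring

theorem demazure_mixed_zero (p q : F) (hp : p ≠ 0) :
    demazure p q x s 0 * R.mulX 0 * demazure p q x s 0 = R.mulX 0 * R.mulX 1 := by
  ext z
  have hs := R.s_demazureCoeff p q 0
  have hP : heckeParam p q 0 = p := if_pos rfl
  simp only [Module.End.mul_apply, demazure_apply, mulX_apply, map_add, map_mul, map_sub,
    R.zero_zero, hs, AlgEquiv.commutes, R.s_involutive, hP]
  rw [demazureCoeff, if_pos rfl]
  have h0 : algebraMap F K p ≠ 0 := (map_ne_zero _).2 hp
  have h3 : x 1 - 1 ≠ 0 := sub_ne_zero.2 (R.ne_one 1)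
  generalize algebraMap F K p = Q at *
  generalize x 1 = y at *
  generalize x 0 = y' at *
  field_simp
  ring

end ReflectionSystem

/-! ### The braid relations for Demazure–Lusztig operators -/

namespace ReflectionSystem

variable {F K : Type*} [Field F] [Field K] [Algebra F K] {x : ℕ → K} {s : ℕ → K ≃ₐ[F] K}
  (R : ReflectionSystem x s)
include R

/-- Both sides are expanded in the six elements of the Weyl group of type `A_2`. The reflections
permute the coefficients of the three positive roots up to the sign rule `s_demazureCoeff`, and the
difference of the two sides is a multiple of the single identity `hrel` between these coefficients.
-/
theorem demazure_braid (p q : F) {i : ℕ} (hi : 1 ≤ i) :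
    demazure p q x s i * demazure p q x s (i + 1) * demazure p q x s i =
      demazure p q x s (i + 1) * demazure p q x s i * demazure p q x s (i + 1) := by
  ext z
  have hi' : 1 ≤ i + 1 := by omega
  have h1 := R.sub_ne_zero_of_ne (show i + 1 ≠ i by omega)
  have h2 := R.sub_ne_zero_of_ne (show i + 1 + 1 ≠ i by omega)
  have h3 := R.sub_ne_zero_of_ne (show i + 1 + 1 ≠ i + 1 by omega)
  have hP : heckeParam p q i = q := if_neg (by omega)
  have hP' : heckeParam p q (i + 1) = q := if_neg (by omega)
  have hs1 := R.s_demazureCoeff p q i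
  have hs2 := R.s_demazureCoeff p q (i + 1)
  have hs3 := algEquiv_demazureCoeff_succ (s (i + 1)) p q x hi
  have hs4 := algEquiv_demazureCoeff_succ (s i) p q x hi'
  rw [R.self _ hi', R.of_ne (i + 1) i (by omega) (by omega)] at hs3
  rw [R.succ _ hi, R.of_ne i (i + 1 + 1) (by omega) (by omega)] at hs4
  have hs5 : s i (s (i + 1) (demazureCoeff p q x i)) = demazureCoeff p q x (i + 1) := by
    rw [hs3, ← hs4, R.s_involutive]
  have hs6 : s (i + 1) (s i (demazureCoeff p q x (i + 1))) = demazureCoeff p q x i := by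
    rw [hs4, ← hs3, R.s_involutive]
  have hrel : demazureCoeff p q x i * demazureCoeff p q x (i + 1) =
      s i (demazureCoeff p q x (i + 1)) * (demazureCoeff p q x i + demazureCoeff p q x (i + 1) -
        (algebraMap F K q - (algebraMap F K q)⁻¹)) := by
    rw [hs4, demazureCoeff, demazureCoeff, if_neg (by omega), if_neg (by omega)]
    generalize algebraMap F K q - (algebraMap F K q)⁻¹ = c
    field_simp
    ring
  rw [← hs4] at hs3
  rw [hP] at hs1
  rw [hP'] at hs2
  rw [hs3] at hs5
  simp only [Module.End.mul_apply, demazure_apply, map_add, map_mul, map_sub, hs1, hs2, hs3, hs5,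
    hs6, AlgEquiv.commutes, R.s_involutive, hP, hP', R.s_braid hi]
  generalize demazureCoeff p q x i = b1 at *
  generalize s i (demazureCoeff p q x (i + 1)) = b3 at *
  generalize demazureCoeff p q x (i + 1) = b2 at *
  linear_combination ((b1 - b2) * z + (algebraMap F K q - b1) * s i z -
    (algebraMap F K q - b2) * s (i + 1) z) * hrel

/-- The same comparison in type `B_2`, with four positive roots. The coefficient `s 1 (b_0)` is
fixed by `s 0` and `s 0 (b_1)` by `s 1`, the roots concerned being orthogonal, and one identity
`hrel` between the four coefficients again accounts for the whole difference. -/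
theorem demazure_braid_zero (p q : F) :
    demazure p q x s 1 * demazure p q x s 0 * demazure p q x s 1 * demazure p q x s 0 =
      demazure p q x s 0 * demazure p q x s 1 * demazure p q x s 0 * demazure p q x s 1 := by
  ext z
  have a1 : s 1 (x 1) = x 2 := R.self 1 (le_refl 1)
  have a2 : s 1 (x 2) = x 1 := R.succ 1 (le_refl 1)
  have a4 := R.zero_one
  have a5 := R.of_ne 0 2 (by omega) (by omega)
  have h0 := R.ne_zero 1
  have h1 := R.sub_ne_zero_of_ne (show 2 ≠ 1 by omega)
  have h2 : x 1 - 1 ≠ 0 := sub_ne_zero.2 (R.ne_one 1)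
  have h3 : x 2 - 1 ≠ 0 := sub_ne_zero.2 (R.ne_one 2)
  have h4 : x 2 * x 1 - 1 ≠ 0 := fun h => R.ne_inv 2 1 (eq_inv_of_mul_eq_one_left (sub_eq_zero.1 h))
  have hP : heckeParam p q 0 = p := if_pos rfl
  have hP' : heckeParam p q 1 = q := if_neg (by omega)
  have hs1 := R.s_demazureCoeff p q 0
  have hs2 := R.s_demazureCoeff p q 1
  have hs3 := algEquiv_demazureCoeff_zero (s 1) p q x
  have hs4 := algEquiv_demazureCoeff_succ (s 0) p q x (le_refl 1)
  rw [a1] at hs3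
  rw [a4, a5] at hs4
  rw [hP] at hs1
  rw [hP'] at hs2
  have hs5 : s 0 (s 1 (demazureCoeff p q x 0)) = s 1 (demazureCoeff p q x 0) := by
    rw [hs3]
    simp only [map_div₀, map_mul, map_sub, map_inv₀, map_one, AlgEquiv.commutes, a5]
  have hs6 : s 1 (s 0 (demazureCoeff p q x 1)) = s 0 (demazureCoeff p q x 1) := by
    have e : s 0 (demazureCoeff p q x 1) = (algebraMap F K q - (algebraMap F K q)⁻¹) *
        (x 1 * x 2) / (x 1 * x 2 - 1) := by
      have h4' : x 1 * x 2 - 1 ≠ 0 := by rwa [mul_comm]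
      have h5 : x 2 - (x 1)⁻¹ = (x 1 * x 2 - 1) / x 1 := by field_simp
      rw [hs4, h5]
      field_simp
    rw [e]
    simp only [map_div₀, map_mul, map_sub, map_inv₀, map_one, AlgEquiv.commutes, a1, a2,
      mul_comm (x 2)]
  have hrel : demazureCoeff p q x 0 * demazureCoeff p q x 1 +
      (algebraMap F K p - (algebraMap F K p)⁻¹) * s 0 (demazureCoeff p q x 1) -
      demazureCoeff p q x 0 * s 0 (demazureCoeff p q x 1) +
      (algebraMap F K q - (algebraMap F K q)⁻¹) * s 1 (demazureCoeff p q x 0) -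
      s 1 (demazureCoeff p q x 0) * demazureCoeff p q x 1 -
      s 1 (demazureCoeff p q x 0) * s 0 (demazureCoeff p q x 1) = 0 := by
    have h5 : x 2 - (x 1)⁻¹ = (x 2 * x 1 - 1) / x 1 := by field_simp
    have h4' : x 1 * x 2 - 1 ≠ 0 := by rwa [mul_comm]
    rw [hs3, hs4, h5, demazureCoeff, demazureCoeff, if_pos rfl, if_neg (by omega)]
    generalize algebraMap F K q - (algebraMap F K q)⁻¹ = c
    generalize algebraMap F K p - (algebraMap F K p)⁻¹ = c0
    norm_num
    generalize x 1 = y1 at *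
    generalize x 2 = y2 at *
    field_simp
    ring
  clear hs3 hs4
  simp only [Module.End.mul_apply, demazure_apply, map_add, map_mul, map_sub, hs1, hs2, hs5,
    hs6, map_inv₀, AlgEquiv.commutes, R.s_involutive, hP, hP', R.s_braid_zero]
  generalize s 1 (demazureCoeff p q x 0) = d0 at *
  generalize s 0 (demazureCoeff p q x 1) = d1 at *
  generalize demazureCoeff p q x 0 = b0 at *
  generalize demazureCoeff p q x 1 = b1 at *
  linear_combination ((algebraMap F K p - b0) * (b1 - d1) * s 0 z +
    (algebraMap F K q - b1) * (d0 - b0) * s 1 z +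
    (algebraMap F K q - b1) * (algebraMap F K p - d0) * s 1 (s 0 z) -
    (algebraMap F K p - b0) * (algebraMap F K q - d1) * s 0 (s 1 z)) * hrel

/-- The Demazure–Lusztig operators satisfy the relations of the affine Hecke algebra. -/
theorem heckeFamily (p q : F) (hp : p ≠ 0) (hq : q ≠ 0) (n : ℕ) :
    HeckeFamily p q n (demazure p q x s) R.mulX where
  X_comm j k _ _ := by
    ext z
    simp only [Module.End.mul_apply, mulX_apply]
    ring
  quad_zero _ := R.demazure_quad p q hp hq 0
  quad i hi _ := by
    have h := R.demazure_quad p q hp hq i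
    rwa [heckeParam, if_neg (by omega)] at h
  braid i hi _ := R.demazure_braid p q hi
  T_comm i j h _ := R.demazure_comm p q h
  braid_zero _ := R.demazure_braid_zero p q
  mixed_zero _ := R.demazure_mixed_zero p q hp
  mixed_comm i j _ _ h1 h2 := R.demazure_mixed_comm p q h1 h2
  mixed i hi _ := R.demazure_mixed p q hq hi

end ReflectionSystem

/-! ## The defining family of the affine Hecke algebra -/

namespace Hecke

section Family

variable (F : Type u) [Field F] (p q : F) {n : ℕ}

/-- The generators `T_i`, indexed by natural numbers. -/
noncomputable def famT (n i : ℕ) : Hecke F p q n := if h : i < n then T F p q ⟨i, h⟩ else 0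

/-- The generators `X_j`, indexed by natural numbers. -/
noncomputable def famX (n j : ℕ) : (Hecke F p q n)ˣ := if h : j < n + 1 then X F p q ⟨j, h⟩ else 1

variable {F p q}

theorem famT_coe (i : Fin n) : famT F p q n (i : ℕ) = T F p q i := by
  rw [famT, dif_pos i.2]

theorem famX_coe (j : Fin (n + 1)) : famX F p q n (j : ℕ) = X F p q j := by
  rw [famX, dif_pos j.2]

theorem famT_of_lt {i : ℕ} (h : i < n) : famT F p q n i = T F p q ⟨i, h⟩ := dif_pos h

theorem famX_of_le {j : ℕ} (h : j ≤ n) : famX F p q n j = X F p q ⟨j, Nat.lt_succ_of_le h⟩ :=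
  dif_pos (Nat.lt_succ_of_le h)

variable (F p q n) in
theorem heckeFamily : HeckeFamily (A := Hecke F p q n) p q n (famT F p q n) (famX F p q n) where
  X_comm j k hj hk := by
    rw [famX_of_le hj, famX_of_le hk]; exact X_comm F p q _ _
  quad_zero h := by
    rw [famT_of_lt h]
    simpa [T] using mk_rel F p q (.quad_zero ⟨0, h⟩ rfl)
  quad i hi h := by
    rw [famT_of_lt h]
    simpa [T] using mk_rel F p q (.quad ⟨i, h⟩ hi)
  braid i hi h := by
    rw [famT_of_lt h, famT_of_lt (Nat.lt_of_succ_lt h)]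
    simpa [T] using mk_rel F p q (.braid ⟨i, Nat.lt_of_succ_lt h⟩ ⟨i + 1, h⟩ hi rfl)
  T_comm i j hij h := by
    rw [famT_of_lt h, famT_of_lt (by omega)]
    simpa [T] using mk_rel F p q (.T_comm ⟨i, by omega⟩ ⟨j, h⟩ hij)
  braid_zero h := by
    rw [famT_of_lt h, famT_of_lt (by omega)]
    simpa [T] using mk_rel F p q (.braid_zero ⟨0, by omega⟩ ⟨1, h⟩ rfl rfl)
  mixed_zero h := by
    rw [famT_of_lt h, famX_of_le (Nat.zero_le _), famX_of_le h]
    simpa [T, X] using mk_rel F p q (.mixed_zero ⟨0, h⟩ rfl)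
  mixed_comm i j hi hj h1 h2 := by
    rw [famT_of_lt hi, famX_of_le hj]
    simpa [T, X] using mk_rel F p q (.mixed_comm ⟨i, hi⟩ ⟨j, Nat.lt_succ_of_le hj⟩
      (fun h => h1 (by simpa using congrArg Fin.val h))
      (fun h => h2 (by simpa using congrArg Fin.val h)))
  mixed i hi h := by
    rw [famT_of_lt h, famX_of_le h.le, famX_of_le h]
    simpa [T, X] using mk_rel F p q (.mixed ⟨i, h⟩ hi)

theorem incl_T (i : Fin n) : incl F p q n (T F p q i) = T F p q i.castSucc := by
  rw [T, incl_mk, FreeAlgebra.lift_ι_apply]; rfl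

theorem incl_X (j : Fin (n + 1)) :
    incl F p q n (X F p q j : Hecke F p q n) = X F p q j.castSucc := by
  change incl F p q n (mk F p q n _) = _
  rw [incl_mk, FreeAlgebra.lift_ι_apply]; rfl

theorem incl_famT {i : ℕ} (h : i < n) : incl F p q n (famT F p q n i) = famT F p q (n + 1) i := by
  rw [famT_of_lt h, incl_T, ← famT_coe]; rfl

theorem incl_famX {j : ℕ} (h : j ≤ n) :
    incl F p q n (famX F p q n j : Hecke F p q n) =
      (famX F p q (n + 1) j : (Hecke F p q (n + 1))ˣ) := by
  rw [famX_of_le h, incl_X, ← famX_coe]; rfl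

/-- A property of elements closed under the algebra operations and holding for the generators. -/
theorem mem_subalgebra {A : Subalgebra F (Hecke F p q n)} (hT : ∀ i < n, famT F p q n i ∈ A)
    (hX : ∀ j ≤ n, (famX F p q n j : Hecke F p q n) ∈ A)
    (hX' : ∀ j ≤ n, ((famX F p q n j)⁻¹ : (Hecke F p q n)ˣ).val ∈ A) (h : Hecke F p q n) :
    h ∈ A := by
  obtain ⟨y, rfl⟩ := mk_surjective F p q n h
  induction y using FreeAlgebra.induction with
  | grade0 r => rw [AlgHom.commutes]; exact A.algebraMap_mem r
  | add x y hx hy => rw [map_add]; exact A.add_mem hx hy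
  | mul x y hx hy => rw [map_mul]; exact A.mul_mem hx hy
  | grade1 g =>
    cases g with
    | T i => have := hT i i.2; rwa [famT_coe] at this
    | X j => have := hX j (Nat.le_of_lt_succ j.2); rwa [famX_coe] at this
    | Xinv j => have := hX' j (Nat.le_of_lt_succ j.2); rwa [famX_coe] at this

theorem smul_mem_of_stable {V : Type*} [AddCommGroup V] [Module F V] [Module (Hecke F p q n) V]
    [IsScalarTower F (Hecke F p q n) V] {W : Submodule F V}
    (hT : ∀ i < n, ∀ u ∈ W, (famT F p q n i : Hecke F p q n) • u ∈ W)
    (hX : ∀ f ∈ latticeAlg F n (famX F p q n), ∀ u ∈ W, f • u ∈ W) (h : Hecke F p q n)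
    {u : V} (hu : u ∈ W) : h • u ∈ W := by
  let A : Subalgebra F (Hecke F p q n) :=
    { carrier := {h | ∀ u ∈ W, h • u ∈ W}
      mul_mem' := fun ha hb u hu => by rw [mul_smul]; exact ha _ (hb u hu)
      add_mem' := fun ha hb u hu => by rw [add_smul]; exact add_mem (ha u hu) (hb u hu)
      algebraMap_mem' := fun r u hu => by rw [algebraMap_smul]; exact W.smul_mem r hu }
  exact mem_subalgebra (A := A) hT (fun j hj => hX _ (X_mem_latticeAlg hj))
    (fun j hj => hX _ (X_inv_mem_latticeAlg hj)) h u hu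

theorem hom_ext {A : Type*} [Ring A] [Algebra F A] {f g : Hecke F p q n →ₐ[F] A}
    (hT : ∀ i < n, f (famT F p q n i) = g (famT F p q n i))
    (hX : ∀ j ≤ n, f (famX F p q n j : Hecke F p q n) = g (famX F p q n j : Hecke F p q n)) :
    f = g := by
  refine AlgHom.ext fun h => mem_subalgebra (A := AlgHom.equalizer f g) hT hX (fun j hj => ?_) h
  have e1 : f ((famX F p q n j)⁻¹ : (Hecke F p q n)ˣ) * f (famX F p q n j : Hecke F p q n) = 1 := by
    rw [← map_mul, Units.inv_mul, map_one]
  have e2 : f (famX F p q n j : Hecke F p q n) * g ((famX F p q n j)⁻¹ : (Hecke F p q n)ˣ) = 1 := by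
    rw [hX j hj, ← map_mul, Units.mul_inv, map_one]
  exact left_inv_eq_right_inv e1 e2

end Family

section Lift

variable {F : Type u} [Field F] {p q : F} {n : ℕ} {A : Type*} [Ring A] [Algebra F A]
  {T' : ℕ → A} {X' : ℕ → Aˣ}

/-- The images of the generators under the map determined by a family. -/
def genImage (T' : ℕ → A) (X' : ℕ → Aˣ) : HeckeGen n → A
  | .T i => T' i
  | .X j => X' j
  | .Xinv j => ((X' j)⁻¹ : Aˣ)

/-- A family satisfying the defining relations extends to an algebra map. -/
noncomputable def lift (H : HeckeFamily p q n T' X') : Hecke F p q n →ₐ[F] A :=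
  RingQuot.liftAlgHom F ⟨FreeAlgebra.lift F (genImage T' X'), by
    intro x y h
    induction h with
    | X_comm j k => simpa [genImage] using H.X_comm j k (by omega) (by omega)
    | X_Xinv j => simp [genImage]
    | Xinv_X j => simp [genImage]
    | quad_zero i hi => simpa [genImage, hi] using H.quad_zero (by omega)
    | quad i hi => simpa [genImage] using H.quad i hi i.2
    | braid i j hi hj => simpa [genImage, hj] using H.braid i hi (by omega)
    | T_comm i j h => simpa [genImage] using H.T_comm i j h j.2
    | braid_zero i j hi hj => simpa [genImage, hi, hj] using H.braid_zero (by omega)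
    | mixed_zero i hi => simpa [genImage, hi] using H.mixed_zero (by omega)
    | mixed_comm i j h1 h2 =>
      simpa [genImage] using H.mixed_comm i j i.2 (by omega)
        (fun h => h1 (Fin.ext (by simpa using h))) (fun h => h2 (Fin.ext (by simpa using h)))
    | mixed i hi => simpa [genImage] using H.mixed i hi i.2⟩

theorem lift_mk (H : HeckeFamily p q n T' X') (y : FreeAlgebra F (HeckeGen n)) :
    lift H (mk F p q n y) = FreeAlgebra.lift F (genImage T' X') y :=
  RingQuot.liftAlgHom_mkAlgHom_apply F _ _ y

theorem lift_famT (H : HeckeFamily p q n T' X') {i : ℕ} (h : i < n) :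
    lift H (famT F p q n i) = T' i := by
  rw [famT_of_lt h, T, lift_mk, FreeAlgebra.lift_ι_apply]; rfl

theorem lift_famX (H : HeckeFamily p q n T' X') {j : ℕ} (h : j ≤ n) :
    lift H (famX F p q n j : Hecke F p q n) = X' j := by
  rw [famX_of_le h]
  change lift H (mk F p q n _) = _
  rw [lift_mk, FreeAlgebra.lift_ι_apply]; rfl

end Lift

/-! ### Generation over the parabolic subalgebra by coset words -/

section Parabolic

variable (F : Type u) [Field F] (p q : F) (n : ℕ)

theorem laurentEval_T {A : Type*} [Ring A] [Algebra F A] (x : Aˣ) (k : ℤ) :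
    laurentEval (F := F) x (LaurentPolynomial.T k) = ((x ^ k : Aˣ) : A) := by
  rw [laurentEval, LaurentPolynomial.T, AddMonoidAlgebra.lift_single, one_smul]
  rfl

theorem parIncl_tmul (h : Hecke F p q n) (t : LaurentPolynomial F) :
    parIncl F p q n (h ⊗ₜ t) = incl F p q n h * laurentEval (X F p q (Fin.last (n + 1))) t :=
  Algebra.TensorProduct.lift_tmul _ _ _ _ _

theorem X_last_eq :
    (X F p q (Fin.last (n + 1)) : (Hecke F p q (n + 1))ˣ) = famX F p q (n + 1) (n + 1) := by
  rw [famX_of_le (le_refl _)]; rfl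

theorem incl_mem_range_parIncl (h : Hecke F p q n) :
    incl F p q n h ∈ (parIncl F p q n).range :=
  ⟨h ⊗ₜ 1, (parIncl_tmul F p q n h 1).trans (by rw [map_one, mul_one])⟩

theorem latticeAlg_le_range_parIncl :
    latticeAlg F (n + 1) (famX F p q (n + 1)) ≤ (parIncl F p q n).range := by
  refine Algebra.adjoin_le ?_
  have hu : ∀ j ≤ n + 1, ∀ k : ℤ, ((famX F p q (n + 1) j ^ k : (Hecke F p q (n + 1))ˣ) :
      Hecke F p q (n + 1)) ∈ (parIncl F p q n).range := by
    intro j hj k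
    rcases Nat.le_succ_iff.1 hj with h | rfl
    · have e : famX F p q (n + 1) j = Units.map (incl F p q n : Hecke F p q n →* _)
          (famX F p q n j) := Units.ext (incl_famX h).symm
      rw [e, ← map_zpow]
      exact incl_mem_range_parIncl F p q n _
    · refine ⟨1 ⊗ₜ LaurentPolynomial.T k, (parIncl_tmul F p q n _ _).trans ?_⟩
      rw [map_one, one_mul, laurentEval_T, X_last_eq]
  rintro x ⟨j, hj, rfl | rfl⟩
  · simpa using hu j hj 1
  · simpa using hu j hj (-1)

variable {F p q}

/-- The algebra is viewed as a left module over itself, with the parabolic as the stable subspace.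
The span of all coset words is then a left ideal, and it contains `1`. -/
theorem cosetSpan_range_parIncl (hp : p ≠ 0) (hq : q ≠ 0) :
    cosetSpan (famT F p q (n + 1)) n (2 * n + 2)
      (LinearMap.range (parIncl F p q n).toLinearMap) = ⊤ := by
  have H := heckeFamily F p q (n + 1)
  have hT : ∀ i, 0 ≤ i → i < n → ∀ u ∈ LinearMap.range (parIncl F p q n).toLinearMap,
      (famT F p q (n + 1) i : Hecke F p q (n + 1)) • u ∈
        LinearMap.range (parIncl F p q n).toLinearMap := by
    intro i _ hi u hu
    rw [← incl_famT hi]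
    exact (parIncl F p q n).range.mul_mem (incl_mem_range_parIncl F p q n _) hu
  have hX : ∀ f ∈ latticeAlg F (n + 1) (famX F p q (n + 1)),
      ∀ u ∈ LinearMap.range (parIncl F p q n).toLinearMap,
      f • u ∈ LinearMap.range (parIncl F p q n).toLinearMap := fun f hf u hu =>
    (parIncl F p q n).range.mul_mem (latticeAlg_le_range_parIncl F p q n hf) hu
  refine eq_top_iff.2 fun h _ => ?_
  have h1 : (1 : Hecke F p q (n + 1)) ∈ cosetSpan (famT F p q (n + 1)) n (2 * n + 2)
      (LinearMap.range (parIncl F p q n).toLinearMap) :=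
    le_cosetSpan (by omega) ⟨1, map_one (parIncl F p q n)⟩
  have := smul_mem_of_stable (n := n + 1) (fun i hi u hu => T_smul_mem_cosetSpan H hp hq
    (Nat.lt_succ_self n) hT (le_refl _) (fun _ _ => Nat.zero_le _) (Nat.zero_le _)
    (Nat.le_of_lt_succ hi) (fun t ht => by simp only [cosetLetter]; omega) hu)
    (fun f hf u hu => latticeAlg_smul_mem_cosetSpan H hp hq (Nat.lt_succ_self n) hT hX (le_refl _)
    (fun _ _ => Nat.zero_le _) hf hu) h h1
  rwa [smul_eq_mul, mul_one] at this

theorem exists_eq_sum_cosetWord_mul_parIncl (hp : p ≠ 0) (hq : q ≠ 0) (h : Hecke F p q (n + 1)) :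
    ∃ b : ℕ → Par F p q n, h = ∑ s ∈ Finset.range (2 * n + 2),
      cosetWord (famT F p q (n + 1)) n s * parIncl F p q n (b s) := by
  have hh : h ∈ cosetSpan (famT F p q (n + 1)) n (2 * n + 2)
    (LinearMap.range (parIncl F p q n).toLinearMap) := by
    rw [cosetSpan_range_parIncl n hp hq]; trivial
  obtain ⟨y, hy, e⟩ := exists_sum_of_mem_cosetSpan hh
  choose b hb using hy
  exact ⟨b, e.trans (Finset.sum_congr rfl fun s _ => by rw [← hb]; rfl)⟩

end Parabolic

end Hecke

/-! ## The basis theorem -/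

/-- The images of the last variable under the coset representatives. -/
def cosetVar {K : Type*} [Field K] (x : ℕ → K) (k l : ℕ) : K :=
  if l ≤ k then x (k + 1 - l) else (x (l - k))⁻¹

/-- Precomposition with multiplication by `z`. -/
def precompMul (F : Type*) {K : Type*} [Field F] [Field K] [Algebra F K] (z : K) :
    Module.End K (Module.End F K) where
  toFun u := u * Algebra.lmul F K z
  map_add' u v := add_mul u v _
  map_smul' _ _ := rfl

namespace ReflectionSystem

variable {F K : Type*} [Field F] [Field K] [Algebra F K] {x : ℕ → K} {s : ℕ → K ≃ₐ[F] K}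
  (R : ReflectionSystem x s)

omit [Field F] [Algebra F K] in
theorem mem_eigenspace_precompMul [Field F] [Algebra F K] {z y : K} {u : Module.End F K} :
    u ∈ (precompMul F z).eigenspace y ↔ ∀ w, u (z * w) = y * u w := by
  rw [Module.End.mem_eigenspace_iff]
  exact ⟨fun h w => DFunLike.congr_fun h w, fun h => LinearMap.ext h⟩

/-- The eigenspace of `precompMul F z` for `y` consists of the operators that carry multiplication
by `z` to multiplication by `y`. These eigenspaces serve to tell apart the leading terms of the
coset words. -/
theorem lmul_mul_mem_eigenspace {z y : K} {u : Module.End F K} (c : K)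
    (hu : u ∈ (precompMul F z).eigenspace y) :
    Algebra.lmul F K c * u ∈ (precompMul F z).eigenspace y :=
  Submodule.smul_mem _ c hu

theorem toLinearMap_mul_mem_eigenspace {z y : K} {u : Module.End F K} (t : K ≃ₐ[F] K)
    (hu : u ∈ (precompMul F z).eigenspace y) :
    (t.toLinearMap : Module.End F K) * u ∈ (precompMul F z).eigenspace (t y) := by
  rw [mem_eigenspace_precompMul] at *
  intro w
  simp only [Module.End.mul_apply, hu, AlgEquiv.toLinearMap_apply, map_mul]

theorem mul_mem_eigenspace {z y : K} {u h : Module.End F K}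
    (hu : u ∈ (precompMul F z).eigenspace y)
    (hh : h * Algebra.lmul F K z = Algebra.lmul F K z * h) :
    u * h ∈ (precompMul F z).eigenspace y := by
  rw [mem_eigenspace_precompMul] at *
  intro w
  have e : h (z * w) = z * h w := DFunLike.congr_fun hh w
  rw [Module.End.mul_apply, Module.End.mul_apply, e, hu]

include R

theorem cosetVar_ne {k l m : ℕ} (h : l < m) :
    cosetVar x k l ≠ cosetVar x k m := by
  rw [cosetVar, cosetVar]
  split_ifs with h1 h2 h2
  · exact fun e => by have := R.injective e; omega
  · exact R.ne_inv _ _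
  · omega
  · exact fun e => by have := R.injective (inv_injective e); omega

theorem s_cosetVar_self {k l : ℕ} (hl : l ≤ 2 * k) :
    s (cosetLetter k l) (cosetVar x k l) = cosetVar x k (l + 1) := by
  rcases lt_trichotomy l k with h | rfl | h
  · rw [cosetVar, cosetVar, if_pos (by omega), if_pos (by omega)]
    have e1 : cosetLetter k l = k - l := by simp only [cosetLetter]; omega
    have e2 : k + 1 - l = k - l + 1 := by omega
    rw [e1, e2, R.succ _ (by omega)]
    congr 1; omega
  · rw [cosetVar, cosetVar, if_pos (le_refl _), if_neg (by omega)]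
    have e1 : cosetLetter l l = 0 := by simp only [cosetLetter]; omega
    rw [e1, Nat.add_sub_cancel_left, R.zero_one]
  · rw [cosetVar, cosetVar, if_neg (by omega), if_neg (by omega)]
    have e1 : cosetLetter k l = l - k := by simp only [cosetLetter]; omega
    rw [e1, map_inv₀, R.self _ (by omega)]
    congr 2; omega

/-- The simple reflection that leads from coset `m` to coset `m + 1` sends the earlier cosets to
cosets of index at most `m`; hence lower terms stay lower when a word is lengthened. -/
theorem s_cosetVar_of_lt {k l m : ℕ} (hm : m ≤ 2 * k) (h : l < m) :
    ∃ l' ≤ m, s (cosetLetter k m) (cosetVar x k l) = cosetVar x k l' := by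
  by_cases hmk : m ≤ k
  · have e1 : cosetLetter k m = k - m := by simp only [cosetLetter]; omega
    refine ⟨l, h.le, ?_⟩
    rw [cosetVar, if_pos (by omega), e1, R.of_ne _ _ (by omega) (by omega)]
  have e1 : cosetLetter k m = m - k := by simp only [cosetLetter]; omega
  by_cases hlk : l ≤ k
  · by_cases h1 : k + 1 - l = m - k
    · refine ⟨2 * k - m, by omega, ?_⟩
      rw [cosetVar, cosetVar, if_pos hlk, if_pos (by omega), e1, h1, R.self _ (by omega)]
      congr 1; omega
    by_cases h2 : k + 1 - l = m - k + 1
    · refine ⟨2 * k + 1 - m, by omega, ?_⟩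
      rw [cosetVar, cosetVar, if_pos hlk, if_pos (by omega), e1, h2, R.succ _ (by omega)]
      congr 1; omega
    · refine ⟨l, h.le, ?_⟩
      rw [cosetVar, if_pos hlk, e1, R.of_ne _ _ h1 h2]
  · refine ⟨l, h.le, ?_⟩
    rw [cosetVar, if_neg hlk, e1, map_inv₀, R.of_ne _ _ (by omega) (by omega)]

/-- The coefficient of the reflection in a Demazure–Lusztig operator does not vanish. -/
theorem demazureCoeff_ne (p q : F) (hp : p ≠ 0) (hq : q ≠ 0) (hq1 : q ≠ 1) (i : ℕ) :
    algebraMap F K (heckeParam p q i) - demazureCoeff p q x i ≠ 0 := by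
  have hq1' : algebraMap F K q ≠ 1 := fun h => hq1 (by
    rw [← map_one (algebraMap F K)] at h; exact (algebraMap F K).injective h)
  have hp0 : algebraMap F K p ≠ 0 := (map_ne_zero _).2 hp
  have hq0 : algebraMap F K q ≠ 0 := (map_ne_zero _).2 hq
  rcases Nat.eq_zero_or_pos i with rfl | hi
  · intro h
    have h1 : x 1 - 1 ≠ 0 := sub_ne_zero.2 (R.ne_one 1)
    rw [heckeParam, if_pos rfl, demazureCoeff, if_pos rfl] at h
    have h2 : x 1 = algebraMap F K p ^ 2 := by
      field_simp at h
      linear_combination h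
    -- A vanishing coefficient would make `x 1` the constant `p²`, but scaling `x 1` by `q ≠ 1`
    -- fixes constants and moves `x 1`.
    obtain ⟨t, ht, -⟩ := R.exists_scale (Units.mk0 q hq) 1
    have h3 := congrArg t h2
    rw [ht, map_pow, AlgEquiv.commutes, ← h2, Units.val_mk0, Algebra.smul_def] at h3
    exact hq1' (mul_right_cancel₀ (R.ne_zero 1) (h3.trans (one_mul _).symm))
  · intro h
    have h1 := R.sub_ne_zero_of_ne (show i + 1 ≠ i by omega)
    rw [heckeParam, if_neg (by omega), demazureCoeff, if_neg (by omega)] at h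
    have h2 : x (i + 1) = algebraMap F K q ^ 2 * x i := by
      field_simp at h
      linear_combination h
    obtain ⟨t, ht, ht'⟩ := R.exists_scale (Units.mk0 q hq) (i + 1)
    have h3 := congrArg t h2
    rw [ht, map_mul, map_pow, AlgEquiv.commutes, ht' i (by omega), ← h2, Units.val_mk0,
      Algebra.smul_def] at h3
    exact hq1' (mul_right_cancel₀ (R.ne_zero (i + 1)) (h3.trans (one_mul _).symm))

variable (p q : F) (hp : p ≠ 0) (hq : q ≠ 0) (hq1 : q ≠ 1)

include hp hq hq1

/-- Coset words of Demazure–Lusztig operators are unitriangular. -/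
theorem cosetWord_demazure (k m : ℕ) (hm : m ≤ 2 * k + 1) :
    ∃ u ∈ (precompMul F (x (k + 1))).eigenspace (cosetVar x k m), Function.Injective u ∧
      cosetWord (demazure p q x s) k m - u ∈
        ⨆ l : Fin m, (precompMul F (x (k + 1))).eigenspace (cosetVar x k l) := by
  induction m with
  | zero =>
    refine ⟨1, ?_, Function.injective_id, by simp [cosetWord]⟩
    rw [mem_eigenspace_precompMul]
    intro w
    simp [cosetVar]
  | succ m ih =>
    obtain ⟨u, hu, hinj, hr⟩ := ih (by omega)
    set i := cosetLetter k m with hi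
    set A := algebraMap F K (heckeParam p q i) - demazureCoeff p q x i with hA
    have hA0 : A ≠ 0 := R.demazureCoeff_ne p q hp hq hq1 i
    have hT : demazure p q x s i = Algebra.lmul F K (demazureCoeff p q x i) +
        Algebra.lmul F K A * ((s i).toLinearMap : Module.End F K) := rfl
    have hle : ∀ l ≤ m, (precompMul F (x (k + 1))).eigenspace (cosetVar x k l) ≤
        ⨆ l : Fin (m + 1), (precompMul F (x (k + 1))).eigenspace (cosetVar x k l) := fun l hl =>
      le_iSup (fun l : Fin (m + 1) => (precompMul F (x (k + 1))).eigenspace (cosetVar x k l))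
        ⟨l, Nat.lt_succ_of_le hl⟩
    -- The leading term is the reflection part of the new letter applied to the old leading term; it
    -- is injective because `A` does not vanish.
    refine ⟨Algebra.lmul F K A * ((s i).toLinearMap * u), ?_, ?_, ?_⟩
    · rw [← R.s_cosetVar_self (by omega), ← hi]
      exact lmul_mul_mem_eigenspace _ (toLinearMap_mul_mem_eigenspace _ hu)
    · intro w w' h
      exact hinj ((s i).injective (mul_left_cancel₀ hA0 h))
    · have e : cosetWord (demazure p q x s) k (m + 1) - Algebra.lmul F K A *
          ((s i).toLinearMap * u) = Algebra.lmul F K (demazureCoeff p q x i) * u +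
          (Algebra.lmul F K (demazureCoeff p q x i) * (cosetWord (demazure p q x s) k m - u) +
            Algebra.lmul F K A * ((s i).toLinearMap * (cosetWord (demazure p q x s) k m - u))) := by
        rw [cosetWord, ← hi, hT, add_mul, mul_sub, mul_sub, mul_sub, mul_assoc]
        abel
      rw [e]
      refine add_mem (hle m (le_refl _) (lmul_mul_mem_eigenspace _ hu)) ?_
      generalize cosetWord (demazure p q x s) k m - u = r at hr
      induction hr using Submodule.iSup_induction' with
      | mem l r hr =>
        refine add_mem (hle l l.2.le (lmul_mul_mem_eigenspace _ hr)) ?_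
        obtain ⟨l', hl', e'⟩ := R.s_cosetVar_of_lt (k := k) (by omega : m ≤ 2 * k) l.2
        refine hle l' hl' (lmul_mul_mem_eigenspace _ ?_)
        rw [← e', ← hi]
        exact toLinearMap_mul_mem_eigenspace _ hr
      | zero => simp
      | add a b _ _ ha hb =>
        have := add_mem ha hb
        convert this using 1
        rw [mul_add, mul_add, mul_add]
        abel

/-- The leading terms lie in eigenspaces for distinct values, and right multiplication by an
operator commuting with `x (k + 1)` preserves these eigenspaces. So the top term of a relation must
vanish, and its leading operator is injective. -/
theorem cosetWord_demazure_independent (k m : ℕ) (hm : m ≤ 2 * k + 2) (h : ℕ → Module.End F K)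
    (hh : ∀ t, h t * Algebra.lmul F K (x (k + 1)) = Algebra.lmul F K (x (k + 1)) * h t)
    (hsum : ∑ t ∈ Finset.range m, cosetWord (demazure p q x s) k t * h t = 0) :
    ∀ t < m, h t = 0 := by
  have hmem : ∀ m (r : Module.End F K),
      r ∈ ⨆ l : Fin m, (precompMul F (x (k + 1))).eigenspace (cosetVar x k l) →
      ∀ t, r * h t ∈ ⨆ l : Fin m, (precompMul F (x (k + 1))).eigenspace (cosetVar x k l) := by
    intro m r hr t
    induction hr using Submodule.iSup_induction' with
    | mem l r hr => exact Submodule.mem_iSup_of_mem l (mul_mem_eigenspace hr (hh t))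
    | zero => simp
    | add a b _ _ ha hb => rw [add_mul]; exact add_mem ha hb
  have hmono : ∀ m m', m ≤ m' →
      ⨆ l : Fin m, (precompMul F (x (k + 1))).eigenspace (cosetVar x k l) ≤
      ⨆ l : Fin m', (precompMul F (x (k + 1))).eigenspace (cosetVar x k l) := fun m m' hmm =>
    iSup_le fun l => le_iSup (fun l : Fin m' => (precompMul F (x (k + 1))).eigenspace
      (cosetVar x k l)) ⟨l, l.2.trans_le hmm⟩
  induction m with
  | zero => intro t ht; omega
  | succ m ih =>
    obtain ⟨u, hu, hinj, hr⟩ := R.cosetWord_demazure p q hp hq hq1 k m (by omega)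
    rw [Finset.sum_range_succ] at hsum
    have hlow : ∑ t ∈ Finset.range m, cosetWord (demazure p q x s) k t * h t ∈
        ⨆ l : Fin m, (precompMul F (x (k + 1))).eigenspace (cosetVar x k l) := by
      refine Submodule.sum_mem _ fun t ht => ?_
      rw [Finset.mem_range] at ht
      obtain ⟨u', hu', -, hr'⟩ := R.cosetWord_demazure p q hp hq hq1 k t (by omega)
      have e : cosetWord (demazure p q x s) k t * h t =
          u' * h t + (cosetWord (demazure p q x s) k t - u') * h t := by
        rw [sub_mul]; abel
      rw [e]
      exact add_mem (Submodule.mem_iSup_of_mem (⟨t, ht⟩ : Fin m) (mul_mem_eigenspace hu' (hh t)))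
        (hmono t m ht.le (hmem t _ hr' t))
    have huh : u * h m ∈ ⨆ l : Fin m, (precompMul F (x (k + 1))).eigenspace (cosetVar x k l) := by
      have e : u * h m = -(∑ t ∈ Finset.range m, cosetWord (demazure p q x s) k t * h t) -
          (cosetWord (demazure p q x s) k m - u) * h m := by
        rw [eq_neg_of_add_eq_zero_left hsum, sub_mul]
        abel
      rw [e]
      exact sub_mem (neg_mem hlow) (hmem m _ hr m)
    have hdisj := (Module.End.eigenspaces_iSupIndep (precompMul F (x (k + 1)))) (cosetVar x k m)
    have hle : ⨆ l : Fin m, (precompMul F (x (k + 1))).eigenspace (cosetVar x k l) ≤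
        ⨆ y, ⨆ (_ : y ≠ cosetVar x k m), (precompMul F (x (k + 1))).eigenspace y :=
      iSup_le fun l => le_iSup₂_of_le (cosetVar x k l) (R.cosetVar_ne l.2) (le_refl _)
    have h0 : u * h m = 0 :=
      Submodule.disjoint_def.1 hdisj _ (mul_mem_eigenspace hu (hh m)) (hle huh)
    have hm0 : h m = 0 := LinearMap.ext fun w => hinj (by
      have := DFunLike.congr_fun h0 w
      simpa using this)
    rw [hm0, mul_zero, add_zero] at hsum
    intro t ht
    rcases Nat.lt_succ_iff_lt_or_eq.1 ht with h' | rfl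
    · exact ih (by omega) hsum t h'
    · exact hm0

end ReflectionSystem

/-! ## Freeness over the parabolic subalgebra -/

/-- A linear map out of `B ⊗ F[T, T⁻¹]` which sends the graded components injectively into distinct
eigenspaces of some endomorphism is injective. -/
theorem tensor_laurent_injective {F B E : Type*} [Field F] [AddCommGroup B] [Module F B]
    [AddCommGroup E] [Module F E] (Ψ : B ⊗[F] LaurentPolynomial F →ₗ[F] E) (C : Module.End F E)
    (c : ℤ → F) (hc : Function.Injective c)
    (h1 : ∀ b k, Ψ (b ⊗ₜ LaurentPolynomial.T k) ∈ C.eigenspace (c k))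
    (h2 : ∀ b k, Ψ (b ⊗ₜ LaurentPolynomial.T k) = 0 → b = 0) : Function.Injective Ψ := by
  rw [injective_iff_map_eq_zero]
  intro z hz
  let bas : Module.Basis ℤ F (LaurentPolynomial F) := AddMonoidAlgebra.basis ℤ F
  have hbas : ∀ k, bas k = LaurentPolynomial.T k := AddMonoidAlgebra.basis_apply F
  set y := TensorProduct.equivFinsuppOfBasisRight bas z with hy
  have hzy : z = y.sum fun k b => b ⊗ₜ[F] bas k := by
    rw [← TensorProduct.equivFinsuppOfBasisRight_symm_apply, hy, LinearEquiv.symm_apply_apply]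
  have hind := (C.eigenspaces_iSupIndep).comp hc
  rw [iSupIndep_iff_finsetSum_eq_zero_imp_eq_zero] at hind
  have hsum : ∑ k ∈ y.support, Ψ (y k ⊗ₜ LaurentPolynomial.T k) = 0 := by
    rw [← map_sum, ← hz, hzy, Finsupp.sum]
    simp only [hbas]
  have hy0 : y = 0 := by
    ext k
    by_cases hk : k ∈ y.support
    · exact h2 _ k (hind y.support _ (fun k _ => h1 _ k) hsum k hk)
    · exact Finsupp.notMem_support_iff.1 hk
  rw [hzy, hy0, Finsupp.sum_zero_index]

theorem map_cosetWord {A B : Type*} [Monoid A] [Monoid B] (φ : A →* B) {T : ℕ → A} {T' : ℕ → B}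
    {k : ℕ} (h : ∀ i ≤ k, φ (T i) = T' i) (s : ℕ) (hs : s ≤ 2 * k + 1) :
    φ (cosetWord T k s) = cosetWord T' k s := by
  induction s with
  | zero => exact map_one φ
  | succ s ih =>
    rw [cosetWord, cosetWord, map_mul, ih (by omega), h]
    simp only [cosetLetter]; omega

namespace ReflectionSystem

variable {F K : Type*} [Field F] [Field K] [Algebra F K] {x : ℕ → K} {s : ℕ → K ≃ₐ[F] K}
  (R : ReflectionSystem x s)

theorem mulX_zpow_apply (j : ℕ) (k : ℤ) (z : K) :
    ((R.mulX j ^ k : (Module.End F K)ˣ) : Module.End F K) z = x j ^ k * z := by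
  rw [mulX, ← map_zpow, Units.coe_map]
  change ((Units.mk0 (x j) (R.ne_zero j) ^ k : Kˣ) : K) * z = _
  rw [Units.val_zpow_eq_zpow_val, Units.val_mk0]

include R

/-- For `i + 1 < j` the reflection `s i` does not involve `x j`. Conjugation by the scaling of `x j`
will therefore fix the operators of the smaller Hecke algebra and multiply the `k`-th power of `x j`
by the `k`-th power of the factor. -/
theorem scale_comm {t : K ≃ₐ[F] K} {c : F} {j i : ℕ} (ht : t (x j) = c • x j)
    (ht' : ∀ k ≠ j, t (x k) = x k) (hi : i + 1 < j) (z : K) : t (s i z) = s i (t z) := by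
  refine R.algEquiv_ext (f := (s i).trans t) (g := t.trans (s i)) (fun k => ?_) z
  simp only [AlgEquiv.trans_apply]
  by_cases hkj : k = j
  · subst hkj
    rw [R.of_ne i _ (by omega) (by omega), ht, map_smul, R.of_ne i _ (by omega) (by omega)]
  rw [ht' k hkj]
  rcases Nat.eq_zero_or_pos i with rfl | hi0
  · by_cases h0 : k = 0
    · subst h0
      rw [R.zero_zero, map_mul, ht' 0 (by omega), ht' 1 (by omega)]
    by_cases h1 : k = 1
    · subst h1
      rw [R.zero_one, map_inv₀, ht' 1 (by omega)]
    · rw [R.of_ne _ _ h0 h1, ht' k hkj]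
  · by_cases h0 : k = i
    · subst h0
      rw [R.self _ hi0, ht' _ (by omega)]
    by_cases h1 : k = i + 1
    · subst h1
      rw [R.succ _ hi0, ht' _ (by omega)]
    · rw [R.of_ne _ _ h0 h1, ht' k hkj]

theorem scale_demazure (p q : F) {t : K ≃ₐ[F] K} {c : F} {j i : ℕ} (ht : t (x j) = c • x j)
    (ht' : ∀ k ≠ j, t (x k) = x k) (hi : i + 1 < j) (z : K) :
    t (demazure p q x s i z) = demazure p q x s i (t z) := by
  have hd : t (demazureCoeff p q x i) = demazureCoeff p q x i := by
    rw [demazureCoeff]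
    split_ifs with h
    · simp only [map_div₀, map_mul, map_sub, map_inv₀, map_one, AlgEquiv.commutes,
        ht' 1 (by omega)]
    · simp only [map_div₀, map_mul, map_sub, map_inv₀, AlgEquiv.commutes,
        ht' i (by omega), ht' (i + 1) (by omega)]
  simp only [demazure_apply, map_add, map_mul, map_sub, AlgEquiv.commutes, hd,
    R.scale_comm ht ht' hi]

end ReflectionSystem

namespace Hecke

/-! ### Faithfulness of the polynomial representation -/

section Faithful

variable {F K : Type*} [Field F] [Field K] [Algebra F K] {x : ℕ → K} {s : ℕ → K ≃ₐ[F] K}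
  (R : ReflectionSystem x s) (p q : F) (hp : p ≠ 0) (hq : q ≠ 0)

/-- The representation by Demazure–Lusztig operators. -/
noncomputable def polyRep (n : ℕ) : Hecke F p q n →ₐ[F] Module.End F K :=
  lift (R.heckeFamily p q hp hq n)

theorem polyRep_famT {n i : ℕ} (h : i < n) :
    polyRep R p q hp hq n (famT F p q n i) = demazure p q x s i := lift_famT _ h

theorem polyRep_famX {n j : ℕ} (h : j ≤ n) :
    polyRep R p q hp hq n (famX F p q n j : Hecke F p q n) = R.mulX j := lift_famX _ h

theorem polyRep_famX_zpow {n j : ℕ} (h : j ≤ n) (k : ℤ) :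
    polyRep R p q hp hq n ((famX F p q n j ^ k : (Hecke F p q n)ˣ) : Hecke F p q n) =
      ((R.mulX j ^ k : (Module.End F K)ˣ) : Module.End F K) := by
  have e : Units.map (polyRep R p q hp hq n : Hecke F p q n →* Module.End F K)
      (famX F p q n j) = R.mulX j := Units.ext (polyRep_famX R p q hp hq h)
  rw [← e, ← map_zpow]
  rfl

theorem polyRep_incl {n : ℕ} (h : Hecke F p q n) :
    polyRep R p q hp hq (n + 1) (incl F p q n h) = polyRep R p q hp hq n h := by
  have e : (polyRep R p q hp hq (n + 1)).comp (incl F p q n) = polyRep R p q hp hq n := by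
    refine hom_ext (fun i hi => ?_) (fun j hj => ?_)
    · rw [AlgHom.comp_apply, incl_famT hi, polyRep_famT _ _ _ _ _ (by omega),
        polyRep_famT _ _ _ _ _ hi]
    · rw [AlgHom.comp_apply, incl_famX hj, polyRep_famX _ _ _ _ _ (by omega),
        polyRep_famX _ _ _ _ _ hj]
  exact DFunLike.congr_fun e h

theorem polyRep_scale {n j : ℕ} {t : K ≃ₐ[F] K} {c : F} (ht : t (x j) = c • x j)
    (ht' : ∀ k ≠ j, t (x k) = x k) (hj : n < j) (h : Hecke F p q n) :
    (t.toLinearEquiv.conj) (polyRep R p q hp hq n h) = polyRep R p q hp hq n h := by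
  have e : (t.toLinearEquiv.conjAlgEquiv F : Module.End F K →ₐ[F] Module.End F K).comp
      (polyRep R p q hp hq n) = polyRep R p q hp hq n := by
    refine hom_ext (fun i hi => ?_) (fun j' hj' => ?_)
    · rw [AlgHom.comp_apply, polyRep_famT _ _ _ _ _ hi]
      ext z
      change t (demazure p q x s i (t.symm z)) = _
      rw [R.scale_demazure p q ht ht' (by omega), AlgEquiv.apply_symm_apply]
    · rw [AlgHom.comp_apply, polyRep_famX _ _ _ _ _ hj']
      ext z
      change t (x j' * t.symm z) = x j' * z
      rw [map_mul, AlgEquiv.apply_symm_apply, ht' j' (by omega)]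
  exact DFunLike.congr_fun e h

theorem zpow_injective_of_not_root {c : F} (hc0 : c ≠ 0) (hc : ∀ k : ℕ, 0 < k → c ^ k ≠ 1) :
    Function.Injective fun k : ℤ => c ^ k := by
  have key : ∀ k l : ℤ, k < l → c ^ k ≠ c ^ l := by
    intro k l h e
    obtain ⟨m, hm⟩ := Int.eq_ofNat_of_zero_le (sub_nonneg.2 h.le)
    refine hc m (by omega) ?_
    rw [← zpow_natCast, ← hm, zpow_sub₀ hc0, e, div_self (zpow_ne_zero _ hc0)]
  intro k l e
  by_contra h
  rcases lt_or_gt_of_ne h with h | h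
  · exact key k l h e
  · exact key l k h e.symm

/-- If the representation of a subalgebra is faithful and commutes with the scaling of a further
variable, then so is its extension by that variable. -/
theorem tensor_rep_injective (hq : q ≠ 0) (hqr : ∀ k : ℕ, 0 < k → q ^ k ≠ 1) {B : Type*}
    [Ring B] [Algebra F B]
    (φ : B →ₗ[F] Module.End F K) (hφ : Function.Injective φ) {t : K ≃ₐ[F] K} {j : ℕ}
    (ht : t (x j) = q • x j) (hφt : ∀ b, t.toLinearEquiv.conj (φ b) = φ b)
    (Ψ : B ⊗[F] LaurentPolynomial F →ₗ[F] Module.End F K)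
    (hΨ : ∀ b k, Ψ (b ⊗ₜ LaurentPolynomial.T k) =
      φ b * ((R.mulX j ^ k : (Module.End F K)ˣ) : Module.End F K)) : Function.Injective Ψ := by
  -- Conjugation by `t` acts on `φ b · x_j^k` by `q ^ k`, and these scalars are distinct since `q`
  -- is not a root of unity.
  refine tensor_laurent_injective Ψ (t.toLinearEquiv.conj : Module.End F K →ₗ[F] Module.End F K)
    (fun k => q ^ k) (zpow_injective_of_not_root hq hqr) (fun b k => ?_) (fun b k h => ?_)
  · rw [Module.End.mem_eigenspace_iff, hΨ]
    have e : t.toLinearEquiv.conj ((R.mulX j ^ k : (Module.End F K)ˣ) : Module.End F K) =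
        q ^ k • ((R.mulX j ^ k : (Module.End F K)ˣ) : Module.End F K) := by
      ext z
      change t (((R.mulX j ^ k : (Module.End F K)ˣ) : Module.End F K) (t.symm z)) = q ^ k •
        ((R.mulX j ^ k : (Module.End F K)ˣ) : Module.End F K) z
      rw [R.mulX_zpow_apply, R.mulX_zpow_apply, map_mul, map_zpow₀, AlgEquiv.apply_symm_apply, ht,
        Algebra.smul_def, Algebra.smul_def, mul_zpow, map_zpow₀, mul_assoc]
    rw [LinearEquiv.coe_coe, Module.End.mul_eq_comp, LinearEquiv.conj_comp, hφt, e,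
      LinearMap.comp_smul]
  · rw [hΨ, Units.mul_left_eq_zero] at h
    exact hφ (h.trans (map_zero φ).symm)

variable (hqr : ∀ k : ℕ, 0 < k → q ^ k ≠ 1)

include hqr

/-- `ℋ_0` is a quotient of the Laurent polynomials in `X_0`, so this is the separation of powers
over the ground field, `B = F`. -/
theorem polyRep_zero_injective : Function.Injective (polyRep R p q hp hq 0) := by
  have hsurj : ∀ h : Hecke F p q 0, ∃ y, laurentEval (F := F) (famX F p q 0 0) y = h := by
    intro h
    have hX : ∀ k : ℤ, ((famX F p q 0 0 ^ k : (Hecke F p q 0)ˣ) : Hecke F p q 0) ∈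
        (laurentEval (F := F) (famX F p q 0 0)).range := fun k => ⟨_, laurentEval_T F _ k⟩
    refine mem_subalgebra (A := (laurentEval (F := F) (famX F p q 0 0)).range)
      (fun i hi => by omega) (fun j hj => ?_) (fun j hj => ?_) h
    · obtain rfl : j = 0 := by omega
      simpa using hX 1
    · obtain rfl : j = 0 := by omega
      simpa using hX (-1)
  obtain ⟨t, ht, -⟩ := R.exists_scale (Units.mk0 q hq) 0
  have hinj := tensor_rep_injective R q hq hqr (B := F) (Algebra.linearMap F (Module.End F K))
    (algebraMap F (Module.End F K)).injective ht (fun r => by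
      ext z
      change t (r • t.symm z) = r • z
      rw [map_smul, AlgEquiv.apply_symm_apply])
    ((polyRep R p q hp hq 0).toLinearMap ∘ₗ (laurentEval (F := F) (famX F p q 0 0)).toLinearMap ∘ₗ
      (TensorProduct.lid F _).toLinearMap) (fun r k => by
      simp only [LinearMap.comp_apply, LinearEquiv.coe_coe, TensorProduct.lid_tmul, map_smul,
        AlgHom.toLinearMap_apply, laurentEval_T, polyRep_famX_zpow R p q hp hq (le_refl 0),
        Algebra.linearMap_apply]
      exact Algebra.smul_def _ _)
  rw [injective_iff_map_eq_zero]
  intro h h0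
  obtain ⟨y, rfl⟩ := hsurj h
  have : (1 : F) ⊗ₜ[F] y = 0 := hinj (by
    rw [map_zero]
    simpa using h0)
  have := congrArg (TensorProduct.lid F (LaurentPolynomial F)) this
  rw [TensorProduct.lid_tmul, one_smul, map_zero] at this
  rw [this, map_zero]

theorem polyRep_parIncl_injective {n : ℕ} (hn : Function.Injective (polyRep R p q hp hq n)) :
    Function.Injective fun b => polyRep R p q hp hq (n + 1) (parIncl F p q n b) := by
  obtain ⟨t, ht, ht'⟩ := R.exists_scale (Units.mk0 q hq) (n + 1)
  exact tensor_rep_injective R q hq hqr (polyRep R p q hp hq n).toLinearMap hn ht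
    (polyRep_scale R p q hp hq ht ht' (Nat.lt_succ_self n))
    ((polyRep R p q hp hq (n + 1)).comp (parIncl F p q n)).toLinearMap (fun b k => by
      rw [AlgHom.toLinearMap_apply, AlgHom.comp_apply, parIncl_tmul, map_mul, polyRep_incl,
        laurentEval_T, X_last_eq, polyRep_famX_zpow R p q hp hq (le_refl _)]
      rfl)

theorem eq_zero_of_polyRep_sum_eq_zero {n : ℕ} (hn : Function.Injective (polyRep R p q hp hq n))
    (b : ℕ → Par F p q n) (h : polyRep R p q hp hq (n + 1) (∑ s ∈ Finset.range (2 * n + 2),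
      cosetWord (famT F p q (n + 1)) n s * parIncl F p q n (b s)) = 0) :
    ∀ s < 2 * n + 2, b s = 0 := by
  intro m hm
  refine polyRep_parIncl_injective R p q hp hq hqr hn ?_
  simp only [map_zero]
  refine R.cosetWord_demazure_independent p q hp hq (fun h => hqr 1 one_pos (by rw [h, one_pow])) n
    (2 * n + 2) (le_refl _) (fun s => polyRep R p q hp hq (n + 1) (parIncl F p q n (b s)))
    (fun t => ?_) ?_ m hm
  · have h := congrArg (polyRep R p q hp hq (n + 1)) (parIncl_commute F p q (b t)).eq
    rwa [map_mul, map_mul, X_last_eq, polyRep_famX R p q hp hq (le_refl _)] at h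
  · rw [← h, map_sum]
    refine Finset.sum_congr rfl fun t ht => ?_
    rw [Finset.mem_range] at ht
    rw [map_mul]
    congr 1
    exact (map_cosetWord (polyRep R p q hp hq (n + 1) : Hecke F p q (n + 1) →* Module.End F K)
      (T := famT F p q (n + 1)) (T' := demazure p q x s) (k := n)
      (fun i hi => polyRep_famT R p q hp hq (by omega)) t (by omega)).symm

/-- Every element is a combination of coset words over the parabolic. The images of the words are
independent over the parabolic, which itself acts faithfully by the induction hypothesis and the
separation of powers. -/
theorem polyRep_injective (n : ℕ) : Function.Injective (polyRep R p q hp hq n) := by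
  induction n with
  | zero => exact polyRep_zero_injective R p q hp hq hqr
  | succ n ih =>
    rw [injective_iff_map_eq_zero]
    intro h h0
    obtain ⟨b, rfl⟩ := exists_eq_sum_cosetWord_mul_parIncl n hp hq h
    have := eq_zero_of_polyRep_sum_eq_zero R p q hp hq hqr ih b h0
    refine Finset.sum_eq_zero fun s hs => ?_
    rw [this s (Finset.mem_range.1 hs), map_zero, mul_zero]

end Faithful

variable {F : Type u} [Field F] {p q : F}

/-- The coset words are independent over the parabolic subalgebra. -/
theorem eq_zero_of_sum_cosetWord_mul_parIncl (hp : p ≠ 0) (hq : q ≠ 0)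
    (hqr : ∀ k : ℕ, 0 < k → q ^ k ≠ 1) {n : ℕ} (b : ℕ → Par F p q n)
    (h : ∑ s ∈ Finset.range (2 * n + 2),
      cosetWord (famT F p q (n + 1)) n s * parIncl F p q n (b s) = 0) :
    ∀ s < 2 * n + 2, b s = 0 :=
  eq_zero_of_polyRep_sum_eq_zero (reflectionSystem_ratField F) p q hp hq hqr
    (polyRep_injective _ p q hp hq hqr n) b (by rw [h, map_zero])

/-- The coefficient of the identity coset, a map of right modules over the parabolic. -/
theorem exists_parabolic_coefficient (hp : p ≠ 0) (hq : q ≠ 0)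
    (hqr : ∀ k : ℕ, 0 < k → q ^ k ≠ 1) (n : ℕ) :
    ∃ c : Hecke F p q (n + 1) →ₗ[F] Par F p q n,
      c 1 = 1 ∧ ∀ h b, c (h * parIncl F p q n b) = c h * b := by
  choose b hb using exists_eq_sum_cosetWord_mul_parIncl (F := F) n hp hq
  have huniq : ∀ (h : Hecke F p q (n + 1)) (b' : ℕ → Par F p q n),
      h = ∑ s ∈ Finset.range (2 * n + 2),
        cosetWord (famT F p q (n + 1)) n s * parIncl F p q n (b' s) → b h 0 = b' 0 := by
    intro h b' e
    refine sub_eq_zero.1 (eq_zero_of_sum_cosetWord_mul_parIncl hp hq hqr (fun s => b h s - b' s) ?_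
      0 (by omega))
    simp only [map_sub, mul_sub, Finset.sum_sub_distrib]
    rw [← hb h, ← e, sub_self]
  refine ⟨{ toFun := fun h => b h 0, map_add' := fun h h' => ?_, map_smul' := fun r h => ?_ },
    ?_, fun h y => ?_⟩
  · refine huniq _ (fun s => b h s + b h' s) ?_
    simp only [map_add, mul_add, Finset.sum_add_distrib]
    rw [← hb h, ← hb h']
  · refine huniq _ (fun s => r • b h s) ?_
    simp only [map_smul, mul_smul_comm, ← Finset.smul_sum]
    rw [← hb h]
  · refine huniq _ (fun s => if s = 0 then 1 else 0) ?_
    rw [Finset.sum_eq_single 0 (fun s _ hs => by rw [if_neg hs, map_zero, mul_zero])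
      (fun h => absurd (Finset.mem_range.2 (by omega)) h), if_pos rfl, map_one, mul_one, cosetWord]
  · refine huniq _ (fun s => b h s * y) ?_
    simp only [map_mul, ← mul_assoc, ← Finset.sum_mul]
    rw [← hb h]

end Hecke

/-! ## Induction -/

theorem laurentEval_smul_of_smul_eq {F A M : Type*} [Field F] [Ring A] [Algebra F A]
    [AddCommGroup M] [Module F M] [Module A M] [IsScalarTower F A M] (y : Aˣ) (a : Fˣ) {m : M}
    (h : (y : A) • m = (a : F) • m) (t : LaurentPolynomial F) :
    laurentEval (F := F) y t • m = laurentEval (F := F) a t • m := by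
  have hnat : ∀ k : ℕ, ((y ^ k : Aˣ) : A) • m = ((a ^ k : Fˣ) : F) • m := by
    intro k
    induction k with
    | zero => simp
    | succ k ih =>
      rw [pow_succ', Units.val_mul, mul_smul, ih, pow_succ, Units.val_mul, mul_smul, ← h,
        smul_comm]
  have hint : ∀ k : ℤ, ((y ^ k : Aˣ) : A) • m = ((a ^ k : Fˣ) : F) • m := by
    intro k
    obtain ⟨k, rfl | rfl⟩ := k.eq_nat_or_neg
    · rw [zpow_natCast, zpow_natCast, hnat]
    · have h1 : m = ((y ^ k : Aˣ) : A) • ((a ^ k)⁻¹ : Fˣ).val • m := by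
        rw [smul_comm, hnat, smul_smul, Units.inv_mul, one_smul]
      rw [zpow_neg, zpow_neg, zpow_natCast, zpow_natCast]
      nth_rewrite 1 [h1]
      rw [smul_smul, Units.inv_mul, one_smul]
  induction t using AddMonoidAlgebra.induction_linear with
  | zero => simp
  | add f g hf hg => rw [map_add, map_add, add_smul, add_smul, hf, hg]
  | single k r =>
    simp only [laurentEval, AddMonoidAlgebra.lift_single]
    rw [smul_assoc, smul_assoc]
    congr 1
    exact hint k

theorem evalRight_tmul {F B : Type*} [Field F] [Ring B] [Algebra F B] (a : Fˣ) (b : B)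
    (t : LaurentPolynomial F) : evalRight B a (b ⊗ₜ[F] t) = laurentEval (F := F) a t • b :=
  (Algebra.TensorProduct.lift_tmul _ _ _ _ _).trans (by
    rw [AlgHom.id_apply, AlgHom.comp_apply, Algebra.ofId_apply, ← Algebra.commutes,
      ← Algebra.smul_def])

section Induced

variable {F : Type u} [Field F] {p q : F} {n : ℕ}
  {N : Type*} [AddCommGroup N] [Module F N] [Module (Hecke F p q n) N]
  [IsScalarTower F (Hecke F p q n) N]
  {M : Type*} [AddCommGroup M] [Module F M] [Module (Hecke F p q (n + 1)) M]
  [IsScalarTower F (Hecke F p q (n + 1)) M]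
  {M' : Type*} [AddCommGroup M'] [Module F M'] [Module (Hecke F p q (n + 1)) M']
  [IsScalarTower F (Hecke F p q (n + 1)) M']

open Hecke

/-- A homomorphism of `ℋ_n`-modules from `N` to the `a`-eigenspace of `X_{n+1}` in `M`. -/
structure IsEigenHom (p q a : F) (n : ℕ) {N M : Type*} [AddCommGroup N] [Module F N]
    [Module (Hecke F p q n) N] [AddCommGroup M] [Module F M] [Module (Hecke F p q (n + 1)) M]
    (φ : N →ₗ[F] M) : Prop where
  map_smul : ∀ (h : Hecke F p q n) v, φ (h • v) = incl F p q n h • φ v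
  X_smul : ∀ v, (famX F p q (n + 1) (n + 1) : Hecke F p q (n + 1)) • φ v = a • φ v

omit [IsScalarTower F (Hecke F p q n) N] in
theorem IsEigenHom.comp {a : F} {φ : N →ₗ[F] M} (hφ : IsEigenHom p q a n φ)
    (g : M →ₗ[Hecke F p q (n + 1)] M') :
    IsEigenHom p q a n ((g.restrictScalars F).comp φ) where
  map_smul h v := by
    rw [LinearMap.comp_apply, hφ.map_smul, LinearMap.restrictScalars_apply, LinearMap.map_smul]
    rfl
  X_smul v := by
    rw [LinearMap.comp_apply, LinearMap.restrictScalars_apply, ← LinearMap.map_smul, hφ.X_smul]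
    exact (g.restrictScalars F).map_smul a _

theorem IsEigenHom.parIncl_smul {a : Fˣ} {φ : N →ₗ[F] M} (hφ : IsEigenHom p q (a : F) n φ)
    (b : Par F p q n) (v : N) :
    parIncl F p q n b • φ v = φ (evalRight (Hecke F p q n) a b • v) := by
  induction b using TensorProduct.induction_on with
  | zero => simp
  | add x y hx hy => rw [map_add, map_add, add_smul, add_smul, map_add, hx, hy]
  | tmul h t =>
    rw [parIncl_tmul, mul_smul, laurentEval_smul_of_smul_eq _ a (by rw [X_last_eq, hφ.X_smul]),
      evalRight_tmul, smul_assoc, φ.map_smul, hφ.map_smul, smul_comm]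

/-- The submodule of vectors mapped into a given submodule. -/
def IsEigenHom.comap {a : F} {φ : N →ₗ[F] M} (hφ : IsEigenHom p q a n φ)
    (W : Submodule (Hecke F p q (n + 1)) M) : Submodule (Hecke F p q n) N where
  carrier := {v | φ v ∈ W}
  zero_mem' := by simp
  add_mem' hv hw := by simpa using add_mem hv hw
  smul_mem' h v hv := by
    change φ (h • v) ∈ W
    rw [hφ.map_smul]
    exact W.smul_mem _ hv

omit [IsScalarTower F (Hecke F p q n) N] [IsScalarTower F (Hecke F p q (n + 1)) M] in
theorem IsEigenHom.mem_comap {a : F} {φ : N →ₗ[F] M} (hφ : IsEigenHom p q a n φ)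
    {W : Submodule (Hecke F p q (n + 1)) M} {v : N} : v ∈ hφ.comap W ↔ φ v ∈ W := Iff.rfl

/-- A module generated by the image of a finite-dimensional one is finite-dimensional. -/
theorem IsEigenHom.finiteDimensional (hp : p ≠ 0) (hq : q ≠ 0) {a : Fˣ} {φ : N →ₗ[F] M}
    (hφ : IsEigenHom p q (a : F) n φ) [FiniteDimensional F N]
    (hgen : ∀ W : Submodule (Hecke F p q (n + 1)) M, (∀ v, φ v ∈ W) → W = ⊤) :
    FiniteDimensional F M := by
  have H := heckeFamily F p q (n + 1)
  have hT : ∀ i, 0 ≤ i → i < n → ∀ u ∈ LinearMap.range φ,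
      (famT F p q (n + 1) i : Hecke F p q (n + 1)) • u ∈ LinearMap.range φ := by
    rintro i _ hi _ ⟨v, rfl⟩
    rw [← incl_famT hi, ← hφ.map_smul]
    exact ⟨_, rfl⟩
  have hX : ∀ f ∈ latticeAlg F (n + 1) (famX F p q (n + 1)),
      ∀ u ∈ LinearMap.range φ, f • u ∈ LinearMap.range φ := by
    rintro f hf _ ⟨v, rfl⟩
    obtain ⟨b, rfl⟩ := latticeAlg_le_range_parIncl F p q n hf
    exact ⟨_, (hφ.parIncl_smul b v).symm⟩
  let W : Submodule (Hecke F p q (n + 1)) M :=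
    { cosetSpan (famT F p q (n + 1)) n (2 * n + 2) (LinearMap.range φ) with
      smul_mem' := fun h u hu =>
        smul_mem_of_stable (n := n + 1) (fun i hi u hu => T_smul_mem_cosetSpan H hp hq
          (Nat.lt_succ_self n) hT (le_refl _) (fun _ _ => Nat.zero_le _) (Nat.zero_le _)
          (Nat.le_of_lt_succ hi) (fun t ht => by simp only [cosetLetter]; omega) hu)
          (fun f hf u hu => latticeAlg_smul_mem_cosetSpan H hp hq (Nat.lt_succ_self n) hT hX
          (le_refl _) (fun _ _ => Nat.zero_le _) hf hu) h hu }
  have hW : W = ⊤ := hgen W fun v => le_cosetSpan (by omega) ⟨v, rfl⟩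
  have htop : cosetSpan (famT F p q (n + 1)) n (2 * n + 2) (LinearMap.range φ) = ⊤ := by
    refine eq_top_iff.2 fun m _ => ?_
    have : m ∈ W := by rw [hW]; trivial
    exact this
  have hfin : FiniteDimensional F
      (cosetSpan (famT F p q (n + 1)) n (2 * n + 2) (LinearMap.range φ)) :=
    Submodule.finite_iSup _
  rw [htop] at hfin
  exact Module.finite_def.2 ((Submodule.fg_top _).1 Module.Finite.fg_top)

variable (a : Fˣ)

/-- The canonical map `N → f_a N`. -/
noncomputable def toInd (p q : F) (n : ℕ) (N : Type*) [AddCommGroup N] [Module F N]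
    [Module (Hecke F p q n) N] : N →ₗ[F] fFun p q n a N :=
  ((Submodule.mkQ _).restrictScalars F) ∘ₗ
    (TensorProduct.mk F (Hecke F p q (n + 1)) (OuterChar (Hecke F p q n) a N) 1)

omit [IsScalarTower F (Hecke F p q n) N] in
theorem parIncl_smul_toInd (b : Par F p q n) (v : N) :
    parIncl F p q n b • toInd a p q n N v =
      toInd a p q n N (evalRight (Hecke F p q n) a b • v) := by
  refine (Submodule.Quotient.eq _).2 (Submodule.subset_span ⟨b, v, ?_⟩)
  exact congrArg₂ (· - ·) ((TensorProduct.smul_tmul' _ _ _).trans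
    (by rw [smul_eq_mul, mul_one])) rfl

theorem isEigenHom_toInd : IsEigenHom p q (a : F) n (toInd a p q n N) where
  map_smul h v := by
    have := parIncl_smul_toInd a (h ⊗ₜ[F] (1 : LaurentPolynomial F)) v
    rw [parIncl_tmul, map_one, mul_one, evalRight_tmul, map_one, one_smul] at this
    exact this.symm
  X_smul v := by
    have := parIncl_smul_toInd a ((1 : Hecke F p q n) ⊗ₜ[F] (LaurentPolynomial.T 1)) v
    rw [parIncl_tmul, map_one, one_mul, evalRight_tmul, laurentEval_T, X_last_eq, laurentEval_T,
      zpow_one, zpow_one, smul_assoc, one_smul, map_smul] at this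
    exact this

omit [IsScalarTower F (Hecke F p q n) N] in
theorem toInd_generates (W : Submodule (Hecke F p q (n + 1)) (fFun p q n a N))
    (h : ∀ v : N, toInd a p q n N v ∈ W) : W = ⊤ := by
  refine eq_top_iff.2 fun z _ => ?_
  obtain ⟨y, rfl⟩ := Submodule.mkQ_surjective _ z
  induction y using TensorProduct.induction_on with
  | zero => rw [map_zero]; exact zero_mem _
  | add x y hx hy => rw [map_add]; exact add_mem (hx trivial) (hy trivial)
  | tmul k v =>
    have := W.smul_mem k (h v)
    convert this using 1
    change _ = k • Submodule.mkQ _ (1 ⊗ₜ v)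
    rw [← map_smul, TensorProduct.smul_tmul', smul_eq_mul, mul_one]

/-- The coefficient of the identity coset gives a linear retraction `h ⊗ v ↦ c(h) v` onto `N`. It
kills the defining relations because `c` is linear over the parabolic on the right. -/
theorem toInd_injective (hp : p ≠ 0) (hq : q ≠ 0) (hqr : ∀ k : ℕ, 0 < k → q ^ k ≠ 1) :
    Function.Injective (toInd a p q n N) := by
  obtain ⟨c, hc1, hc⟩ := exists_parabolic_coefficient hp hq hqr n
  let ψ : Hecke F p q (n + 1) ⊗[F] OuterChar (Hecke F p q n) a N →ₗ[F]
      OuterChar (Hecke F p q n) a N :=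
    TensorProduct.lift ((Algebra.lsmul F F (OuterChar (Hecke F p q n) a N)).toLinearMap ∘ₗ c)
  have hψ : ∀ h v, ψ (h ⊗ₜ v) = c h • v := fun h v => rfl
  -- The retraction is not linear over the big algebra, so the claim for the generated submodule is
  -- proved for all left translates at once.
  have hz : ∀ z ∈ Submodule.span (Hecke F p q (n + 1))
      {z : Hecke F p q (n + 1) ⊗[F] OuterChar (Hecke F p q n) a N |
        ∃ (b : Par F p q n) (v : OuterChar (Hecke F p q n) a N),
          z = parIncl F p q n b ⊗ₜ[F] v - (1 : Hecke F p q (n + 1)) ⊗ₜ[F] (b • v)},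
      ∀ h : Hecke F p q (n + 1), ψ (h • z) = 0 := by
    intro z hz
    induction hz using Submodule.span_induction with
    | mem z hz =>
      obtain ⟨b, v, rfl⟩ := hz
      intro h
      rw [smul_sub, TensorProduct.smul_tmul', TensorProduct.smul_tmul', map_sub, hψ, hψ,
        smul_eq_mul, smul_eq_mul, mul_one, hc, mul_smul, sub_self]
    | zero => simp
    | add x y _ _ hx hy => intro h; rw [smul_add, map_add, hx, hy, add_zero]
    | smul k x _ hx => intro h; rw [smul_smul, hx]
  rw [injective_iff_map_eq_zero]
  intro v hv
  have h1 : c 1 • (show OuterChar (Hecke F p q n) a N from v) = 0 := by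
    rw [← hψ]
    have := hz _ ((Submodule.Quotient.mk_eq_zero _).1 hv) 1
    rwa [one_smul] at this
  rwa [hc1, one_smul] at h1

/-- Frobenius reciprocity. -/
theorem IsEigenHom.exists_lift {a : Fˣ} {φ : N →ₗ[F] M} (hφ : IsEigenHom p q (a : F) n φ) :
    ∃ g : fFun p q n a N →ₗ[Hecke F p q (n + 1)] M, ∀ v, g (toInd a p q n N v) = φ v := by
  let φ' : OuterChar (Hecke F p q n) a N →ₗ[F] M := φ
  let g₀ : Hecke F p q (n + 1) ⊗[F] OuterChar (Hecke F p q n) a N →ₗ[Hecke F p q (n + 1)] M :=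
    TensorProduct.AlgebraTensorModule.lift
      (LinearMap.toSpanSingleton (Hecke F p q (n + 1)) _ φ')
  have hg₀ : ∀ h v, g₀ (h ⊗ₜ v) = h • φ' v := fun h v => rfl
  refine ⟨Submodule.liftQ _ g₀ (Submodule.span_le.2 ?_), fun v => ?_⟩
  · rintro _ ⟨b, v, rfl⟩
    change g₀ _ = 0
    rw [map_sub, hg₀, hg₀, one_smul, sub_eq_zero]
    exact hφ.parIncl_smul b v
  · exact (hg₀ 1 v).trans (one_smul _ _)

end Induced

/-! ## The number `ε_a` -/

section Tail

open Hecke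

variable {F : Type u} [Field F] {p q : F}

/-- The simultaneous `a`-eigenspace of `X_{r+1}, …, X_n`. -/
def tailEigenspace (p q : F) (n : ℕ) (a : F) (M : Type*) [AddCommGroup M] [Module F M]
    [Module (Hecke F p q n) M] [IsScalarTower F (Hecke F p q n) M] (r : ℕ) : Submodule F M where
  carrier := {v | ∀ l, r < l → l ≤ n → (famX F p q n l : Hecke F p q n) • v = a • v}
  zero_mem' := by simp
  add_mem' hv hw := fun l h h' => by rw [smul_add, smul_add, hv l h h', hw l h h']
  smul_mem' c v hv := fun l h h' => by rw [smul_comm, hv l h h', smul_comm]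

variable {n : ℕ} {a : Fˣ} {M : Type*} [AddCommGroup M] [Module F M] [Module (Hecke F p q n) M]
  [IsScalarTower F (Hecke F p q n) M]

omit [Module F M] [IsScalarTower F (Hecke F p q n) M] in
theorem famX_smul_comm {j l : ℕ} (hj : j ≤ n) (hl : l ≤ n) (v : M) :
    (famX F p q n j : Hecke F p q n) • (famX F p q n l : Hecke F p q n) • v =
      (famX F p q n l : Hecke F p q n) • (famX F p q n j : Hecke F p q n) • v := by
  rw [smul_smul, (heckeFamily F p q n).X_comm j l hj hl, mul_smul]

theorem mem_maxGenEigenspace_of_smul_eq {x : Hecke F p q n} {b : F} {v : M} (h : x • v = b • v) :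
    v ∈ Module.End.maxGenEigenspace (Algebra.lsmul F F M x) b :=
  Module.End.genEigenspace_le_maximal _ _ 1 (Module.End.mem_eigenspace_iff.2 h)

/-- The lattice operators commute. So a nonzero joint generalized eigenvector can be improved to an
honest one, treating one operator at a time by taking the last nonzero power of `X_j - a` on it.
This makes `ε_a` accessible through true eigenvectors. -/
theorem deltaPow_ne_bot_iff {m : ℕ} (hm : m ≤ n) :
    deltaPow p q n a M m ≠ ⊥ ↔ tailEigenspace p q n (a : F) M (n - m) ≠ ⊥ := by
  constructor
  · intro h
    -- The vector stays in the generalized eigenspace throughout, while honest eigenvector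
    -- conditions are added for `X_n, X_{n-1}, …`.
    have key : ∀ k ≤ m, deltaPow p q n a M m ⊓ tailEigenspace p q n (a : F) M (n - k) ≠ ⊥ := by
      intro k
      induction k with
      | zero =>
        intro _
        have : tailEigenspace p q n (a : F) M (n - 0) = ⊤ :=
          eq_top_iff.2 fun v _ => fun l h1 h2 => by omega
        rwa [this, inf_top_eq]
      | succ k ih =>
        intro hk
        obtain ⟨v, ⟨hv, hv'⟩, hv0⟩ := Submodule.exists_mem_ne_zero_of_ne_bot (ih (by omega))
        set j := n - k with hj
        set g : Module.End F M := Algebra.lsmul F F M (famX F p q n j : Hecke F p q n) -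
          algebraMap F _ (a : F) with hg
        have hgv : ∀ w, g w = (famX F p q n j : Hecke F p q n) • w - (a : F) • w := fun w => rfl
        have hst : ∀ w ∈ deltaPow p q n a M m ⊓ tailEigenspace p q n (a : F) M j,
            g w ∈ deltaPow p q n a M m ⊓ tailEigenspace p q n (a : F) M j := by
          rintro w ⟨hw, hw'⟩
          rw [hgv]
          refine sub_mem ⟨?_, fun l h1 h2 => ?_⟩ (Submodule.smul_mem _ _ ⟨hw, hw'⟩)
          · rw [SetLike.mem_coe, deltaPow, Submodule.mem_iInf] at *
            intro i
            have := hw i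
            rw [Submodule.mem_iInf] at *
            intro hi
            refine Module.End.mapsTo_maxGenEigenspace_of_comm
              (g := Algebra.lsmul F F M (famX F p q n j : Hecke F p q n)) ?_ _ (this hi)
            refine LinearMap.ext fun w => ?_
            rw [← famX_coe]
            exact famX_smul_comm (by omega) (by omega) w
          · rw [famX_smul_comm h2 (by omega), hw' l h1 h2, smul_comm]
        have hnil : ∃ N, (g ^ N) v = 0 := by
          rw [deltaPow, SetLike.mem_coe, Submodule.mem_iInf] at hv
          have := hv ⟨j, by omega⟩
          rw [Submodule.mem_iInf] at this
          have := this (show n < j + m by omega)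
          rw [Module.End.mem_maxGenEigenspace, ← famX_of_le (by omega : j ≤ n)] at this
          obtain ⟨N, hN⟩ := this
          exact ⟨N, hN⟩
        classical
        have hN := Nat.find_spec hnil
        have hN0 : Nat.find hnil ≠ 0 := fun h => hv0 (by rw [h] at hN; simpa using hN)
        obtain ⟨N, hNe⟩ := Nat.exists_eq_succ_of_ne_zero hN0
        have hmin : (g ^ N) v ≠ 0 := Nat.find_min hnil (by omega)
        have hpow : ∀ i, (g ^ i) v ∈
            deltaPow p q n a M m ⊓ tailEigenspace p q n (a : F) M j := by
          intro i
          induction i with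
          | zero => exact ⟨hv, hv'⟩
          | succ i ih => rw [pow_succ', Module.End.mul_apply]; exact hst _ ih
        refine (Submodule.ne_bot_iff _).2 ⟨(g ^ N) v, ⟨(hpow N).1, fun l h1 h2 => ?_⟩, hmin⟩
        by_cases hl : l = j
        · subst hl
          rw [hNe, pow_succ', Module.End.mul_apply, hgv] at hN
          exact sub_eq_zero.1 hN
        · exact (hpow N).2 l (by omega) h2
    exact fun h0 => key m (le_refl _) (by rw [h0, inf_bot_eq])
  · intro h h0
    refine h (eq_bot_iff.2 ?_)
    rw [← h0, deltaPow]
    refine fun v hv => Submodule.mem_iInf _ |>.2 fun i => Submodule.mem_iInf _ |>.2 fun hi => ?_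
    refine mem_maxGenEigenspace_of_smul_eq ?_
    rw [← famX_coe]
    exact hv i (by omega) (by omega)

theorem epsilon_le : epsilon p q n a M ≤ n := by
  rw [epsilon]
  rcases Set.eq_empty_or_nonempty {m : ℕ | m ≤ n ∧ deltaPow p q n a M m ≠ ⊥} with h | h
  · rw [h, csSup_empty]; exact Nat.zero_le _
  · exact csSup_le h fun m hm => hm.1

theorem le_epsilon {m : ℕ} (hm : m ≤ n) (h : tailEigenspace p q n (a : F) M (n - m) ≠ ⊥) :
    m ≤ epsilon p q n a M :=
  le_csSup ⟨n, fun _ h => h.1⟩ ⟨hm, (deltaPow_ne_bot_iff hm).2 h⟩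

theorem tailEigenspace_epsilon_ne_bot [Nontrivial M] :
    tailEigenspace p q n (a : F) M (n - epsilon p q n a M) ≠ ⊥ := by
  have h0 : (0 : ℕ) ∈ {m : ℕ | m ≤ n ∧ deltaPow p q n a M m ≠ ⊥} := by
    refine ⟨Nat.zero_le _, (deltaPow_ne_bot_iff (Nat.zero_le _)).2 ?_⟩
    have : tailEigenspace p q n (a : F) M (n - 0) = ⊤ :=
      eq_top_iff.2 fun v _ => fun l h1 h2 => by omega
    rw [this]
    exact top_ne_bot
  have := Nat.sSup_mem (s := {m : ℕ | m ≤ n ∧ deltaPow p q n a M m ≠ ⊥}) ⟨0, h0⟩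
    ⟨n, fun _ h => h.1⟩
  exact (deltaPow_ne_bot_iff this.1).1 this.2

theorem epsilon_eq_of_forall {m : ℕ} (hm : m ≤ n)
    (h : tailEigenspace p q n (a : F) M (n - m) ≠ ⊥)
    (h' : ∀ k, m < k → k ≤ n → tailEigenspace p q n (a : F) M (n - k) = ⊥) :
    epsilon p q n a M = m := by
  refine le_antisymm (not_lt.1 fun hlt => ?_) (le_epsilon hm h)
  have hnt : Nontrivial M := by
    obtain ⟨v, -, hv⟩ := Submodule.exists_mem_ne_zero_of_ne_bot h
    exact ⟨v, 0, hv⟩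
  exact tailEigenspace_epsilon_ne_bot (h' _ hlt epsilon_le)

theorem eq_zero_of_epsilon_lt {r : ℕ} (hr : r < n - epsilon p q n a M) {v : M}
    (hv : v ∈ tailEigenspace p q n (a : F) M r) : v = 0 := by
  by_contra h
  have := le_epsilon (p := p) (q := q) (a := a) (M := M) (n := n) (m := n - r) (by omega)
    ((Submodule.ne_bot_iff _).2 ⟨v, by rwa [show n - (n - r) = r by omega], h⟩)
  omega

end Tail

/-! ## The shuffle lemma for modules -/

section Shuffle

open Hecke

variable {F : Type u} [Field F] {p q : F} {n : ℕ} {a : Fˣ}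
  {N : Type*} [AddCommGroup N] [Module F N] [Module (Hecke F p q n) N]
  [IsScalarTower F (Hecke F p q n) N]
  {M : Type*} [AddCommGroup M] [Module F M] [Module (Hecke F p q (n + 1)) M]
  [IsScalarTower F (Hecke F p q (n + 1)) M]

theorem tailEigenspace_map {φ : N →ₗ[F] M} (hφ : IsEigenHom p q (a : F) n φ) {r : ℕ} {u : N}
    (hu : u ∈ tailEigenspace p q n (a : F) N r) :
    φ u ∈ tailEigenspace p q (n + 1) (a : F) M r := by
  intro l h1 h2
  rcases Nat.le_succ_iff.1 h2 with h | rfl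
  · rw [← incl_famX h, ← hφ.map_smul, hu l h1 h, map_smul]
  · exact hφ.X_smul u

theorem mem_tailEigenspace_of_map {φ : N →ₗ[F] M} (hφ : IsEigenHom p q (a : F) n φ)
    (hinj : Function.Injective φ) {r : ℕ} {u : N}
    (hu : φ u ∈ tailEigenspace p q (n + 1) (a : F) M r) : u ∈ tailEigenspace p q n (a : F) N r := by
  intro l h1 h2
  have := hu l h1 (by omega)
  rw [← incl_famX h2, ← hφ.map_smul, ← map_smul] at this
  exact hinj this

theorem smul_mem_tailEigenspace {r : ℕ} {h : Hecke F p q n}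
    (hc : ∀ l, r < l → l ≤ n → (famX F p q n l : Hecke F p q n) * h = h * famX F p q n l) {u : N}
    (hu : u ∈ tailEigenspace p q n (a : F) N r) : h • u ∈ tailEigenspace p q n (a : F) N r := by
  intro l h1 h2
  rw [smul_smul, hc l h1 h2, mul_smul, hu l h1 h2, smul_comm]

variable [IsAlgClosed F] [FiniteDimensional F M]
  [IsSimpleModule (Hecke F p q n) N] {φ : N →ₗ[F] M}
  (hp : p ≠ 0) (hq : q ≠ 0) (hc : q - q⁻¹ ≠ 0) (ha : (a : F)⁻¹ ≠ a)
  (hφ : IsEigenHom p q (a : F) n φ) (hinj : Function.Injective φ)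
  (hgen : ∀ W : Submodule (Hecke F p q (n + 1)) M, (∀ v, φ v ∈ W) → W = ⊤)

include hp hq hc ha hφ hinj hgen

/-- The simultaneous eigenvectors for the longest possible tail come from `N`. -/
theorem IsEigenHom.exists_of_mem_tailEigenspace {v : M}
    (hv : v ∈ tailEigenspace p q (n + 1) (a : F) M (n - epsilon p q n a N)) :
    ∃ u ∈ tailEigenspace p q n (a : F) N (n - epsilon p q n a N), φ u = v := by
  set r := n - epsilon p q n a N with hr
  have hnt : Nontrivial N := IsSimpleModule.nontrivial (Hecke F p q n) N
  have H := heckeFamily F p q (n + 1)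
  have Hn := heckeFamily F p q n
  refine mem_of_forall_X_smul_eq (S := (tailEigenspace p q n (a : F) N r).map φ) (r := r)
    (n := n + 1) H hp hq ?_ ?_ a.ne_zero ha hc (by omega) ?_ ?_ ?_ hv
  · rintro f hf _ ⟨u, hu, rfl⟩
    have hfu : f • φ u ∈ tailEigenspace p q (n + 1) (a : F) M r :=
      smul_mem_tailEigenspace (fun l h1 h2 =>
        latticeAlg_commute H.X_comm (X_mem_latticeAlg h2) hf) (tailEigenspace_map hφ hu)
    obtain ⟨b, rfl⟩ := latticeAlg_le_range_parIncl F p q n hf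
    refine ⟨_, mem_tailEigenspace_of_map hφ hinj ?_, (hφ.parIncl_smul b u).symm⟩
    rw [← hφ.parIncl_smul]
    exact hfu
  · rintro l h1 h2 _ ⟨u, hu, rfl⟩
    exact tailEigenspace_map hφ hu l h1 h2
  · rintro i hi _ ⟨u, hu, rfl⟩
    refine ⟨famT F p q n i • u, smul_mem_tailEigenspace (fun l h1 h2 => ?_) hu, ?_⟩
    · exact (Hn.mixed_comm i l (by omega) h2 (by omega) (by omega)).symm
    · rw [hφ.map_smul, incl_famT (by omega)]
  · rintro h1 _ ⟨u, hu, rfl⟩ h2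
    -- An `a`-eigenvector of `X_r` in `S` would come from a longer tail in `N`, against the
    -- maximality of `ε_a(N)`.
    have : u = 0 := by
      refine eq_zero_of_epsilon_lt (p := p) (q := q) (a := a) (n := n) (r := r - 1) (by omega) ?_
      refine mem_tailEigenspace_of_map hφ hinj fun l h3 h4 => ?_
      by_cases hl : l = r
      · rw [hl]; exact h2
      · exact tailEigenspace_map hφ hu l (by omega) h4
    rw [this, map_zero]
  · intro W hSW hT hX
    let W' : Submodule (Hecke F p q (n + 1)) M :=
      { W with smul_mem' := fun h u hu => smul_mem_of_stable (n := n + 1) hT hX h hu }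
    -- A stable subspace containing `S` meets `N` in a nonzero submodule, hence contains `N` by
    -- irreducibility and is everything.
    have hne : hφ.comap W' ≠ ⊥ := by
      obtain ⟨u, hu, hu0⟩ := Submodule.exists_mem_ne_zero_of_ne_bot
        (tailEigenspace_epsilon_ne_bot (p := p) (q := q) (n := n) (a := a) (M := N))
      exact (Submodule.ne_bot_iff _).2 ⟨u, hSW ⟨u, hu, rfl⟩, hu0⟩
    have htop := (eq_bot_or_eq_top (hφ.comap W')).resolve_left hne
    have hW' : W' = ⊤ := hgen W' fun v => by
      rw [← hφ.mem_comap, htop]; trivial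
    refine eq_top_iff.2 fun m _ => ?_
    have : m ∈ W' := by rw [hW']; trivial
    exact this

/-- The image of `S` has a tail longer by one. A still longer tail in `M` would, by the shuffle
lemma, already come from `N` and exceed `ε_a(N)` there. -/
theorem IsEigenHom.epsilon_eq : epsilon p q (n + 1) a M = epsilon p q n a N + 1 := by
  have hnt : Nontrivial N := IsSimpleModule.nontrivial (Hecke F p q n) N
  have hle : epsilon p q n a N ≤ n := epsilon_le
  refine epsilon_eq_of_forall (by omega) ?_ fun k h1 h2 => ?_
  · obtain ⟨u, hu, hu0⟩ := Submodule.exists_mem_ne_zero_of_ne_bot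
      (tailEigenspace_epsilon_ne_bot (p := p) (q := q) (n := n) (a := a) (M := N))
    refine (Submodule.ne_bot_iff _).2 ⟨φ u, ?_, fun h => hu0 (hinj (h.trans (map_zero φ).symm))⟩
    rw [Nat.add_sub_add_right]
    exact tailEigenspace_map hφ hu
  · refine eq_bot_iff.2 fun v hv => ?_
    obtain ⟨u, hu, rfl⟩ := hφ.exists_of_mem_tailEigenspace hp hq hc ha hinj hgen
      (v := v) fun l h3 h4 => hv l (by omega) h4
    have : u = 0 := eq_zero_of_epsilon_lt (p := p) (q := q) (a := a) (n := n) (r := n + 1 - k)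
      (by omega) (mem_tailEigenspace_of_map hφ hinj hv)
    rw [this, map_zero]
    exact zero_mem _

end Shuffle

/-! ## A central element -/

section Central

variable {F A : Type*} [Field F] [Ring A] [Algebra F A] {p q : F} {n : ℕ} {T : ℕ → A}
  {X : ℕ → Aˣ}

/-- The sum of the Weyl group orbit of the first coordinate of the lattice. -/
def orbitSum (n : ℕ) (X : ℕ → Aˣ) : A :=
  ∑ j ∈ Finset.range n, ((X (j + 1) : A) + ((X (j + 1))⁻¹ : Aˣ))

/-- Only the summands moved by the reflection matter: one pair `X_1, X_1⁻¹` for `T_0`, two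
neighbouring pairs otherwise. There the correction terms of the Bernstein relations cancel. -/
theorem HeckeFamily.orbitSum_comm_T (H : HeckeFamily p q n T X) (hp : p ≠ 0) (hq : q ≠ 0) {i : ℕ}
    (hi : i < n) : orbitSum n X * T i = T i * orbitSum n X := by
  let D : ℕ → A := fun j => ((X (j + 1) : A) + ((X (j + 1))⁻¹ : Aˣ)) * T i -
    T i * ((X (j + 1) : A) + ((X (j + 1))⁻¹ : Aˣ))
  have hD : ∀ j < n, j + 1 ≠ i → j ≠ i → D j = 0 := by
    intro j hj h1 h2
    have h3 : Commute (X (j + 1) : A) (T i) := H.X_mul_T_of_ne hi (by omega) h1 (by omega)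
    exact sub_eq_zero.2 ((h3.add_left h3.units_inv_left).eq)
  suffices h : ∑ j ∈ Finset.range n, D j = 0 by
    rw [Finset.sum_sub_distrib, ← Finset.sum_mul, ← Finset.mul_sum] at h
    exact sub_eq_zero.1 h
  rcases Nat.eq_zero_or_pos i with rfl | h0
  · rw [Finset.sum_eq_single_of_mem 0 (Finset.mem_range.2 hi) fun j hj h =>
      hD j (Finset.mem_range.1 hj) (by omega) h]
    have h1 := H.X_one_mul_T_zero hp hq hi
    have h2 := Units.inv_mul_of_mul_eq h1
    have h3 : (((X 1)⁻¹ : Aˣ) : A) * heckeCoeff p q 0 • (1 + X 1 : A) * ((X 1)⁻¹⁻¹ : Aˣ) =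
        heckeCoeff p q 0 • (1 + X 1 : A) := by
      rw [mul_smul_comm, smul_mul_assoc, inv_inv, mul_add, mul_one, Units.inv_mul, add_mul,
        Units.inv_mul, one_mul]
    rw [h3, inv_inv] at h2
    simp only [D, zero_add, add_mul, h1, h2, mul_add]
    abel
  · obtain ⟨k, rfl⟩ := Nat.exists_eq_add_of_le' h0
    rw [← Finset.sum_subset (s₁ := {k, k + 1}) (fun j hj => by
      simp only [Finset.mem_insert, Finset.mem_singleton] at hj
      exact Finset.mem_range.2 (by omega)) fun j hj h => by
        simp only [Finset.mem_insert, Finset.mem_singleton, not_or] at h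
        exact hD j (Finset.mem_range.1 hj) (by omega) (by omega),
      Finset.sum_pair (by omega)]
    have h1 := H.X_succ_mul_T hp hq h0 hi
    have h2 := H.X_mul_T hp hq h0 hi
    have h3 := Units.inv_mul_of_mul_eq h1
    rw [sub_eq_add_neg] at h2
    have h4 := Units.inv_mul_of_mul_eq h2
    rw [mul_smul_comm, smul_mul_assoc, Units.inv_mul, one_mul] at h3
    rw [mul_neg, neg_mul, sub_neg_eq_add, mul_smul_comm, smul_mul_assoc, mul_assoc, Units.mul_inv,
      mul_one] at h4
    simp only [D, add_mul, h1, h2, h3, h4, mul_add]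
    abel

namespace Hecke

variable {F : Type u} [Field F] {p q : F} {n : ℕ}

theorem orbitSum_commute (hp : p ≠ 0) (hq : q ≠ 0) (h : Hecke F p q n) :
    orbitSum n (famX F p q n) * h = h * orbitSum n (famX F p q n) := by
  have H := heckeFamily F p q n
  have hz : orbitSum n (famX F p q n) ∈ latticeAlg F n (famX F p q n) :=
    Subalgebra.sum_mem _ fun j hj => by
      rw [Finset.mem_range] at hj
      exact add_mem (X_mem_latticeAlg (by omega)) (X_inv_mem_latticeAlg (by omega))
  have := mem_subalgebra (A := Subalgebra.centralizer F {orbitSum n (famX F p q n)})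
    (fun i hi => Subalgebra.mem_centralizer_iff F |>.2 fun z hz => by
      rw [Set.mem_singleton_iff.1 hz, H.orbitSum_comm_T hp hq hi])
    (fun j hj => Subalgebra.mem_centralizer_iff F |>.2 fun z hz' => by
      rw [Set.mem_singleton_iff.1 hz']
      exact latticeAlg_commute H.X_comm hz (X_mem_latticeAlg hj))
    (fun j hj => Subalgebra.mem_centralizer_iff F |>.2 fun z hz' => by
      rw [Set.mem_singleton_iff.1 hz']
      exact latticeAlg_commute H.X_comm hz (X_inv_mem_latticeAlg hj)) h
  exact Subalgebra.mem_centralizer_iff F |>.1 this _ rfl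

theorem orbitSum_succ : orbitSum (n + 1) (famX F p q (n + 1)) =
    incl F p q n (orbitSum n (famX F p q n)) +
      ((famX F p q (n + 1) (n + 1) : Hecke F p q (n + 1)) +
        ((famX F p q (n + 1) (n + 1))⁻¹ : (Hecke F p q (n + 1))ˣ)) := by
  rw [orbitSum, Finset.sum_range_succ, orbitSum, map_sum]
  congr 1
  refine Finset.sum_congr rfl fun j hj => ?_
  rw [Finset.mem_range] at hj
  have e : famX F p q (n + 1) (j + 1) = Units.map (incl F p q n : Hecke F p q n →* _)
      (famX F p q n (j + 1)) := Units.ext (incl_famX (by omega)).symm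
  rw [e, map_add, ← map_inv]
  rfl

end Hecke

/-- Schur's lemma: central elements act by scalars. -/
theorem exists_smul_eq_of_commute [IsAlgClosed F] {M : Type*} [AddCommGroup M] [Module F M]
    [Module A M] [IsScalarTower F A M] [FiniteDimensional F M] [IsSimpleModule A M] {z : A}
    (hz : ∀ h, z * h = h * z) : ∃ c : F, ∀ m : M, z • m = c • m := by
  have := IsSimpleModule.nontrivial A M
  obtain ⟨c, hc⟩ := Module.End.exists_eigenvalue (Algebra.lsmul F F M z)
  obtain ⟨m, hm⟩ := hc.exists_hasEigenvector
  let W : Submodule A M :=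
    { carrier := {m | z • m = c • m}
      zero_mem' := by simp
      add_mem' := fun {v w} hv hw => by
        change z • (v + w) = c • (v + w)
        rw [smul_add, smul_add, show z • v = c • v from hv, show z • w = c • w from hw]
      smul_mem' := fun h v hv => by
        change z • h • v = c • h • v
        rw [smul_smul, hz, mul_smul, show z • v = c • v from hv, smul_comm] }
  have hW : W = ⊤ := (eq_bot_or_eq_top W).resolve_left
    ((Submodule.ne_bot_iff _).2 ⟨m, hm.apply_eq_smul, hm.2⟩)
  refine ⟨c, fun m => ?_⟩
  have : m ∈ W := by rw [hW]; trivial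
  exact this

/-- On the span of `m` and `y m` the operator `y` is a root of `t² - d t + 1`, whose roots are
inverse to each other. A nontrivial Jordan block at `a` would require a double root, that is `a =
a⁻¹`. -/
theorem smul_eq_of_add_inv_smul_eq {M : Type*} [AddCommGroup M] [Module F M]
    [Module A M] [IsScalarTower F A M] (y : Aˣ) {a d : F} (ha0 : a ≠ 0) (ha : a⁻¹ ≠ a) (k : ℕ)
    {m : M} (h : (y : A) • m + ((y⁻¹ : Aˣ) : A) • m = d • m)
    (hk : ((Algebra.lsmul F F M (y : A) - algebraMap F (Module.End F M) a) ^ k) m = 0) :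
    (y : A) • m = a • m := by
  induction k generalizing m with
  | zero =>
    have : m = 0 := by simpa using hk
    rw [this, smul_zero, smul_zero]
  | succ k ih =>
    set m' := (y : A) • m - a • m with hm'
    have h1 : (y : A) • (y : A) • m + m = d • (y : A) • m := by
      have h1 := congrArg (fun w => (y : A) • w) h
      simp only [smul_add, smul_smul, Units.mul_inv, one_smul] at h1
      rwa [smul_comm (y : A) d m, mul_smul] at h1
    have hrel : (y : A) • m' + ((y⁻¹ : Aˣ) : A) • m' = d • m' := by
      rw [hm', smul_sub, smul_sub, smul_smul ((y⁻¹ : Aˣ) : A), Units.inv_mul, one_smul,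
        smul_comm (y : A) a m, smul_comm ((y⁻¹ : Aˣ) : A) a m, smul_sub, ← h1,
        smul_comm d a m, ← h, smul_add]
      abel
    have e : (y : A) • m' = a • m' := ih hrel (by
      rw [pow_succ, Module.End.mul_apply] at hk
      exact hk)
    by_contra hne
    have hm0 : m' ≠ 0 := fun h0 => hne (sub_eq_zero.1 h0)
    have h2 : ((y⁻¹ : Aˣ) : A) • m' = a⁻¹ • m' := by
      have h2 : m' = a⁻¹ • (y : A) • m' := by rw [e, smul_smul, inv_mul_cancel₀ ha0, one_smul]
      nth_rewrite 1 [h2]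
      rw [smul_comm, smul_smul, Units.inv_mul, one_smul]
    rw [e, h2, ← add_smul] at hrel
    -- With `m' ≠ 0` an eigenvector for `a`, the quadratic equation factors as `(y - a⁻¹)(y - a) m =
    -- 0`, making `m'` also an eigenvector for `a⁻¹`.
    have hd : a + a⁻¹ = d := smul_left_injective F hm0 hrel
    have h3 : (y : A) • m' = a⁻¹ • m' := by
      rw [hm', smul_sub, smul_sub, smul_smul a⁻¹ a, inv_mul_cancel₀ ha0, one_smul,
        smul_comm (y : A) a,
        eq_sub_of_add_eq h1, ← hd, add_smul]
      abel
    exact ha (smul_left_injective F hm0 (h3.symm.trans e))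

end Central

/-! ## The socle of `e_a M` -/

section Restriction

open Hecke

variable {F : Type u} [Field F] {p q : F} {n : ℕ} {a : Fˣ}
  {M : Type*} [AddCommGroup M] [Module F M] [Module (Hecke F p q (n + 1)) M]
  [IsScalarTower F (Hecke F p q (n + 1)) M]

variable (p q n a M) in
/-- The inclusion `e_a M → M`. -/
noncomputable def eIncl : eFun p q n a M →ₗ[F] M where
  toFun m := Subtype.val (p := fun m => m ∈ delta p q n a M) m
  map_add' _ _ := rfl
  map_smul' _ _ := rfl

theorem eIncl_smul (h : Hecke F p q n) (m : eFun p q n a M) :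
    eIncl p q n a M (h • m) = incl F p q n h • eIncl p q n a M m := by
  have e : parIncl F p q n (h ⊗ₜ 1) = incl F p q n h := by
    rw [parIncl_tmul, map_one, mul_one]
  rw [← e]
  rfl

theorem eIncl_injective : Function.Injective (eIncl p q n a M) := Subtype.val_injective

theorem eIncl_mem (m : eFun p q n a M) : eIncl p q n a M m ∈ Module.End.maxGenEigenspace
    (Algebra.lsmul F F M (X F p q (Fin.last (n + 1)) : Hecke F p q (n + 1))) (a : F) :=
  Subtype.prop (p := fun m => m ∈ delta p q n a M) m

theorem exists_eIncl_eq {m : M} (h : (famX F p q (n + 1) (n + 1) : Hecke F p q (n + 1)) • m =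
    (a : F) • m) : ∃ m' : eFun p q n a M, eIncl p q n a M m' = m := by
  rw [← X_last_eq] at h
  exact ⟨(⟨m, mem_maxGenEigenspace_of_smul_eq (M := M) h⟩ : delta p q n a M), rfl⟩

variable {N : Type*} [AddCommGroup N] [Module F N] [Module (Hecke F p q n) N]
  [IsScalarTower F (Hecke F p q n) N]

omit [IsScalarTower F (Hecke F p q (n + 1)) M] [Module (Hecke F p q n) N]
  [IsScalarTower F (Hecke F p q n) N] in
theorem generates_of_ne_zero [IsSimpleModule (Hecke F p q (n + 1)) M] {φ : N →ₗ[F] M}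
    (h : φ ≠ 0) (W : Submodule (Hecke F p q (n + 1)) M) (hW : ∀ v, φ v ∈ W) : W = ⊤ := by
  refine (eq_bot_or_eq_top W).resolve_left fun h0 => h (LinearMap.ext fun v => ?_)
  have := hW v
  rwa [h0, Submodule.mem_bot] at this

/-- The inclusion into `M` of a submodule of `e_a M`. -/
noncomputable def subIncl (K : Submodule (Hecke F p q n) (eFun p q n a M)) : K →ₗ[F] M :=
  eIncl p q n a M ∘ₗ K.subtype.restrictScalars F

theorem subIncl_injective (K : Submodule (Hecke F p q n) (eFun p q n a M)) :
    Function.Injective (subIncl K) := eIncl_injective.comp Subtype.val_injective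

theorem subIncl_ne_zero (K : Submodule (Hecke F p q n) (eFun p q n a M)) [Nontrivial K] :
    subIncl K ≠ 0 := fun h => by
  obtain ⟨k, hk⟩ := exists_ne (0 : K)
  exact hk (subIncl_injective K (by rw [h]; rfl))

variable [IsAlgClosed F] [FiniteDimensional F M] [IsSimpleModule (Hecke F p q (n + 1)) M]
  (hp : p ≠ 0) (hq : q ≠ 0) (ha : (a : F)⁻¹ ≠ a)

include hp hq ha

/-- By definition `X_{n+1}` has only a generalized eigenvalue `a` on `e_a M`. On a simple submodule,
Schur's lemma for the central orbit sums of both algebras makes `X_{n+1} + X_{n+1}⁻¹` a scalar,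
which removes the nilpotent part. -/
theorem isEigenHom_subIncl (K : Submodule (Hecke F p q n) (eFun p q n a M))
    [IsSimpleModule (Hecke F p q n) K] : IsEigenHom p q (a : F) n (subIncl K) where
  map_smul h k := eIncl_smul h (k : eFun p q n a M)
  X_smul k := by
    have hK : FiniteDimensional F K :=
      FiniteDimensional.of_injective (subIncl K) (subIncl_injective K)
    obtain ⟨c, hc⟩ := exists_smul_eq_of_commute (F := F) (M := M)
      (orbitSum_commute (F := F) (n := n + 1) hp hq)
    obtain ⟨d, hd⟩ := exists_smul_eq_of_commute (F := F) (M := K)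
      (orbitSum_commute (F := F) (n := n) hp hq)
    obtain ⟨k', hk'⟩ := (Module.End.mem_maxGenEigenspace _ _ _).1
      (eIncl_mem (k : eFun p q n a M))
    refine smul_eq_of_add_inv_smul_eq (d := c - d) _ a.ne_zero ha k' ?_ (by
      rw [← X_last_eq]; exact hk')
    have h1 := hc (subIncl K k)
    have h2 : incl F p q n (orbitSum n (famX F p q n)) • subIncl K k = d • subIncl K k := by
      rw [← (subIncl K).map_smul, ← hd]
      exact (eIncl_smul _ (k : eFun p q n a M)).symm
    rw [orbitSum_succ, add_smul, h2, add_smul] at h1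
    rw [sub_smul, ← h1]
    abel

variable (hqq : q - q⁻¹ ≠ 0)

include hqq

theorem epsilon_eq_of_simple (K : Submodule (Hecke F p q n) (eFun p q n a M))
    [IsSimpleModule (Hecke F p q n) K] :
    epsilon p q (n + 1) a M = epsilon p q n a K + 1 :=
  have := IsSimpleModule.nontrivial (Hecke F p q n) K
  (isEigenHom_subIncl hp hq ha K).epsilon_eq hp hq hqq ha (subIncl_injective K)
    (generates_of_ne_zero (subIncl_ne_zero K))

/-- By the shuffle lemma both `K` and `K'` contain a common nonzero vector, namely any joint
eigenvector in `M` for the longest tail. As `K` is simple, it lies in `K'`. Thus `e_a M` has at most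
one simple submodule, not merely one up to isomorphism. -/
theorem le_of_simple (K K' : Submodule (Hecke F p q n) (eFun p q n a M))
    [IsSimpleModule (Hecke F p q n) K] [IsSimpleModule (Hecke F p q n) K'] : K ≤ K' := by
  have := IsSimpleModule.nontrivial (Hecke F p q n) K
  have := IsSimpleModule.nontrivial (Hecke F p q n) K'
  have := IsSimpleModule.nontrivial (Hecke F p q (n + 1)) M
  have e := epsilon_eq_of_simple hp hq ha hqq K
  have e' := epsilon_eq_of_simple hp hq ha hqq K'
  obtain ⟨v, hv, hv0⟩ := Submodule.exists_mem_ne_zero_of_ne_bot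
    (tailEigenspace_epsilon_ne_bot (p := p) (q := q) (n := n + 1) (a := a) (M := M))
  obtain ⟨k, -, hk⟩ := (isEigenHom_subIncl hp hq ha K).exists_of_mem_tailEigenspace hp hq hqq ha
    (subIncl_injective K) (generates_of_ne_zero (subIncl_ne_zero K)) (v := v)
    (by rwa [e, Nat.add_sub_add_right] at hv)
  obtain ⟨k', -, hk'⟩ := (isEigenHom_subIncl hp hq ha K').exists_of_mem_tailEigenspace hp hq hqq ha
    (subIncl_injective K') (generates_of_ne_zero (subIncl_ne_zero K')) (v := v)
    (by rwa [e', Nat.add_sub_add_right] at hv)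
  have hkk : (k : eFun p q n a M) = k' := eIncl_injective (hk.trans hk'.symm)
  have hat : IsAtom K := isSimpleModule_iff_isAtom.1 inferInstance
  refine inf_eq_left.1 ((hat.le_iff.1 inf_le_left).resolve_left ?_)
  refine (Submodule.ne_bot_iff _).2 ⟨k, ⟨k.2, hkk ▸ k'.2⟩, fun h0 => hv0 ?_⟩
  rw [← hk]
  change eIncl p q n a M k = 0
  rw [h0, map_zero]

theorem eTilde_eq_of_simple (K : Submodule (Hecke F p q n) (eFun p q n a M))
    [IsSimpleModule (Hecke F p q n) K] : eTilde p q n a M = K :=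
  le_antisymm (sSup_le fun K' (_ : IsSimpleModule _ K') => le_of_simple hp hq ha hqq K' K)
    (le_sSup (show IsSimpleModule _ K from inferInstance))

omit hp hq ha hqq [IsAlgClosed F] [IsSimpleModule (Hecke F p q (n + 1)) M] in
theorem exists_simple_of_epsilon_pos [Nontrivial M] (h : 0 < epsilon p q (n + 1) a M) :
    ∃ K : Submodule (Hecke F p q n) (eFun p q n a M), IsSimpleModule (Hecke F p q n) K := by
  obtain ⟨v, hv, hv0⟩ := Submodule.exists_mem_ne_zero_of_ne_bot
    (tailEigenspace_epsilon_ne_bot (p := p) (q := q) (n := n + 1) (a := a) (M := M))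
  obtain ⟨m, hm⟩ := exists_eIncl_eq (hv (n + 1) (by omega) (le_refl _))
  have hfin : FiniteDimensional F (eFun p q n a M) :=
    FiniteDimensional.of_injective (eIncl p q n a M) eIncl_injective
  have hart : IsArtinian (Hecke F p q n) (eFun p q n a M) := isArtinian_of_tower F inferInstance
  have hnt : Nontrivial (eFun p q n a M) := ⟨m, 0, fun h0 => hv0 (by rw [← hm, h0, map_zero])⟩
  obtain ⟨K, hK, -⟩ := (eq_bot_or_exists_atom_le (⊤ : Submodule (Hecke F p q n)
    (eFun p q n a M))).resolve_left top_ne_bot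
  exact ⟨K, isSimpleModule_iff_isAtom.2 hK⟩

theorem eTilde_of_epsilon_pos (h : 0 < epsilon p q (n + 1) a M) :
    IsSimpleModule (Hecke F p q n) (eTilde p q n a M) ∧
      epsilon p q n a (eTilde p q n a M) + 1 = epsilon p q (n + 1) a M := by
  have := IsSimpleModule.nontrivial (Hecke F p q (n + 1)) M
  obtain ⟨K, hK⟩ := exists_simple_of_epsilon_pos h
  have hs : IsSimpleModule (Hecke F p q n) (eTilde p q n a M) := by
    rw [eTilde_eq_of_simple hp hq ha hqq K]; exact hK
  exact ⟨hs, (epsilon_eq_of_simple hp hq ha hqq (eTilde p q n a M)).symm⟩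

theorem eTilde_of_epsilon_eq_zero (h : epsilon p q (n + 1) a M = 0) :
    Subsingleton (eTilde p q n a M) := by
  have : eTilde p q n a M = ⊥ := by
    refine eq_bot_iff.2 (sSup_le fun K hK => ?_)
    have hK : IsSimpleModule (Hecke F p q n) K := hK
    have := epsilon_eq_of_simple hp hq ha hqq K
    omega
  rw [this]
  infer_instance

end Restriction

/-! ## The cosocle of `f_a N` -/

theorem finiteDimensional_quotient {F A M : Type*} [Field F] [Ring A] [Algebra F A]
    [AddCommGroup M] [Module F M] [Module A M] [IsScalarTower F A M] [FiniteDimensional F M]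
    (W : Submodule A M) : FiniteDimensional F (M ⧸ W) :=
  Module.Finite.of_surjective (W.mkQ.restrictScalars F) W.mkQ_surjective

section Cosocle

open Hecke

variable {F : Type u} [Field F] [IsAlgClosed F] {p q : F} {n : ℕ} {a : Fˣ}
  {N : Type*} [AddCommGroup N] [Module F N] [Module (Hecke F p q n) N]
  [IsScalarTower F (Hecke F p q n) N] [IsSimpleModule (Hecke F p q n) N]
  {M : Type*} [AddCommGroup M] [Module F M] [Module (Hecke F p q (n + 1)) M]
  [IsScalarTower F (Hecke F p q (n + 1)) M]
  (hp : p ≠ 0) (hq : q ≠ 0) (ha : (a : F)⁻¹ ≠ a)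

omit [IsAlgClosed F] [IsScalarTower F (Hecke F p q n) N]
  [IsScalarTower F (Hecke F p q (n + 1)) M] in
theorem IsEigenHom.comap_eq_bot {φ : N →ₗ[F] M} (hφ : IsEigenHom p q (a : F) n φ)
    (hgen : ∀ W : Submodule (Hecke F p q (n + 1)) M, (∀ v, φ v ∈ W) → W = ⊤)
    {W : Submodule (Hecke F p q (n + 1)) M} (hW : W ≠ ⊤) {v : N} (hv : φ v ∈ W) : v = 0 := by
  have h := (eq_bot_or_eq_top (hφ.comap W)).resolve_right fun h => hW (hgen W fun v => by
    rw [← hφ.mem_comap, h]; trivial)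
  have : v ∈ hφ.comap W := hv
  rwa [h] at this

include hp hq ha

/-- A module generated by the image of a simple module has at most one maximal submodule. -/
theorem IsEigenHom.coatom_eq [FiniteDimensional F M] (hqq : q - q⁻¹ ≠ 0) {φ : N →ₗ[F] M}
    (hφ : IsEigenHom p q (a : F) n φ)
    (hgen : ∀ W : Submodule (Hecke F p q (n + 1)) M, (∀ v, φ v ∈ W) → W = ⊤)
    {J J' : Submodule (Hecke F p q (n + 1)) M} (hJ : IsCoatom J) (hJ' : IsCoatom J') :
    J = J' := by
  by_contra hne
  have hnt : Nontrivial N := IsSimpleModule.nontrivial (Hecke F p q n) N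
  let π := (J ⊓ J').mkQ
  have hπ : ∀ m, π m = 0 ↔ m ∈ J ∧ m ∈ J' := fun m => Submodule.Quotient.mk_eq_zero _
  have hψ := hφ.comp π
  have hψinj : Function.Injective ((π.restrictScalars F).comp φ) := by
    rw [injective_iff_map_eq_zero]
    intro v hv
    exact hφ.comap_eq_bot hgen hJ.1 ((hπ _).1 hv).1
  have hψgen : ∀ W : Submodule (Hecke F p q (n + 1)) (M ⧸ J ⊓ J'),
      (∀ v, (π.restrictScalars F).comp φ v ∈ W) → W = ⊤ := by
    intro W hW
    have := hgen (W.comap π) hW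
    refine eq_top_iff.2 fun z _ => ?_
    obtain ⟨m, rfl⟩ := Submodule.mkQ_surjective _ z
    have hm : m ∈ W.comap π := by rw [this]; trivial
    exact hm
  have hfin : FiniteDimensional F (M ⧸ J ⊓ J') :=
    finiteDimensional_quotient _
  obtain ⟨u, hu, hu0⟩ := Submodule.exists_mem_ne_zero_of_ne_bot
    (tailEigenspace_epsilon_ne_bot (p := p) (q := q) (n := n) (a := a) (M := N))
  have hsup : J ⊔ J' = ⊤ := hJ.sup_eq_top_of_ne hJ' hne
  -- Modulo `J ∩ J'` the component `w ∈ J'` of the eigenvector `φ u` is again a joint eigenvector: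
  -- `(X_l - a) w` lies in `J'` and equals `-(X_l - a) j`, which lies in `J`.
  obtain ⟨j, hj, w, hw, hjw⟩ := Submodule.mem_sup.1 (show φ u ∈ J ⊔ J' by rw [hsup]; trivial)
  have hπw : π w ∈ tailEigenspace p q (n + 1) (a : F) (M ⧸ J ⊓ J') (n - epsilon p q n a N) := by
    intro l h1 h2
    have e : (famX F p q (n + 1) l : Hecke F p q (n + 1)) • π w - (a : F) • π w =
        π ((famX F p q (n + 1) l : Hecke F p q (n + 1)) • w - (a : F) • w) := by
      rw [map_sub, π.map_smul]
      congr 1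
    rw [← sub_eq_zero, e, hπ]
    have hJF : ∀ (J : Submodule (Hecke F p q (n + 1)) M) (v : M), v ∈ J →
        (famX F p q (n + 1) l : Hecke F p q (n + 1)) • v - (a : F) • v ∈ J := fun J v hv =>
      sub_mem (J.smul_mem _ hv) ((J.restrictScalars F).smul_mem _ hv)
    refine ⟨?_, hJF J' w hw⟩
    have h3 := tailEigenspace_map hφ hu l h1 h2
    have h4 := hJF J j hj
    rw [← hjw, smul_add, smul_add] at h3
    have h5 : (famX F p q (n + 1) l : Hecke F p q (n + 1)) • w - (a : F) • w =
        -((famX F p q (n + 1) l : Hecke F p q (n + 1)) • j - (a : F) • j) := by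
      rw [eq_neg_iff_add_eq_zero, ← sub_eq_zero.2 h3]
      abel
    rw [h5]
    exact neg_mem h4
  -- By the shuffle lemma `w` comes from `N` modulo `J ∩ J'`. But `N` meets neither `J` nor `J'`, so
  -- first `u' = 0`, then `w ∈ J`, and finally `φ u ∈ J`, a contradiction.
  obtain ⟨u', hu', e⟩ := hψ.exists_of_mem_tailEigenspace hp hq hqq ha hψinj hψgen hπw
  have h6 : φ u' - w ∈ J ∧ φ u' - w ∈ J' := (hπ _).1 (by
    rw [map_sub, sub_eq_zero]; exact e)
  have h7 : u' = 0 := hφ.comap_eq_bot hgen hJ'.1 (by simpa using add_mem h6.2 hw)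
  rw [h7, map_zero, zero_sub, neg_mem_iff] at h6
  exact hu0 (hφ.comap_eq_bot hgen hJ.1 (by rw [← hjw]; exact add_mem hj h6.1))

variable [FiniteDimensional F N] (hqr : ∀ k : ℕ, 0 < k → q ^ k ≠ 1) (hqq : q - q⁻¹ ≠ 0)

omit [IsAlgClosed F] [IsSimpleModule (Hecke F p q n) N] ha in
theorem finiteDimensional_fFun : FiniteDimensional F (fFun p q n a N) :=
  (isEigenHom_toInd a).finiteDimensional hp hq (toInd_generates a)

include hqr hqq

/-- `f_a N` is nonzero because `N` embeds in it, so it has a maximal submodule; this is the only one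
and hence equals the radical. -/
theorem isCoatom_jacobson_fFun :
    IsCoatom (Module.jacobson (Hecke F p q (n + 1)) (fFun p q n a N)) := by
  have hnt : Nontrivial N := IsSimpleModule.nontrivial (Hecke F p q n) N
  have hfin : FiniteDimensional F (fFun p q n a N) := finiteDimensional_fFun hp hq
  have hnoeth : IsNoetherian (Hecke F p q (n + 1)) (fFun p q n a N) :=
    isNoetherian_of_tower F inferInstance
  have hntf : Nontrivial (fFun p q n a N) := (toInd_injective a hp hq hqr).nontrivial
  obtain ⟨J, hJ, -⟩ := (eq_top_or_exists_le_coatom (⊥ : Submodule (Hecke F p q (n + 1))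
    (fFun p q n a N))).resolve_left bot_ne_top
  have : Module.jacobson (Hecke F p q (n + 1)) (fFun p q n a N) = J :=
    le_antisymm (sInf_le hJ) (le_sInf fun J' hJ' =>
      ((isEigenHom_toInd a).coatom_eq hp hq ha hqq (toInd_generates a) hJ hJ').le)
  rwa [this]

theorem isSimpleModule_fTilde : IsSimpleModule (Hecke F p q (n + 1)) (fTilde p q n a N) :=
  isSimpleModule_iff_isCoatom.2 (isCoatom_jacobson_fFun hp hq ha hqr hqq)

omit [IsAlgClosed F] [IsSimpleModule (Hecke F p q n) N] ha hqr hqq in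
theorem finiteDimensional_fTilde : FiniteDimensional F (fTilde p q n a N) :=
  have := finiteDimensional_fFun (n := n) (a := a) (N := N) hp hq
  finiteDimensional_quotient _

variable [FiniteDimensional F M] [IsSimpleModule (Hecke F p q (n + 1)) M]

-- Frobenius reciprocity gives a surjection from `f_a N` onto the simple module `M`, and its kernel
-- can only be the unique maximal submodule.
omit [FiniteDimensional F M] in
theorem IsEigenHom.nonempty_fTilde_equiv {φ : N →ₗ[F] M} (hφ : IsEigenHom p q (a : F) n φ)
    (h0 : φ ≠ 0) : Nonempty (fTilde p q n a N ≃ₗ[Hecke F p q (n + 1)] M) := by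
  obtain ⟨g, hg⟩ := hφ.exists_lift
  have hsurj : Function.Surjective g := LinearMap.range_eq_top.1
    (generates_of_ne_zero h0 _ fun v => ⟨_, hg v⟩)
  have hker : IsCoatom (LinearMap.ker g) := by
    rw [← isSimpleModule_iff_isCoatom]
    exact IsSimpleModule.congr (g.quotKerEquivOfSurjective hsurj)
  have hfin := finiteDimensional_fFun (n := n) (a := a) (N := N) hp hq
  have e := (isEigenHom_toInd a).coatom_eq hp hq ha hqq (toInd_generates a)
    (isCoatom_jacobson_fFun (a := a) (N := N) hp hq ha hqr hqq) hker
  exact ⟨(Submodule.quotEquivOfEq _ _ e).trans (g.quotKerEquivOfSurjective hsurj)⟩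

/-- `ẽ_a M ≅ N` if and only if `f̃_a N ≅ M`. -/
theorem nonempty_eTilde_equiv_iff :
    Nonempty (eTilde p q n a M ≃ₗ[Hecke F p q n] N) ↔
      Nonempty (fTilde p q n a N ≃ₗ[Hecke F p q (n + 1)] M) := by
  constructor
  · rintro ⟨e⟩
    have hs : IsSimpleModule (Hecke F p q n) (eTilde p q n a M) := IsSimpleModule.congr e
    have hK := isEigenHom_subIncl hp hq ha (eTilde p q n a M)
    have hφ : IsEigenHom p q (a : F) n
        (subIncl (eTilde p q n a M) ∘ₗ e.symm.toLinearMap.restrictScalars F) :=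
      { map_smul := fun h v => by
          change subIncl _ (e.symm (h • v)) = _ • subIncl _ (e.symm v)
          rw [map_smul, hK.map_smul]
        X_smul := fun v => hK.X_smul _ }
    have hnt := IsSimpleModule.nontrivial (Hecke F p q n) N
    refine hφ.nonempty_fTilde_equiv hp hq ha hqr hqq fun h => ?_
    obtain ⟨v, hv⟩ := exists_ne (0 : N)
    have h1 : subIncl (eTilde p q n a M) (e.symm v) = 0 := DFunLike.congr_fun h v
    rw [← map_zero (subIncl (eTilde p q n a M))] at h1
    exact hv (e.symm.injective ((subIncl_injective _ h1).trans (map_zero e.symm).symm))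
  · rintro ⟨e⟩
    have hJ := isCoatom_jacobson_fFun (n := n) (a := a) (N := N) hp hq ha hqr hqq
    let g : fFun p q n a N →ₗ[Hecke F p q (n + 1)] M := e.toLinearMap ∘ₗ Submodule.mkQ _
    have hφ := (isEigenHom_toInd (N := N) a).comp g
    have hinj : Function.Injective ((g.restrictScalars F).comp (toInd a p q n N)) := by
      rw [injective_iff_map_eq_zero]
      intro v hv
      have h1 : Submodule.mkQ (Module.jacobson (Hecke F p q (n + 1)) (fFun p q n a N))
        (toInd a p q n N v) = 0 := e.injective (hv.trans (map_zero e).symm)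
      exact (isEigenHom_toInd a).comap_eq_bot (toInd_generates a) hJ.1
        ((Submodule.Quotient.mk_eq_zero _).1 h1)
    -- The copy of `N` inside `f̃_a N ≅ M` consists of `a`-eigenvectors of `X_{n+1}`, so it lies in
    -- `e_a M`; being simple, it is the whole socle.
    choose f hf using fun v => exists_eIncl_eq (hφ.X_smul v)
    let f' : N →ₗ[Hecke F p q n] eFun p q n a M :=
      { toFun := f
        map_add' := fun v w => eIncl_injective (by rw [map_add, hf, hf, hf, map_add])
        map_smul' := fun h v => eIncl_injective (by
          rw [RingHom.id_apply, eIncl_smul, hf, hf, hφ.map_smul]) }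
    have hf' : Function.Injective f' := fun v w h => hinj (by
      rw [← hf v, ← hf w]; exact congrArg _ h)
    let e' := LinearEquiv.ofInjective f' hf'
    have hs : IsSimpleModule (Hecke F p q n) (LinearMap.range f') := IsSimpleModule.congr e'.symm
    rw [eTilde_eq_of_simple hp hq ha hqq (LinearMap.range f')]
    exact ⟨e'.symm⟩

end Cosocle

/-! ## Partial bijections -/

/-- A relation which is a partial function in both directions defines a partial bijection. -/
theorem exists_pequiv_of_relation {α β : Type*} (r : α → β → Prop)
    (h1 : ∀ a b b', r a b → r a b' → b = b') (h2 : ∀ a a' b, r a b → r a' b → a = a') :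
    ∃ Φ : α ≃. β, ∀ a b, Φ a = some b ↔ r a b := by
  classical
  let f : α → Option β := fun a => if h : ∃ b, r a b then some h.choose else none
  let g : β → Option α := fun b => if h : ∃ a, r a b then some h.choose else none
  have hf : ∀ a b, f a = some b ↔ r a b := by
    intro a b
    by_cases h : ∃ b, r a b
    · simp only [f, dif_pos h, Option.some.injEq]
      exact ⟨fun e => e ▸ h.choose_spec, fun hr => h1 a _ _ h.choose_spec hr⟩
    · simp only [f, dif_neg h, reduceCtorEq, false_iff]
      exact fun hr => h ⟨b, hr⟩
  have hg : ∀ a b, g b = some a ↔ r a b := by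
    intro a b
    by_cases h : ∃ a, r a b
    · simp only [g, dif_pos h, Option.some.injEq]
      exact ⟨fun e => e ▸ h.choose_spec, fun hr => h2 _ _ b h.choose_spec hr⟩
    · simp only [g, dif_neg h, reduceCtorEq, false_iff]
      exact fun hr => h ⟨a, hr⟩
  exact ⟨⟨f, g, fun a b => (hg a b).trans (hf a b).symm⟩, hf⟩

theorem mainTheorem6 {F : Type u} [Field F] [IsAlgClosed F] (hF : ringChar F ≠ 2)
    (p q : F) (hp0 : p ≠ 0) (hq0 : q ≠ 0)
    (hp : ∀ k : ℕ, 0 < k → p ^ k ≠ 1) (hq : ∀ k : ℕ, 0 < k → q ^ k ≠ 1)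
    (n : ℕ) (a : Fˣ) (ha : (a : F) ≠ 1) (ha' : (a : F) ≠ -1) :
    -- `soc e_a M` is irreducible with `ε_a` dropping by one
    (∀ (M : Type v) [AddCommGroup M] [Module F M] [Module (Hecke F p q (n + 1)) M]
        [IsScalarTower F (Hecke F p q (n + 1)) M] [FiniteDimensional F M]
        [IsSimpleModule (Hecke F p q (n + 1)) M],
      (0 < epsilon p q (n + 1) a M →
        IsSimpleModule (Hecke F p q n) (eTilde p q n a M) ∧
        epsilon p q n a (eTilde p q n a M) + 1 = epsilon p q (n + 1) a M) ∧
      (epsilon p q (n + 1) a M = 0 → Subsingleton (eTilde p q n a M))) ∧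
    -- `f̃_a N` is irreducible
    (∀ (N : Type w) [AddCommGroup N] [Module F N] [Module (Hecke F p q n) N]
        [IsScalarTower F (Hecke F p q n) N] [FiniteDimensional F N]
        [IsSimpleModule (Hecke F p q n) N],
      IsSimpleModule (Hecke F p q (n + 1)) (fTilde p q n a N) ∧
      FiniteDimensional F (fTilde p q n a N)) ∧
    -- `ẽ_a M ≅ N` if and only if `f̃_a N ≅ M`
    (∀ (M : Type v) [AddCommGroup M] [Module F M] [Module (Hecke F p q (n + 1)) M]
        [IsScalarTower F (Hecke F p q (n + 1)) M] [FiniteDimensional F M]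
        [IsSimpleModule (Hecke F p q (n + 1)) M]
        (N : Type w) [AddCommGroup N] [Module F N] [Module (Hecke F p q n) N]
        [IsScalarTower F (Hecke F p q n) N] [FiniteDimensional F N]
        [IsSimpleModule (Hecke F p q n) N],
      Nonempty (eTilde p q n a M ≃ₗ[Hecke F p q n] N) ↔
        Nonempty (fTilde p q n a N ≃ₗ[Hecke F p q (n + 1)] M)) ∧
    -- `ẽ_a` and `f̃_a` induce mutually inverse partial bijections on isomorphism classes,
    -- `ẽ_a` being defined exactly where `ε_a > 0` and `f̃_a` being defined everywhere
    (∃ Φ : IrrClass F p q (n + 1) ≃. IrrClass F p q n,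
      (∀ (M : IrrRep F p q (n + 1)) (N : IrrRep F p q n),
        (Φ M.cls = some N.cls ↔
          Nonempty (eTilde p q n a M.carrier ≃ₗ[Hecke F p q n] N.carrier)) ∧
        (Φ.symm N.cls = some M.cls ↔
          Nonempty (fTilde p q n a N.carrier ≃ₗ[Hecke F p q (n + 1)] M.carrier))) ∧
      (∀ M : IrrRep F p q (n + 1),
        (Φ M.cls).isSome ↔ 0 < epsilon p q (n + 1) a M.carrier) ∧
      (∀ N : IrrRep F p q n, (Φ.symm N.cls).isSome)) := by
  -- This form of `a ≠ ±1` is used twice: to discard the words through `T_0` in the shuffle lemma,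
  -- and to make `X_{n+1}` a scalar on the socle.
  have ha2 : (a : F)⁻¹ ≠ a := fun h => by
    have h1 : (a : F) * a = 1 := by
      nth_rewrite 1 [← h]
      exact inv_mul_cancel₀ a.ne_zero
    rcases mul_self_eq_one_iff.1 h1 with h2 | h2
    · exact ha h2
    · exact ha' h2
  have hqq : q - q⁻¹ ≠ 0 := fun h => hq 2 two_pos (by
    rw [sq]
    nth_rewrite 2 [sub_eq_zero.1 h]
    exact mul_inv_cancel₀ hq0)
  have hiff := fun (M : IrrRep F p q (n + 1)) (N : IrrRep F p q n) =>
    nonempty_eTilde_equiv_iff (M := M.carrier) (N := N.carrier) (a := a) (n := n) hp0 hq0 ha2 hq hqq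
  refine ⟨fun M _ _ _ _ _ _ => ⟨eTilde_of_epsilon_pos hp0 hq0 ha2 hqq,
    eTilde_of_epsilon_eq_zero hp0 hq0 ha2 hqq⟩, fun N _ _ _ _ _ _ =>
    ⟨isSimpleModule_fTilde hp0 hq0 ha2 hq hqq, finiteDimensional_fTilde hp0 hq0⟩,
    fun M _ _ _ _ _ _ N _ _ _ _ _ _ => nonempty_eTilde_equiv_iff hp0 hq0 ha2 hq hqq, ?_⟩
  let r : IrrClass F p q (n + 1) → IrrClass F p q n → Prop := fun m k =>
    ∃ (M : IrrRep F p q (n + 1)) (N : IrrRep F p q n), M.cls = m ∧ N.cls = k ∧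
      Nonempty (eTilde p q n a M.carrier ≃ₗ[Hecke F p q n] N.carrier)
  have hr : ∀ (M : IrrRep F p q (n + 1)) (N : IrrRep F p q n), r M.cls N.cls ↔
      Nonempty (eTilde p q n a M.carrier ≃ₗ[Hecke F p q n] N.carrier) := by
    refine fun M N => ⟨?_, fun h => ⟨M, N, rfl, rfl, h⟩⟩
    rintro ⟨M', N', hM, hN, ⟨e⟩⟩
    obtain ⟨i⟩ : Nonempty (M'.carrier ≃ₗ[Hecke F p q (n + 1)] M.carrier) := Quotient.exact hM
    obtain ⟨j⟩ : Nonempty (N'.carrier ≃ₗ[Hecke F p q n] N.carrier) := Quotient.exact hN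
    -- The module `M'` is replaced by `M` on the side of `f̃_a`, where it occurs only as the target
    -- of an isomorphism; functoriality of `ẽ_a` is not needed.
    obtain ⟨e'⟩ := (hiff M' N).1 ⟨e.trans j⟩
    exact (hiff M N).2 ⟨e'.trans i⟩
  obtain ⟨Φ, hΦ⟩ := exists_pequiv_of_relation r (by
    intro m k k' h h'
    induction m using Quotient.inductionOn with | _ M
    induction k using Quotient.inductionOn with | _ N
    induction k' using Quotient.inductionOn with | _ N'
    obtain ⟨e⟩ := (hr M N).1 h
    obtain ⟨e'⟩ := (hr M N').1 h'
    exact Quotient.sound ⟨e.symm.trans e'⟩) (by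
    intro m m' k h h'
    induction m using Quotient.inductionOn with | _ M
    induction m' using Quotient.inductionOn with | _ M'
    induction k using Quotient.inductionOn with | _ N
    -- Injectivity is seen after passing to `f̃_a`: both modules are isomorphic to `f̃_a N`.
    obtain ⟨e⟩ := (hiff M N).1 ((hr M N).1 h)
    obtain ⟨e'⟩ := (hiff M' N).1 ((hr M' N).1 h')
    exact Quotient.sound ⟨e.symm.trans e'⟩)
  refine ⟨Φ, fun M N => ⟨(hΦ _ _).trans (hr M N), ?_⟩, fun M => ?_, fun N => ?_⟩
  · rw [← Option.mem_def, PEquiv.mem_iff_mem, Option.mem_def, hΦ, hr, hiff]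
  · rw [Option.isSome_iff_exists]
    constructor
    · rintro ⟨k, hk⟩
      induction k using Quotient.inductionOn with | _ N
      obtain ⟨e⟩ := (hr M N).1 ((hΦ _ _).1 hk)
      refine Nat.pos_of_ne_zero fun h0 => ?_
      have := eTilde_of_epsilon_eq_zero hp0 hq0 ha2 hqq h0
      have := e.symm.toEquiv.subsingleton
      exact not_subsingleton_iff_nontrivial.2
        (IsSimpleModule.nontrivial (Hecke F p q n) N.carrier) this
    · intro h
      have hs := (eTilde_of_epsilon_pos hp0 hq0 ha2 hqq h).1
      have hfin : FiniteDimensional F (eTilde p q n a M.carrier) :=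
        FiniteDimensional.of_injective (subIncl _) (subIncl_injective _)
      let N : IrrRep F p q n := { carrier := eTilde p q n a M.carrier }
      exact ⟨N.cls, (hΦ _ _).2 ((hr M N).2 ⟨LinearEquiv.refl _ _⟩)⟩
  · have hs := isSimpleModule_fTilde (n := n) (a := a) (N := N.carrier) hp0 hq0 ha2 hq hqq
    have hfin := finiteDimensional_fTilde (n := n) (a := a) (N := N.carrier) hp0 hq0
    let M : IrrRep F p q (n + 1) := { carrier := fTilde p q n a N.carrier }
    refine Option.isSome_iff_exists.2 ⟨M.cls, ?_⟩
    rw [← Option.mem_def, PEquiv.mem_iff_mem, Option.mem_def, hΦ, hr, hiff]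
    exact ⟨LinearEquiv.refl _ _⟩
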